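/- Algorithms are randomized: programs of a random access machine with natural-number variables and arrays that can toss fair coins, in which an addition, a truncated subtraction, an array access, a coin toss or a test takes one step (this is polynomially equivalent to probabilistic Turing machines). An algorithm runs in time $T$ if on every input it halts within $T$ steps, whatever the outcomes of the coin tosses. Graphs on $n$ vertices are given by their adjacency matrix. Let $\mathcal{G}(n,\tfrac12)$ be the Erdős–Rényi distribution on $n$-vertex graphs with edge probability $\tfrac12$, and let $\mathcal{G}(n,\tfrac12,\kappa)$ be the distribution obtained from it by adding a clique on an independent, uniformly random set of $\kappa$ vertices. **Strongish Planted Clique Hypothesis (SPCH).** There is a constant $\delta\in(0,\tfrac12)$ such that no $n^{o(\log n)}$-time algorithm $\mathcal{A}$ satisfies, for all sufficiently large $n$, both $$\Pr_{G\sim\mathcal{G}(n,\frac12,\lceil n^\delta\rceil)}[\mathcal{A}(G)=1]\ge \tfrac23 \quad\text{and}\quad \Pr_{G\sim\mathcal{G}(n,\frac12)}[\mathcal{A}(G)=1]\le\tfrac13,$$ where the probabilities are over $G$ and the coin tosses of $\mathcal{A}$. **$k$-Biclique.** The input is a graph $G$ and a positive integer $k$ such that $G$ is promised to contain the complete bipartite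 graph $K_{k,k}$ as a (not necessarily induced) subgraph. For a real $C>0$, an algorithm approximates $k$-Biclique to within a factor $C$ if on every input that satisfies the promise it outputs, with probability at least $\tfrac23$, a copy of $K_{t,t}$ in $G$ for some $t\ge k/C$. (Nothing is required of the output on other inputs.) **Corollary.** Assume SPCH. For every constant $C>0$, there is no algorithm that approximates $k$-Biclique to within a factor $C$ and runs, on all inputs consisting of an $n$-vertex graph with $n\ge1$ and a positive integer $k$, in time $f(k)\cdot n^{g(k)}$ for some function $f$ and some function $g$ with $g(k)=o(k)$ as $k\to\infty$. Furthermore, this remains true if the promise is strengthened to: $G$ contains a clique on $2k$ vertices. -/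

import Mathlib

open Filter Asymptotics
open scoped ENNReal SimpleGraph

/-! ### Randomized algorithms

An algorithm is a program of a random access machine that can toss fair coins. The machine has
natural-number variables `x₀, x₁, …` and infinite arrays `a₀, a₁, …` of natural numbers; addition,
truncated subtraction, array access, a coin toss and a test each take one step. (There is no
unit-cost multiplication, so that `t` steps of the machine can be carried out by a probabilistic
Turing machine in time polynomial in `t` and the input length, and conversely.) -/

/-- Programs. -/
inductive Prog : Type
  /-- do nothing -/
  | skip : Prog
  /-- `const i c` is `xᵢ := c` -/
  | const (i c : ℕ) : Prog
  /-- `add i j k` is `xᵢ := xⱼ + xₖ` -/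
  | add (i j k : ℕ) : Prog
  /-- `sub i j k` is `xᵢ := max (xⱼ - xₖ) 0` -/
  | sub (i j k : ℕ) : Prog
  /-- `load i b j` is `xᵢ := a_b[xⱼ]` -/
  | load (i b j : ℕ) : Prog
  /-- `store b i j` is `a_b[xᵢ] := xⱼ` -/
  | store (b i j : ℕ) : Prog
  /-- `flip i` sets `xᵢ` to `0` or `1` by a fair coin toss, independent of all others -/
  | flip (i : ℕ) : Prog
  /-- `seq p q` is `p; q` -/
  | seq (p q : Prog) : Prog
  /-- `ite i p q` is `if xᵢ ≠ 0 then p else q` -/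
  | ite (i : ℕ) (p q : Prog) : Prog
  /-- `loop i p` is `while xᵢ ≠ 0 do p` -/
  | loop (i : ℕ) (p : Prog) : Prog

/-- The memory: the values of the variables and the contents of the arrays. -/
@[ext]
structure MemState : Type where
  var : ℕ → ℕ
  arr : ℕ → ℕ → ℕ

/-- The memory after the assignment `xᵢ := v`. -/
def MemState.setVar (s : MemState) (i v : ℕ) : MemState :=
  { s with var := Function.update s.var i v }

/-- The memory after the assignment `a_b[i] := v`. -/
def MemState.setArr (s : MemState) (b i v : ℕ) : MemState :=
  { s with arr := Function.update s.arr b (Function.update (s.arr b) i v) }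

/-- A configuration: the list of programs that are still to be executed, one after the other, and
the memory. The machine has halted when this list is empty. -/
abbrev Config : Type := List Prog × MemState

/-- A fair coin. -/
noncomputable def fairCoin : PMF Bool := PMF.uniformOfFintype Bool

/-- One step of the machine. -/
noncomputable def machineStep : Config → PMF Config
  | ([], s) => PMF.pure ([], s)
  | (Prog.skip :: K, s) => PMF.pure (K, s)
  | (Prog.const i c :: K, s) => PMF.pure (K, s.setVar i c)
  | (Prog.add i j k :: K, s) => PMF.pure (K, s.setVar i (s.var j + s.var k))
  | (Prog.sub i j k :: K, s) => PMF.pure (K, s.setVar i (s.var j - s.var k))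
  | (Prog.load i b j :: K, s) => PMF.pure (K, s.setVar i (s.arr b (s.var j)))
  | (Prog.store b i j :: K, s) => PMF.pure (K, s.setArr b (s.var i) (s.var j))
  | (Prog.flip i :: K, s) => fairCoin.map fun c => (K, s.setVar i (if c then 1 else 0))
  | (Prog.seq p q :: K, s) => PMF.pure (p :: q :: K, s)
  | (Prog.ite i p q :: K, s) => PMF.pure ((if s.var i ≠ 0 then p else q) :: K, s)
  | (Prog.loop i p :: K, s) =>
      PMF.pure (if s.var i ≠ 0 then (p :: Prog.loop i p :: K, s) else (K, s))

/-- The distribution of the configuration after `t` steps. -/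
noncomputable def runFor : ℕ → Config → PMF Config
  | 0, c => PMF.pure c
  | t + 1, c => (machineStep c).bind (runFor t)

/-- Started on the memory `s`, the program `A` halts within `t` steps, whatever the coin tosses. -/
def Prog.HaltsWithin (A : Prog) (t : ℕ) (s : MemState) : Prop :=
  ∀ c ∈ (runFor t ([A], s)).support, c.1 = []

/-- The probability that `A`, started on the memory `s`, halts with a memory in `P`. (The
probability of having halted in `P` within `t` steps is nondecreasing in `t`.) -/
noncomputable def Prog.outcomeProb (A : Prog) (s : MemState) (P : Set MemState) : ℝ≥0∞ :=
  ⨆ t : ℕ, (runFor t ([A], s)).toOuterMeasure {c | c.1 = [] ∧ c.2 ∈ P}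

/-! ### Inputs -/

open Classical in
/-- The input memory for a graph `G` on `n` vertices and a number `k`: `x₀ = n`, `x₁ = k`, the
array `a₀` holds the adjacency matrix of `G` row by row, and all the rest is `0`. -/
noncomputable def graphInput {n : ℕ} (G : SimpleGraph (Fin n)) (k : ℕ) : MemState where
  var i := if i = 0 then n else if i = 1 then k else 0
  arr b m := if b = 0 ∧ ∃ u v : Fin n, G.Adj u v ∧ m = (u : ℕ) * n + (v : ℕ) then 1 else 0

/-! ### Planted clique -/

instance simpleGraphFinMeasurableSingletonClass (n : ℕ) :
    MeasurableSingletonClass (SimpleGraph (Fin n)) where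
  measurableSet_singleton G := by
    rw [← SimpleGraph.measurableEmbedding_edgeSet.measurableSet_image, Set.image_singleton]
    exact measurableSet_singleton _

/-- The Erdős–Rényi distribution `𝒢(n, 1/2)`. -/
noncomputable def erdosRenyiHalf (n : ℕ) : PMF (SimpleGraph (Fin n)) :=
  (SimpleGraph.binomialRandom (Fin n) ⟨1 / 2, by norm_num, by norm_num⟩).toPMF

/-- The graph `G` with a clique added on the vertex set `S`. -/
def addClique {n : ℕ} (G : SimpleGraph (Fin n)) (S : Finset (Fin n)) : SimpleGraph (Fin n) :=
  G ⊔ SimpleGraph.fromRel fun u v => u ∈ S ∧ v ∈ S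

/-- A uniformly random set of `κ` vertices (of all vertices if `κ > n`). -/
noncomputable def randomVertexSet (n κ : ℕ) : PMF (Finset (Fin n)) :=
  PMF.uniformOfFinset (Finset.powersetCard (min κ n) Finset.univ)
    (Finset.powersetCard_nonempty.2 (by simp))

/-- The distribution `𝒢(n, 1/2, κ)`: a graph from `𝒢(n, 1/2)` to which a clique is added on an
independent uniformly random set of `κ` vertices. -/
noncomputable def plantedClique (n κ : ℕ) : PMF (SimpleGraph (Fin n)) :=
  (erdosRenyiHalf n).bind fun G => (randomVertexSet n κ).map fun S => addClique G S

/-- `Pr_{G ∼ D}[A(G) = 1]`, over the choice of `G` and the coin tosses of `A`: the probability that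
`A` on input `G` halts with `x₀ = 1`. -/
noncomputable def acceptProb {n : ℕ} (A : Prog) (D : PMF (SimpleGraph (Fin n))) : ℝ≥0∞ :=
  ∑' G, D G * A.outcomeProb (graphInput G 0) {s | s.var 0 = 1}

/-- `A` runs in time `n^{o(log n)}` on `n`-vertex graphs. -/
def QuasiPolyLittleOTime (A : Prog) : Prop :=
  ∃ e : ℕ → ℝ, e =o[atTop] (fun n : ℕ => Real.log n) ∧
    ∀ᶠ n : ℕ in atTop, ∀ G : SimpleGraph (Fin n),
      A.HaltsWithin ⌊(n : ℝ) ^ e n⌋₊ (graphInput G 0)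

/-- The Strongish Planted Clique Hypothesis. -/
def SPCH : Prop :=
  ∃ δ : ℝ, 0 < δ ∧ δ < 1 / 2 ∧ ¬ ∃ A : Prog, QuasiPolyLittleOTime A ∧
    ∀ᶠ n : ℕ in atTop,
      2 / 3 ≤ acceptProb A (plantedClique n ⌈(n : ℝ) ^ δ⌉₊) ∧
      acceptProb A (erdosRenyiHalf n) ≤ 1 / 3

/-! ### `k`-Biclique -/

/-- `G` contains `K_{k,k}` as a (not necessarily induced) subgraph. -/
def ContainsBiclique {n : ℕ} (G : SimpleGraph (Fin n)) (k : ℕ) : Prop :=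
  completeBipartiteGraph (Fin k) (Fin k) ⊑ G

/-- `G` contains a `2k`-clique. -/
def ContainsDoubleClique {n : ℕ} (G : SimpleGraph (Fin n)) (k : ℕ) : Prop :=
  ∃ S : Finset (Fin n), G.IsNClique (2 * k) S

/-- The memory `s` represents a copy of `K_{t,t}` in `G`: `x₀ = t`, and the two sides are listed
in the first `t` entries of the arrays `a₀` and `a₁`. -/
def RepresentsBiclique {n : ℕ} (G : SimpleGraph (Fin n)) (t : ℕ) (s : MemState) : Prop :=
  s.var 0 = t ∧ ∃ L R : Fin t ↪ Fin n, (∀ i j, G.Adj (L i) (R j)) ∧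
    ∀ i : Fin t, s.arr 0 i = L i ∧ s.arr 1 i = R i

/-- `A` runs in time `f(k) · n^{o(k)}` on all pairs of an `n`-vertex graph and a positive
integer `k`, for some function `f`. -/
def RunsInTimeFMulNPowLittleO (A : Prog) : Prop :=
  ∃ f g : ℕ → ℝ, g =o[atTop] (fun k : ℕ => (k : ℝ)) ∧
    ∀ k n : ℕ, 1 ≤ k → 1 ≤ n → ∀ G : SimpleGraph (Fin n),
      A.HaltsWithin ⌊f k * (n : ℝ) ^ g k⌋₊ (graphInput G k)

/-- On every pair of a graph `G` and a positive integer `k` that satisfies the promise, `A` outputs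
with probability at least `2/3` a balanced biclique of `G` of size at least `k / C`. -/
def ApproximatesBiclique (C : ℝ) (promise : ∀ {n : ℕ}, SimpleGraph (Fin n) → ℕ → Prop)
    (A : Prog) : Prop :=
  ∀ (n k : ℕ) (G : SimpleGraph (Fin n)), 1 ≤ k → promise G k →
    2 / 3 ≤ A.outcomeProb (graphInput G k)
      {s | ∃ t : ℕ, (k : ℝ) / C ≤ t ∧ RepresentsBiclique G t s}

/-! Suppose `A` solves the approximation problem in time f(k) n^{g(k)} with g(k) = o(k), even if
only under the clique promise. It is turned into an n^{o(log n)}-time distinguisher that refutes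
SPCH, by applying `A` to a randomized power of the input graph G.

Let L be the logarithm of n rounded up and c = ⌈C⌉. For a side length t ≤ L put m = ⌈20L/t⌉, ℓ =
(e+1)m and N = 2^{eLm}, where e ≥ 3/δ. Draw N rows of ℓ random vertices each, and join two distinct
rows if every entry of one equals or is adjacent to every entry of the other (`rowGraph`). Run `A`
on this graph with k = ct and check whether its output contains a copy of K_{t,t}.

Completeness (`stepDist_prob_false_le`): rows inside a planted clique of size κ form a clique. Since
κ^{e+1} ≥ n 2^L, at least N(κ/2^L)^ℓ = (κ^{e+1}/2^L)^m ≥ n such rows are expected, so with high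
probability there are 2ct of them, the promise holds, and `A` finds a biclique of side at least ct/C
≥ t with probability 2/3.

Soundness (`stepDist_prob_true_le`): a random graph has with high probability no K_{3L,3L}. A
K_{t,t} among the rows then forces the t rows of one side to use at most 6L vertices altogether, and
a union bound gives probability at most N^t n^{6L} (12L/2^L)^{ℓt} ≤ 2^{-4L²}. Because outputs are
checked, nothing about `A` is used here.

Time (`exists_side_halts`): for fixed t the run of `A` takes about f(ct) N^{g(ct)} = 2^{O(L²
g(ct)/t)} steps, and g(k) = o(k) makes the exponent an arbitrarily small multiple of L² for a
suitable constant t. The functions f and g are unknown and t depends on the multiple, so the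
distinguisher goes through all pairs of a time bound 2^i and a side t ≤ L, by increasing i. A run
that does not halt in time leads to the next pair, a verified biclique to acceptance, and n halted
runs without one to rejection. The running time is thus at most exp(ε log² n) for every ε > 0 and
large n, which is n^{o(log n)} (`quasiPolyLittleOTime_of_forall`).

To make this a program of the machine, a program logic (`Yields`) couples final memories with
abstract distributions, `A` is interpreted step by step under a clock (`interp`), and the simulated
memory is cleared between trials. -/

section

/-! ### Expectations -/

/-- The expectation of `f` under `μ`. -/
noncomputable def PMF.expect {α : Type*} (μ : PMF α) (f : α → ℝ≥0∞) : ℝ≥0∞ := ∑' a, μ a * f a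

namespace PMF

variable {α β : Type*}

theorem expect_pure (a : α) (f : α → ℝ≥0∞) : (PMF.pure a).expect f = f a := by
  unfold expect
  rw [tsum_eq_single a]
  · simp
  · intro b hb; simp [hb]

theorem expect_bind (μ : PMF α) (κ : α → PMF β) (f : β → ℝ≥0∞) :
    (μ.bind κ).expect f = μ.expect fun a => (κ a).expect f := by
  unfold expect
  simp only [bind_apply, ← ENNReal.tsum_mul_right, ← ENNReal.tsum_mul_left]
  rw [ENNReal.tsum_comm]
  simp only [mul_assoc]

theorem expect_map (μ : PMF α) (g : α → β) (f : β → ℝ≥0∞) :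
    (μ.map g).expect f = μ.expect fun a => f (g a) := by
  rw [map, expect_bind]
  simp only [Function.comp, expect_pure]

theorem expect_congr {μ : PMF α} {f g : α → ℝ≥0∞} (h : ∀ a ∈ μ.support, f a = g a) :
    μ.expect f = μ.expect g := by
  unfold expect
  refine tsum_congr fun a => ?_
  by_cases ha : a ∈ μ.support
  · rw [h a ha]
  · rw [(μ.apply_eq_zero_iff a).2 ha]; simp

theorem expect_mono {μ : PMF α} {f g : α → ℝ≥0∞} (h : ∀ a ∈ μ.support, f a ≤ g a) :
    μ.expect f ≤ μ.expect g := by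
  unfold expect
  refine ENNReal.tsum_le_tsum fun a => ?_
  by_cases ha : a ∈ μ.support
  · gcongr; exact h a ha
  · rw [(μ.apply_eq_zero_iff a).2 ha]; simp

theorem expect_const (μ : PMF α) (c : ℝ≥0∞) : (μ.expect fun _ => c) = c := by
  unfold expect
  rw [ENNReal.tsum_mul_right, tsum_coe, one_mul]

theorem expect_add (μ : PMF α) (f g : α → ℝ≥0∞) :
    (μ.expect fun a => f a + g a) = μ.expect f + μ.expect g := by
  unfold expect
  simp only [mul_add]
  exact ENNReal.tsum_add

theorem expect_mul_left (μ : PMF α) (c : ℝ≥0∞) (f : α → ℝ≥0∞) :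
    (μ.expect fun a => c * f a) = c * μ.expect f := by
  unfold expect
  rw [← ENNReal.tsum_mul_left]
  exact tsum_congr fun a => by ring

theorem expect_mul_right (μ : PMF α) (c : ℝ≥0∞) (f : α → ℝ≥0∞) :
    (μ.expect fun a => f a * c) = μ.expect f * c := by
  simp only [mul_comm _ c, expect_mul_left]

theorem expect_sum {ι : Type*} (μ : PMF α) (s : Finset ι) (f : ι → α → ℝ≥0∞) :
    (μ.expect fun a => ∑ i ∈ s, f i a) = ∑ i ∈ s, μ.expect (f i) := by
  classical
  induction s using Finset.induction_on with
  | empty => simpa using μ.expect_const 0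
  | insert i s hi ih => simp only [Finset.sum_insert hi, expect_add, ih]

/-- Monotone convergence, read off from the Lebesgue integral against the counting measure. -/
theorem expect_iSup (μ : PMF α) {f : ℕ → α → ℝ≥0∞} (hf : ∀ a, Monotone fun t => f t a) :
    (μ.expect fun a => ⨆ t, f t a) = ⨆ t, μ.expect (f t) := by
  let _ : MeasurableSpace α := ⊤
  have key : ∀ g : α → ℝ≥0∞, μ.expect g = ∫⁻ a, μ a * g a ∂MeasureTheory.Measure.count := by
    intro g
    rw [MeasureTheory.lintegral_count]; rfl
  simp only [key]
  rw [← MeasureTheory.lintegral_iSup]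
  · simp only [ENNReal.mul_iSup]
  · intro t; exact measurable_from_top
  · intro s t hst a
    exact mul_le_mul_right (hf a hst) _

/-- The probability of an event. -/
noncomputable def prob (μ : PMF α) (P : α → Prop) : ℝ≥0∞ :=
  μ.expect ({a | P a}.indicator 1)

theorem toOuterMeasure_eq_prob (μ : PMF α) (S : Set α) :
    μ.toOuterMeasure S = μ.prob (· ∈ S) := by
  rw [toOuterMeasure_apply, prob, expect]
  refine tsum_congr fun a => ?_
  by_cases h : a ∈ S <;> simp [h]

theorem prob_pure (a : α) (P : α → Prop) [Decidable (P a)] :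
    (PMF.pure a).prob P = if P a then 1 else 0 := by
  rw [prob, expect_pure]
  simp [Set.indicator_apply]

theorem prob_bind (μ : PMF α) (κ : α → PMF β) (P : β → Prop) :
    (μ.bind κ).prob P = μ.expect fun a => (κ a).prob P := expect_bind _ _ _

theorem prob_map (μ : PMF α) (g : α → β) (P : β → Prop) :
    (μ.map g).prob P = μ.prob fun a => P (g a) := by
  rw [prob, expect_map]; rfl

theorem prob_mono {μ : PMF α} {P Q : α → Prop} (h : ∀ a ∈ μ.support, P a → Q a) :
    μ.prob P ≤ μ.prob Q := by
  refine expect_mono fun a ha => ?_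
  by_cases hP : P a
  · simp [hP, h a ha hP]
  · simp [hP]

theorem prob_le_one (μ : PMF α) (P : α → Prop) : μ.prob P ≤ 1 := by
  rw [← μ.expect_const 1]
  refine expect_mono fun a _ => ?_
  by_cases hP : P a <;> simp [hP]

theorem prob_add_not (μ : PMF α) (P : α → Prop) : μ.prob P + μ.prob (fun a => ¬ P a) = 1 := by
  rw [prob, prob, ← expect_add, ← μ.expect_const 1]
  refine expect_congr fun a _ => ?_
  by_cases hP : P a <;> simp [hP]

theorem prob_or_le (μ : PMF α) (P Q : α → Prop) :
    μ.prob (fun a => P a ∨ Q a) ≤ μ.prob P + μ.prob Q := by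
  rw [prob, prob, prob, ← expect_add]
  refine expect_mono fun a _ => ?_
  by_cases hP : P a <;> by_cases hQ : Q a <;> simp [hP, hQ]

theorem prob_exists_le {ι : Type*} (μ : PMF α) (s : Finset ι) (P : ι → α → Prop) :
    μ.prob (fun a => ∃ i ∈ s, P i a) ≤ ∑ i ∈ s, μ.prob (P i) := by
  classical
  simp only [prob]
  rw [← expect_sum]
  refine expect_mono fun a _ => ?_
  by_cases hP : ∃ i ∈ s, P i a
  · obtain ⟨i, hi, hPi⟩ := hP
    have h1 : ({a | P i a}.indicator (1 : α → ℝ≥0∞) a) = 1 := by simp [hPi]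
    calc _ ≤ (1 : ℝ≥0∞) := by
          rw [Set.indicator_apply]; split_ifs <;> simp
      _ = {a | P i a}.indicator (1 : α → ℝ≥0∞) a := h1.symm
      _ ≤ _ := Finset.single_le_sum (f := fun i => {a | P i a}.indicator (1 : α → ℝ≥0∞) a)
          (fun _ _ => zero_le) hi
  · rw [Set.indicator_of_notMem (by simpa using hP)]
    exact zero_le

theorem prob_eq_zero {μ : PMF α} {P : α → Prop} (h : ∀ a ∈ μ.support, ¬ P a) : μ.prob P = 0 := by
  rw [prob, ← μ.expect_const 0]
  exact expect_congr fun a ha => by simp [h a ha]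

end PMF

/-! ### Running the machine -/

/-- From the configuration `c` the machine halts within `t` steps, whatever the coin tosses. -/
def HaltsIn (t : ℕ) (c : Config) : Prop := ∀ c' ∈ (runFor t c).support, c'.1 = []

/-- The probability that the machine halts from `c` with a memory in `P`. -/
noncomputable def haltProb (c : Config) (P : Set MemState) : ℝ≥0∞ :=
  ⨆ t : ℕ, (runFor t c).prob fun c => c.1 = [] ∧ c.2 ∈ P

theorem Prog.outcomeProb_eq_haltProb (A : Prog) (s : MemState) (P : Set MemState) :
    A.outcomeProb s P = haltProb ([A], s) P := by
  simp only [Prog.outcomeProb, haltProb, PMF.toOuterMeasure_eq_prob]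
  rfl

theorem machineStep_halted (s : MemState) : machineStep ([], s) = PMF.pure ([], s) := by
  simp [machineStep]

theorem runFor_halted (t : ℕ) (s : MemState) : runFor t ([], s) = PMF.pure ([], s) := by
  induction t with
  | zero => rfl
  | succ t ih => rw [runFor, machineStep_halted, PMF.pure_bind, ih]

theorem runFor_add (t t' : ℕ) (c : Config) :
    runFor (t + t') c = (runFor t c).bind (runFor t') := by
  induction t generalizing c with
  | zero => simp [runFor]
  | succ t ih =>
    rw [Nat.succ_add, runFor, runFor, PMF.bind_bind]
    congr 1; funext c'; exact ih c'

theorem HaltsIn.mono {t t' : ℕ} {c : Config} (h : HaltsIn t c) (htt' : t ≤ t') :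
    HaltsIn t' c := by
  obtain ⟨d, rfl⟩ := Nat.exists_eq_add_of_le htt'
  intro c' hc'
  rw [runFor_add, PMF.mem_support_bind_iff] at hc'
  obtain ⟨⟨K, s⟩, h1, h2⟩ := hc'
  obtain rfl : K = [] := h _ h1
  rw [runFor_halted] at h2
  simp at h2
  rw [h2]

theorem HaltsIn.of_step {t : ℕ} {c : Config}
    (h : ∀ c' ∈ (machineStep c).support, HaltsIn t c') : HaltsIn (t + 1) c := by
  intro c' hc'
  rw [runFor, PMF.mem_support_bind_iff] at hc'
  obtain ⟨c1, h1, h2⟩ := hc'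
  exact h c1 h1 c' h2

theorem haltsIn_halted (t : ℕ) (s : MemState) : HaltsIn t ([], s) := by
  intro c hc
  rw [runFor_halted] at hc
  simp at hc
  rw [hc]

theorem monotone_runFor_prob (c : Config) (P : Set MemState) :
    Monotone fun t => (runFor t c).prob fun c => c.1 = [] ∧ c.2 ∈ P := by
  refine monotone_nat_of_le_succ fun t => ?_
  rw [runFor_add, PMF.prob_bind, PMF.prob]
  refine PMF.expect_mono fun c' _ => ?_
  by_cases h : c'.1 = [] ∧ c'.2 ∈ P
  · obtain ⟨K, s⟩ := c'
    obtain ⟨rfl, hP⟩ := h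
    classical
    rw [runFor_halted, PMF.prob_pure]
    simp
    simp_all
  · simp [h]

/-- The probability of having halted in `P` grows with the time, so the supremum passes through the
expectation. This equation removes the time from all later reasoning about outcomes. -/
theorem haltProb_step (c : Config) (P : Set MemState) :
    haltProb c P = (machineStep c).expect fun c' => haltProb c' P := by
  unfold haltProb
  rw [PMF.expect_iSup _ fun c' => monotone_runFor_prob c' P,
    ← (monotone_runFor_prob c P).iSup_nat_add 1]
  simp only [runFor, PMF.prob_bind]

theorem haltProb_halted (s : MemState) (P : Set MemState) [Decidable (s ∈ P)] :
    haltProb ([], s) P = if s ∈ P then 1 else 0 := by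
  classical
  unfold haltProb
  simp only [runFor_halted, PMF.prob_pure]
  simp

/-- A run that has stopped outside `P` within `t` steps is not a run that ends in `P`. -/
theorem runFor_prob_not_add_haltProb_le (t : ℕ) (c : Config) (P : Set MemState) :
    (runFor t c).prob (fun c => c.1 = [] ∧ c.2 ∉ P) + haltProb c P ≤ 1 := by
  unfold haltProb
  rw [ENNReal.add_iSup]
  refine iSup_le fun t' => ?_
  calc _ ≤ (runFor (max t t') c).prob (fun c => c.1 = [] ∧ c.2 ∈ Pᶜ) +
        (runFor (max t t') c).prob (fun c => c.1 = [] ∧ c.2 ∈ P) :=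
        add_le_add (monotone_runFor_prob c Pᶜ (le_max_left _ _))
          (monotone_runFor_prob c P (le_max_right _ _))
    _ ≤ (runFor (max t t') c).prob (fun c => ¬ (c.1 = [] ∧ c.2 ∈ P)) +
        (runFor (max t t') c).prob (fun c => c.1 = [] ∧ c.2 ∈ P) := by
        gcongr
        refine PMF.prob_mono ?_
        rintro c - ⟨h1, h2⟩ ⟨-, h4⟩
        exact h2 h4
    _ = 1 := by rw [add_comm, PMF.prob_add_not]

end

section

/-! ### A program logic -/

/-- The program may assign to the variable. -/
def Prog.WritesVar : Prog → ℕ → Prop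
  | .skip, _ => False
  | .const i _, y => y = i
  | .add i _ _, y => y = i
  | .sub i _ _, y => y = i
  | .load i _ _, y => y = i
  | .store _ _ _, _ => False
  | .flip i, y => y = i
  | .seq p q, y => p.WritesVar y ∨ q.WritesVar y
  | .ite _ p q, y => p.WritesVar y ∨ q.WritesVar y
  | .loop _ p, y => p.WritesVar y

/-- The program may store into the array. -/
def Prog.WritesArr : Prog → ℕ → Prop
  | .store b _ _, y => y = b
  | .seq p q, y => p.WritesArr y ∨ q.WritesArr y
  | .ite _ p q, y => p.WritesArr y ∨ q.WritesArr y
  | .loop _ p, y => p.WritesArr y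
  | _, _ => False

/-- The memories agree on everything that `p` cannot change. -/
structure Frame (p : Prog) (s s' : MemState) : Prop where
  var : ∀ y, ¬ p.WritesVar y → s'.var y = s.var y
  arr : ∀ b, ¬ p.WritesArr b → s'.arr b = s.arr b

theorem Frame.refl (p : Prog) (s : MemState) : Frame p s s := ⟨fun _ _ => rfl, fun _ _ => rfl⟩

theorem Frame.trans {p : Prog} {s s' s'' : MemState} (h : Frame p s s') (h' : Frame p s' s'') :
    Frame p s s'' :=
  ⟨fun y hy => (h'.var y hy).trans (h.var y hy), fun y hy => (h'.arr y hy).trans (h.arr y hy)⟩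

theorem Frame.mono {p q : Prog} {s s' : MemState} (h : Frame p s s')
    (hv : ∀ y, p.WritesVar y → q.WritesVar y) (ha : ∀ y, p.WritesArr y → q.WritesArr y) :
    Frame q s s' :=
  ⟨fun y hy => h.var y fun h' => hy (hv y h'), fun y hy => h.arr y fun h' => hy (ha y h')⟩

@[simp] theorem MemState.setVar_var (s : MemState) (i v y : ℕ) :
    (s.setVar i v).var y = if y = i then v else s.var y := by
  simp [MemState.setVar, Function.update_apply]

@[simp] theorem MemState.setVar_arr (s : MemState) (i v : ℕ) : (s.setVar i v).arr = s.arr := rfl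

@[simp] theorem MemState.setArr_var (s : MemState) (b i v : ℕ) :
    (s.setArr b i v).var = s.var := rfl

@[simp] theorem MemState.setArr_arr (s : MemState) (b i v b' x : ℕ) :
    (s.setArr b i v).arr b' x = if b' = b ∧ x = i then v else s.arr b' x := by
  simp only [MemState.setArr, Function.update_apply]
  by_cases h : b' = b
  · subst h; simp [Function.update_apply]
  · simp [h]

/-- Started on `s`, the program `p` halts within `T` steps, and its final memory can be coupled with
a sample from `μ` so that the two are related by `R`. -/
def Yields {α : Type} (p : Prog) (s : MemState) (T : ℕ) (μ : PMF α)
    (R : α → MemState → Prop) : Prop :=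
  ∃ D : PMF (α × MemState), D.map Prod.fst = μ ∧
    (∀ x ∈ D.support, R x.1 x.2 ∧ Frame p s x.2) ∧
    -- The arbitrary continuation `K` is what makes the statement compose under `seq`.
    (∀ K t, (∀ x ∈ D.support, HaltsIn t (K, x.2)) → HaltsIn (T + t) (p :: K, s)) ∧
    ∀ K P, haltProb (p :: K, s) P = D.expect fun x => haltProb (K, x.2) P

/-- Started on `s`, the program `p` halts within `T` steps with a memory that satisfies `Q`. -/
def Runs (p : Prog) (s : MemState) (T : ℕ) (Q : MemState → Prop) : Prop :=
  Yields p s T (PMF.pure ()) fun _ => Q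

variable {α β : Type} {p q : Prog} {s : MemState} {T T₁ T₂ : ℕ}

theorem Yields.conseq {μ : PMF α} {R R' : α → MemState → Prop} (h : Yields p s T₁ μ R)
    (hT : T₁ ≤ T₂) (hR : ∀ a s', a ∈ μ.support → R a s' → Frame p s s' → R' a s') :
    Yields p s T₂ μ R' := by
  obtain ⟨D, h1, h2, h3, h4⟩ := h
  refine ⟨D, h1, fun x hx => ⟨hR _ _ ?_ (h2 x hx).1 (h2 x hx).2, (h2 x hx).2⟩,
    fun K t ht => (h3 K t ht).mono (by omega), h4⟩
  rw [← h1, PMF.support_map]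
  exact ⟨x, hx, rfl⟩

theorem Yields.mono {μ : PMF α} {R : α → MemState → Prop} (h : Yields p s T₁ μ R)
    (hT : T₁ ≤ T₂) : Yields p s T₂ μ R := h.conseq hT fun _ _ _ h _ => h

theorem Yields.map {μ : PMF α} {R : α → MemState → Prop} {R' : β → MemState → Prop} (f : α → β)
    (h : Yields p s T μ R) (hR : ∀ a s', R a s' → Frame p s s' → R' (f a) s') :
    Yields p s T (μ.map f) R' := by
  obtain ⟨D, h1, h2, h3, h4⟩ := h
  refine ⟨D.map fun x => (f x.1, x.2), ?_, ?_, ?_, ?_⟩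
  · rw [← h1, PMF.map_comp, PMF.map_comp]; rfl
  · intro x hx
    rw [PMF.support_map] at hx
    obtain ⟨y, hy, rfl⟩ := hx
    exact ⟨hR _ _ (h2 y hy).1 (h2 y hy).2, (h2 y hy).2⟩
  · intro K t ht
    refine h3 K t fun x hx => ht (f x.1, x.2) ?_
    rw [PMF.support_map]
    exact ⟨x, hx, rfl⟩
  · intro K P
    rw [h4, PMF.expect_map]

theorem Runs.yields {Q : MemState → Prop} {R : α → MemState → Prop} (a : α)
    (h : Runs p s T Q) (hR : ∀ s', Q s' → Frame p s s' → R a s') :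
    Yields p s T (PMF.pure a) R := by
  have := Yields.map (R' := R) (fun _ => a) h fun _ s' h1 h2 => hR s' h1 h2
  rwa [PMF.pure_map] at this

theorem Runs.conseq {Q Q' : MemState → Prop} (h : Runs p s T₁ Q) (hT : T₁ ≤ T₂)
    (hQ : ∀ s', Q s' → Frame p s s' → Q' s') : Runs p s T₂ Q' :=
  Yields.conseq h hT fun _ s' _ h1 h2 => hQ s' h1 h2

theorem Yields.of_pure {R : α → MemState → Prop} {a : α} {s' : MemState}
    (h : ∀ K, machineStep (p :: K, s) = PMF.pure (K, s')) (hf : Frame p s s') (hR : R a s') :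
    Yields p s 1 (PMF.pure a) R := by
  refine ⟨PMF.pure (a, s'), by rw [PMF.pure_map], ?_, ?_, ?_⟩
  · intro x hx
    simp at hx
    subst hx
    exact ⟨hR, hf⟩
  · intro K t ht
    rw [add_comm]
    refine HaltsIn.of_step fun c' hc' => ?_
    rw [h] at hc'
    simp at hc'
    subst hc'
    exact ht (a, s') (by simp)
  · intro K P
    rw [haltProb_step, h, PMF.expect_pure, PMF.expect_pure]

theorem Yields.flip {R : Bool → MemState → Prop} {i : ℕ}
    (hR : ∀ b, R b (s.setVar i (if b then 1 else 0))) :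
    Yields (.flip i) s 1 fairCoin R := by
  have hs : ∀ K, machineStep (Prog.flip i :: K, s) =
      fairCoin.map fun c => (K, s.setVar i (if c then 1 else 0)) := fun K => rfl
  refine ⟨fairCoin.map fun b => (b, s.setVar i (if b then 1 else 0)), ?_, ?_, ?_, ?_⟩
  · rw [PMF.map_comp]; exact PMF.map_id _
  · intro x hx
    rw [PMF.support_map] at hx
    obtain ⟨b, hb, rfl⟩ := hx
    refine ⟨hR b, fun y hy => ?_, fun _ _ => rfl⟩
    simp only [Prog.WritesVar] at hy
    simp [hy]
  · intro K t ht
    rw [add_comm]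
    refine HaltsIn.of_step fun c' hc' => ?_
    rw [hs, PMF.support_map] at hc'
    obtain ⟨b, hb, rfl⟩ := hc'
    refine ht (b, _) ?_
    rw [PMF.support_map]
    exact ⟨b, hb, rfl⟩
  · intro K P
    rw [haltProb_step, hs, PMF.expect_map, PMF.expect_map]

theorem Yields.seq {μ : PMF α} {κ : α → PMF β} {R : α → MemState → Prop}
    {R' : β → MemState → Prop} (h1 : Yields p s T₁ μ R)
    (h2 : ∀ a s', R a s' → Frame p s s' → Yields q s' T₂ (κ a) R') :
    Yields (p.seq q) s (T₁ + T₂ + 1) (μ.bind κ) R' := by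
  obtain ⟨D, d1, d2, d3, d4⟩ := h1
  have : ∀ x : α × MemState, ∃ E : PMF (β × MemState), E.map Prod.fst = κ x.1 ∧
      (x ∈ D.support → (∀ y ∈ E.support, R' y.1 y.2 ∧ Frame q x.2 y.2) ∧
        (∀ K t, (∀ y ∈ E.support, HaltsIn t (K, y.2)) → HaltsIn (T₂ + t) (q :: K, x.2)) ∧
        ∀ K P, haltProb (q :: K, x.2) P = E.expect fun y => haltProb (K, y.2) P) := by
    intro x
    by_cases hx : x ∈ D.support
    · obtain ⟨E, e1, e2, e3, e4⟩ := h2 x.1 x.2 (d2 x hx).1 (d2 x hx).2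
      exact ⟨E, e1, fun _ => ⟨e2, e3, e4⟩⟩
    -- Outside the support of `D` no run has to be described; any coupling with the right marginal
    -- will do.
    · refine ⟨(κ x.1).map fun b => (b, x.2), ?_, fun h => absurd h hx⟩
      rw [PMF.map_comp]; exact PMF.map_id _
  choose E e1 e2 using this
  have hs : ∀ K, machineStep (Prog.seq p q :: K, s) = PMF.pure (p :: q :: K, s) := fun K => rfl
  refine ⟨D.bind E, ?_, ?_, ?_, ?_⟩
  · rw [PMF.map_bind, ← d1, PMF.bind_map]
    congr 1; funext x; exact e1 x
  · intro y hy
    rw [PMF.mem_support_bind_iff] at hy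
    obtain ⟨x, hx, hy⟩ := hy
    refine ⟨((e2 x hx).1 y hy).1, ?_⟩
    refine ((d2 x hx).2.mono ?_ ?_).trans (((e2 x hx).1 y hy).2.mono ?_ ?_) <;>
      intro z hz <;> simp [Prog.WritesVar, Prog.WritesArr, hz]
  · intro K t ht
    rw [show T₁ + T₂ + 1 + t = (T₁ + (T₂ + t)) + 1 by omega]
    refine HaltsIn.of_step fun c' hc' => ?_
    rw [hs] at hc'
    simp at hc'
    subst hc'
    refine d3 _ _ fun x hx => (e2 x hx).2.1 K t fun y hy => ht y ?_
    rw [PMF.mem_support_bind_iff]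
    exact ⟨x, hx, hy⟩
  · intro K P
    rw [haltProb_step, hs, PMF.expect_pure, d4, PMF.expect_bind]
    exact PMF.expect_congr fun x hx => (e2 x hx).2.2 K P

theorem Runs.seq {μ : PMF α} {Q : MemState → Prop} {R : α → MemState → Prop}
    (h1 : Runs p s T₁ Q) (h2 : ∀ s', Q s' → Frame p s s' → Yields q s' T₂ μ R) :
    Yields (p.seq q) s (T₁ + T₂ + 1) μ R := by
  have := Yields.seq (κ := fun _ => μ) h1 fun _ s' hs' hf => h2 s' hs' hf
  rwa [PMF.pure_bind] at this

theorem Yields.seq_runs {μ : PMF α} {R R' : α → MemState → Prop}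
    (h1 : Yields p s T₁ μ R) (h2 : ∀ a s', R a s' → Frame p s s' → Runs q s' T₂ (R' a)) :
    Yields (p.seq q) s (T₁ + T₂ + 1) μ R' := by
  have := Yields.seq (κ := fun a => PMF.pure a) (R' := R') h1
    fun a s' hs' hf => (h2 a s' hs' hf).yields a fun _ h _ => h
  rwa [PMF.bind_pure] at this

/-- Meant for loops: if the test variable is nonzero, `loop i p` and `seq p (loop i p)` make the
same first step, so unrolling a loop costs nothing beyond that of `seq`. -/
theorem Yields.of_step_eq {μ : PMF α} {R : α → MemState → Prop}
    (hs : ∀ K, machineStep (q :: K, s) = machineStep (p :: K, s))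
    (hf : ∀ s', Frame p s s' → Frame q s s') (h : Yields p s T μ R) : Yields q s T μ R := by
  obtain ⟨D, d1, d2, d3, d4⟩ := h
  refine ⟨D, d1, fun x hx => ⟨(d2 x hx).1, hf _ (d2 x hx).2⟩, fun K t ht => ?_, fun K P => ?_⟩
  · have := d3 K t ht
    revert this
    generalize T + t = r
    intro hr
    cases r with
    | zero =>
      -- In zero steps a nonempty list of programs cannot be exhausted.
      have := hr (p :: K, s) (by simp [runFor])
      simp at this
    | succ r =>
      unfold HaltsIn at hr ⊢
      rwa [runFor, hs]
  · rw [← d4, haltProb_step, hs, ← haltProb_step]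

theorem Yields.ite {μ : PMF α} {R : α → MemState → Prop} {i : ℕ}
    (h1 : s.var i ≠ 0 → Yields p s T μ R) (h2 : s.var i = 0 → Yields q s T μ R) :
    Yields (.ite i p q) s (T + 1) μ R := by
  have key : ∀ r, (∀ K, machineStep (Prog.ite i p q :: K, s) = PMF.pure (r :: K, s)) →
      (∀ s', Frame r s s' → Frame (.ite i p q) s s') → Yields r s T μ R →
      Yields (.ite i p q) s (T + 1) μ R := by
    rintro r hs hf ⟨D, d1, d2, d3, d4⟩
    refine ⟨D, d1, fun x hx => ⟨(d2 x hx).1, hf _ (d2 x hx).2⟩, fun K t ht => ?_, fun K P => ?_⟩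
    · rw [show T + 1 + t = T + t + 1 by omega]
      refine HaltsIn.of_step fun c' hc' => ?_
      rw [hs] at hc'
      simp at hc'
      subst hc'
      exact d3 K t ht
    · rw [haltProb_step, hs, PMF.expect_pure, d4]
  by_cases h : s.var i = 0
  · exact key q (fun K => by simp [machineStep, h])
      (fun s' hs' => hs'.mono (by simp +contextual [Prog.WritesVar])
        (by simp +contextual [Prog.WritesArr])) (h2 h)
  · exact key p (fun K => by simp [machineStep, h])
      (fun s' hs' => hs'.mono (by simp +contextual [Prog.WritesVar])
        (by simp +contextual [Prog.WritesArr])) (h1 h)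

theorem Yields.loop_exit {R : α → MemState → Prop} {i : ℕ} {a : α} (h : s.var i = 0)
    (hR : R a s) : Yields (.loop i p) s 1 (PMF.pure a) R :=
  Yields.of_pure (fun K => by simp [machineStep, h]) (Frame.refl _ _) hR

theorem Yields.loop_step {μ : PMF α} {R : α → MemState → Prop} {i : ℕ} (h : s.var i ≠ 0)
    (hp : Yields (p.seq (.loop i p)) s T μ R) : Yields (.loop i p) s T μ R :=
  Yields.of_step_eq (fun K => by simp [machineStep, h])
    (fun s' hs' => hs'.mono (by simp [Prog.WritesVar]) (by simp [Prog.WritesArr])) hp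

open Classical in
/-- Iterate the kernel `κ` as long as `c` holds, but at most `f` times. -/
noncomputable def whileKernel (κ : α → PMF α) (c : α → Prop) : ℕ → α → PMF α
  | 0, a => PMF.pure a
  | f + 1, a => if c a then (κ a).bind (whileKernel κ c f) else PMF.pure a

/-- The fuel `f` exists only in the analysis: `hterm` says that `f` rounds suffice on every outcome,
so the loop and the kernel with fuel agree. Each round pays one step for the sequencing, and the
last test one more. -/
theorem Yields.loop {κ : α → PMF α} {c : α → Prop} {R : α → MemState → Prop} {i : ℕ}
    (hexit : ∀ a s', R a s' → ¬ c a → s'.var i = 0)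
    (hstep : ∀ a s', R a s' → c a → Frame (.loop i p) s s' →
      s'.var i ≠ 0 ∧ Yields p s' T (κ a) R)
    {f : ℕ} {a : α} (hterm : ∀ b ∈ (whileKernel κ c f a).support, ¬ c b) (hR : R a s) :
    Yields (.loop i p) s (f * (T + 1) + 1) (whileKernel κ c f a) fun b s' => R b s' ∧ ¬ c b := by
  suffices H : ∀ f a s', (∀ b ∈ (whileKernel κ c f a).support, ¬ c b) → R a s' →
      Frame (.loop i p) s s' → Yields (.loop i p) s' (f * (T + 1) + 1) (whileKernel κ c f a)
        fun b s' => R b s' ∧ ¬ c b from H f a s hterm hR (Frame.refl _ _)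
  clear hterm hR a f
  intro f
  induction f with
  | zero =>
    intro a s' ht hR hf
    have hc : ¬ c a := ht a (by simp [whileKernel])
    exact (Yields.loop_exit (hexit a s' hR hc) ⟨hR, hc⟩).mono (by omega)
  | succ f ih =>
    intro a s' ht hR hf
    by_cases hc : c a
    · obtain ⟨h0, hp⟩ := hstep a s' hR hc hf
      rw [whileKernel, if_pos hc] at ht ⊢
      refine Yields.loop_step h0 ?_
      refine (Yields.seq (T₁ := T) (T₂ := f * (T + 1) + 1) (R := fun b s'' => R b s'' ∧
        b ∈ (κ a).support) (hp.conseq le_rfl fun b s'' hb h _ => ⟨h, hb⟩) ?_).mono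
        (le_of_eq (by ring))
      rintro b s'' ⟨hb, hb'⟩ hf'
      refine ih b s'' (fun b' hb'' => ht b' ?_) hb (hf.trans (hf'.mono (fun _ h => h) fun _ h => h))
      rw [PMF.mem_support_bind_iff]
      exact ⟨b, hb', hb''⟩
    · rw [whileKernel, if_neg hc]
      exact (Yields.loop_exit (hexit a s' hR hc) ⟨hR, hc⟩).mono (by omega)

/-! ### Straight-line programs -/

/-- The program has neither loops nor coin tosses. -/
def Prog.Straight : Prog → Prop
  | .flip _ => False
  | .loop _ _ => False
  | .seq p q => p.Straight ∧ q.Straight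
  | .ite _ p q => p.Straight ∧ q.Straight
  | _ => True

/-- The effect of a straight-line program. -/
def Prog.eval : Prog → MemState → MemState
  | .const i c, s => s.setVar i c
  | .add i j k, s => s.setVar i (s.var j + s.var k)
  | .sub i j k, s => s.setVar i (s.var j - s.var k)
  | .load i b j, s => s.setVar i (s.arr b (s.var j))
  | .store b i j, s => s.setArr b (s.var i) (s.var j)
  | .seq p q, s => q.eval (p.eval s)
  | .ite i p q, s => if s.var i ≠ 0 then p.eval s else q.eval s
  -- This covers `skip`; for `flip` and `loop` it is a default value, excluded by `Straight`.
  | _, s => s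

/-- A bound on the number of steps of a straight-line program. -/
def Prog.cost : Prog → ℕ
  | .seq p q => p.cost + q.cost + 1
  | .ite _ p q => max p.cost q.cost + 1
  | _ => 1

theorem Yields.straight {R : α → MemState → Prop} {a : α} (hp : p.Straight)
    (hR : R a (p.eval s)) : Yields p s p.cost (PMF.pure a) R := by
  suffices H : ∀ s, Runs p s p.cost (· = p.eval s) from
    (H s).yields a fun s' h _ => by rwa [h]
  clear hR
  induction p with
  | skip => exact fun s => Yields.of_pure (fun K => rfl) (Frame.refl _ _) rfl
  | const i c =>
    exact fun s => Yields.of_pure (fun K => rfl)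
      ⟨fun y hy => by simp_all [Prog.WritesVar], fun _ _ => rfl⟩ rfl
  | add i j k =>
    exact fun s => Yields.of_pure (fun K => rfl)
      ⟨fun y hy => by simp_all [Prog.WritesVar], fun _ _ => rfl⟩ rfl
  | sub i j k =>
    exact fun s => Yields.of_pure (fun K => rfl)
      ⟨fun y hy => by simp_all [Prog.WritesVar], fun _ _ => rfl⟩ rfl
  | load i b j =>
    exact fun s => Yields.of_pure (fun K => rfl)
      ⟨fun y hy => by simp_all [Prog.WritesVar], fun _ _ => rfl⟩ rfl
  | store b i j =>
    exact fun s => Yields.of_pure (fun K => rfl)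
      ⟨fun _ _ => rfl, fun y hy => by
        funext x; simp_all [Prog.WritesArr]⟩ rfl
  | flip i => exact hp.elim
  | seq p q ihp ihq =>
    intro s
    refine Runs.seq (ihp hp.1 s) fun s' hs' _ => ?_
    rw [hs']
    exact ihq hp.2 _
  | ite i p q ihp ihq =>
    intro s
    refine Yields.ite (fun h => (ihp hp.1 s).conseq (le_max_left _ _) fun s' hs' _ => ?_)
      (fun h => (ihq hp.2 s).conseq (le_max_right _ _) fun s' hs' _ => ?_)
    · simp [hs', Prog.eval, h]
    · simp [hs', Prog.eval, h]
  | loop i p _ => exact hp.elim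

theorem Runs.straight {Q : MemState → Prop} (hp : p.Straight) (hQ : Q (p.eval s)) :
    Runs p s p.cost Q := Yields.straight hp hQ

/-! ### Counting loops -/

/-- Run `p` with the variable `x` taking all values below its initial value, in decreasing order.
The variable `x₁` is used as a scratch variable. -/
def forDown (x : ℕ) (p : Prog) : Prog :=
  .loop x (.seq (.const 1 1) (.seq (.sub x x 1) p))

/-- Apply the kernels `κ (N - 1), …, κ 0` one after the other. -/
noncomputable def iterDown (κ : ℕ → α → PMF α) : ℕ → α → PMF α
  | 0, a => PMF.pure a
  | j + 1, a => (κ j a).bind (iterDown κ j)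

theorem iterDown_pure (g : ℕ → α → α) (N : ℕ) (a : α) :
    ∃ b, iterDown (fun j a => PMF.pure (g j a)) N a = PMF.pure b := by
  induction N generalizing a with
  | zero => exact ⟨a, rfl⟩
  | succ N ih =>
    obtain ⟨b, hb⟩ := ih (g N a)
    exact ⟨b, by rw [iterDown, PMF.pure_bind, hb]⟩

/-- The assumption `hR` says that the invariant ignores the counter and the scratch variable, both
of which are changed before `p` runs. The bookkeeping of a round fits into six steps. -/
theorem Yields.forDown {κ : ℕ → α → PMF α} {x N : ℕ} {a : α}
    (R : ℕ → α → MemState → Prop) (hx : x ≠ 1) (hpx : ¬ p.WritesVar x)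
    (hR : ∀ j a s' v, R j a s' → R j a ((s'.setVar 1 1).setVar x v))
    (hstep : ∀ j a s', j < N → s'.var x = j → R (j + 1) a s' → Frame (forDown x p) s s' →
      Yields p s' T (κ j a) (R j))
    (hN : s.var x = N) (h0 : R N a s) :
    Yields (forDown x p) s (N * (T + 6) + 1) (iterDown κ N a)
      fun b s' => R 0 b s' ∧ s'.var x = 0 := by
  suffices H : ∀ M a s', M ≤ N → s'.var x = M → R M a s' → Frame (_root_.forDown x p) s s' →
      Yields (_root_.forDown x p) s' (M * (T + 6) + 1) (iterDown κ M a)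
        fun b s' => R 0 b s' ∧ s'.var x = 0 from
    H N a s le_rfl hN h0 (Frame.refl _ _)
  intro M
  induction M with
  | zero => exact fun a s' _ hM hR _ => (Yields.loop_exit hM ⟨hR, hM⟩).mono (by omega)
  | succ M ih =>
    intro a s' hMN hM hR' hf
    refine Yields.loop_step (by omega) ?_
    have hs1 : ((s'.setVar 1 1).setVar x M).var x = M := by simp
    have hf1 : Frame (_root_.forDown x p) s' ((s'.setVar 1 1).setVar x M) := by
      constructor
      · intro y hy
        simp only [_root_.forDown, Prog.WritesVar, not_or] at hy
        simp [hy.1, hy.2.1]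
      · intro y _; rfl
    have hbody : Yields (.seq (.const 1 1) (.seq (.sub x x 1) p)) s' (T + 4) (κ M a)
        fun b s'' => R M b s'' ∧ s''.var x = M := by
      refine (Runs.seq (T₁ := 1) (T₂ := T + 2) (Q := fun t => t = s'.setVar 1 1)
        (Runs.straight (p := .const 1 1) trivial rfl) ?_).mono (by omega)
      rintro _ rfl _
      refine (Runs.seq (T₁ := 1) (T₂ := T) (Q := fun t => t = (s'.setVar 1 1).setVar x M)
        (Runs.straight (p := .sub x x 1) trivial ?_) ?_).mono (by omega)
      · simp [Prog.eval, hx, hM]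
      rintro _ rfl _
      refine (hstep M a _ (by omega) hs1 (hR _ _ _ _ hR') (hf.trans hf1)).conseq le_rfl ?_
      intro b s'' _ hb hf2
      refine ⟨hb, ?_⟩
      rw [hf2.var x hpx, hs1]
    refine (Yields.seq hbody fun b s'' hb hf2 => ih b s'' (by omega) hb.2 hb.1 ?_).mono
      (by ring_nf; omega)
    exact hf.trans (hf2.mono (fun _ h => h) fun _ h => h)

theorem Runs.forDown {x N : ℕ} (R : ℕ → MemState → Prop) (hx : x ≠ 1) (hpx : ¬ p.WritesVar x)
    (hR : ∀ j s' v, R j s' → R j ((s'.setVar 1 1).setVar x v))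
    (hstep : ∀ j s', j < N → s'.var x = j → R (j + 1) s' → Frame (forDown x p) s s' →
      Runs p s' T (R j))
    (hN : s.var x = N) (h0 : R N s) :
    Runs (forDown x p) s (N * (T + 6) + 1) fun s' => R 0 s' ∧ s'.var x = 0 := by
  have := Yields.forDown (κ := fun _ a => PMF.pure a) (a := ()) (fun j _ => R j) hx hpx
    (fun j _ => hR j) (fun j _ => hstep j) hN h0
  obtain ⟨b, hb⟩ := iterDown_pure (fun _ (a : Unit) => a) N ()
  rwa [hb] at this

/-- A program that runs as the only one. -/
theorem Yields.outcome {μ : PMF α} {R : α → MemState → Prop} (h : Yields p s T μ R) :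
    p.HaltsWithin T s ∧ ∀ (P : Set MemState) (Q : α → Prop),
      (∀ a s', R a s' → (s' ∈ P ↔ Q a)) → p.outcomeProb s P = μ.prob Q := by
  classical
  obtain ⟨D, d1, d2, d3, d4⟩ := h
  refine ⟨d3 [] 0 fun x _ => haltsIn_halted _ _, fun P Q hPQ => ?_⟩
  rw [Prog.outcomeProb_eq_haltProb, d4, ← d1, PMF.prob_map, PMF.prob]
  refine PMF.expect_congr fun x hx => ?_
  rw [haltProb_halted]
  have := hPQ _ _ (d2 x hx).1
  by_cases hQ : Q x.1 <;> simp_all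

end

/-! ### Interpretation of an arbitrary program by another one -/

section

variable {α β : Type} {p q : Prog} {s : MemState} {T T₁ T₂ : ℕ}

theorem Yields.straight_seq {μ : PMF α} {R : α → MemState → Prop} (hp : p.Straight)
    (h : Yields q (p.eval s) T μ R) : Yields (p.seq q) s (p.cost + T + 1) μ R :=
  Runs.seq (Runs.straight (Q := fun s' => s' = p.eval s) hp rfl) fun s' hs' _ => by rwa [hs']

infixr:60 ";;" => Prog.seq

/-! ### The variables and arrays of the distinguisher

The variables from `30` on and the arrays from `5` on hold the memory of a simulated program. The
variable `1` is a scratch variable. -/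

notation "vSize" => (0 : ℕ)
notation "vLog" => (2 : ℕ)
notation "vRun" => (3 : ℕ)
notation "vAns" => (4 : ℕ)
notation "vTime" => (5 : ℕ)
notation "vSide" => (6 : ℕ)
notation "vRep" => (7 : ℕ)
notation "vAcc" => (8 : ℕ)
notation "vLen" => (9 : ℕ)
notation "vCount" => (10 : ℕ)
notation "vI" => (11 : ℕ)
notation "vJ" => (12 : ℕ)
notation "vA" => (13 : ℕ)
notation "vB" => (14 : ℕ)
notation "vU" => (15 : ℕ)
notation "vV" => (16 : ℕ)
notation "vAddr" => (17 : ℕ)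
notation "vCtr" => (18 : ℕ)
notation "vOk" => (19 : ℕ)
notation "vRes" => (20 : ℕ)
notation "vSp" => (21 : ℕ)
notation "vTop" => (22 : ℕ)
notation "vTouched" => (23 : ℕ)
notation "vFuel" => (24 : ℕ)
notation "vX" => (25 : ℕ)
notation "vY" => (26 : ℕ)
notation "aGraph" => (0 : ℕ)
notation "aRows" => (1 : ℕ)
notation "aAdj" => (2 : ℕ)
notation "aStack" => (3 : ℕ)
notation "aTouched" => (4 : ℕ)

/-! ### Interpreting a program -/

/-- The program and all its parts. -/
def Prog.subprogs : Prog → List Prog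
  | .seq p q => .seq p q :: (p.subprogs ++ q.subprogs)
  | .ite i p q => .ite i p q :: (p.subprogs ++ q.subprogs)
  | .loop i p => .loop i p :: p.subprogs
  | p => [p]

theorem Prog.self_mem_subprogs (p : Prog) : p ∈ p.subprogs := by
  cases p <;> simp [Prog.subprogs]

theorem Prog.subprogs_subset {A p : Prog} (h : p ∈ A.subprogs) : p.subprogs ⊆ A.subprogs := by
  induction A with
  | seq a b iha ihb =>
    simp only [Prog.subprogs, List.mem_cons, List.mem_append] at h
    rcases h with rfl | h | h
    · exact List.Subset.refl _
    · exact fun x hx => by simp [Prog.subprogs, iha h hx]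
    · exact fun x hx => by simp [Prog.subprogs, ihb h hx]
  | ite i a b iha ihb =>
    simp only [Prog.subprogs, List.mem_cons, List.mem_append] at h
    rcases h with rfl | h | h
    · exact List.Subset.refl _
    · exact fun x hx => by simp [Prog.subprogs, iha h hx]
    · exact fun x hx => by simp [Prog.subprogs, ihb h hx]
  | loop i a iha =>
    simp only [Prog.subprogs, List.mem_cons] at h
    rcases h with rfl | h
    · exact List.Subset.refl _
    · exact fun x hx => by simp [Prog.subprogs, iha h hx]
  | _ => simp only [Prog.subprogs, List.mem_singleton] at h; subst h; exact List.Subset.refl _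

theorem Prog.WritesVar.of_mem_subprogs {A p : Prog} (h : p ∈ A.subprogs) {y : ℕ}
    (hy : p.WritesVar y) : A.WritesVar y := by
  induction A with
  | seq a b iha ihb =>
    simp only [Prog.subprogs, List.mem_cons, List.mem_append] at h
    rcases h with rfl | h | h
    exacts [hy, Or.inl (iha h), Or.inr (ihb h)]
  | ite i a b iha ihb =>
    simp only [Prog.subprogs, List.mem_cons, List.mem_append] at h
    rcases h with rfl | h | h
    exacts [hy, Or.inl (iha h), Or.inr (ihb h)]
  | loop i a iha =>
    simp only [Prog.subprogs, List.mem_cons] at h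
    rcases h with rfl | h
    exacts [hy, iha h]
  | _ => simp only [Prog.subprogs, List.mem_singleton] at h; subst h; exact hy

theorem Prog.WritesArr.of_mem_subprogs {A p : Prog} (h : p ∈ A.subprogs) {y : ℕ}
    (hy : p.WritesArr y) : A.WritesArr y := by
  induction A with
  | seq a b iha ihb =>
    simp only [Prog.subprogs, List.mem_cons, List.mem_append] at h
    rcases h with rfl | h | h
    exacts [hy, Or.inl (iha h), Or.inr (ihb h)]
  | ite i a b iha ihb =>
    simp only [Prog.subprogs, List.mem_cons, List.mem_append] at h
    rcases h with rfl | h | h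
    exacts [hy, Or.inl (iha h), Or.inr (ihb h)]
  | loop i a iha =>
    simp only [Prog.subprogs, List.mem_cons] at h
    rcases h with rfl | h
    exacts [hy, iha h]
  | _ => simp only [Prog.subprogs, List.mem_singleton] at h; subst h; exact hy

theorem Prog.exists_writesVar_bound (A : Prog) : ∃ V, ∀ y, A.WritesVar y → y < V := by
  induction A with
  | skip => exact ⟨0, fun y h => h.elim⟩
  | store => exact ⟨0, fun y h => h.elim⟩
  | seq a b iha ihb =>
    obtain ⟨V, hV⟩ := iha
    obtain ⟨W, hW⟩ := ihb
    exact ⟨max V W, fun y h => h.elim (fun h => lt_max_of_lt_left (hV y h))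
      fun h => lt_max_of_lt_right (hW y h)⟩
  | ite i a b iha ihb =>
    obtain ⟨V, hV⟩ := iha
    obtain ⟨W, hW⟩ := ihb
    exact ⟨max V W, fun y h => h.elim (fun h => lt_max_of_lt_left (hV y h))
      fun h => lt_max_of_lt_right (hW y h)⟩
  | loop i a iha => exact iha
  | const i _ => exact ⟨i + 1, fun y h => Nat.lt_succ_of_le (le_of_eq h)⟩
  | add i _ _ => exact ⟨i + 1, fun y h => Nat.lt_succ_of_le (le_of_eq h)⟩
  | sub i _ _ => exact ⟨i + 1, fun y h => Nat.lt_succ_of_le (le_of_eq h)⟩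
  | load i _ _ => exact ⟨i + 1, fun y h => Nat.lt_succ_of_le (le_of_eq h)⟩
  | flip i => exact ⟨i + 1, fun y h => Nat.lt_succ_of_le (le_of_eq h)⟩

theorem Prog.exists_writesArr_bound (A : Prog) : ∃ W, ∀ y, A.WritesArr y → y < W := by
  induction A with
  | store i _ => exact ⟨i + 1, fun y h => Nat.lt_succ_of_le (le_of_eq h)⟩
  | seq a b iha ihb =>
    obtain ⟨V, hV⟩ := iha
    obtain ⟨W, hW⟩ := ihb
    exact ⟨max V W, fun y h => h.elim (fun h => lt_max_of_lt_left (hV y h))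
      fun h => lt_max_of_lt_right (hW y h)⟩
  | ite i a b iha ihb =>
    obtain ⟨V, hV⟩ := iha
    obtain ⟨W, hW⟩ := ihb
    exact ⟨max V W, fun y h => h.elim (fun h => lt_max_of_lt_left (hV y h))
      fun h => lt_max_of_lt_right (hW y h)⟩
  | loop i a iha => exact iha
  | _ => exact ⟨0, fun y h => h.elim⟩

open Classical in
/-- The number under which the part `p` of `A` is put on the stack. -/
noncomputable def Prog.index (A p : Prog) : ℕ := A.subprogs.idxOf p

/-- Equal parts of `A` share a number, which is harmless: a configuration contains programs, not
positions in `A`. -/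
theorem Prog.subprogs_index {A p : Prog} (h : p ∈ A.subprogs) :
    A.subprogs[A.index p]? = some p := by
  classical
  unfold Prog.index
  rw [List.getElem?_eq_getElem (List.idxOf_lt_length_iff.2 h)]
  simp

/-- Push the number `e` on the stack. -/
def pushConst (e : ℕ) : Prog :=
  .const 1 e ;; .store aStack vSp 1 ;; .const 1 1 ;; .add vSp vSp 1

/-- Record the address `x_y` as touched. -/
def touch (y : ℕ) : Prog :=
  .store aTouched vTouched y ;; .const 1 1 ;; .add vTouched vTouched 1

/-- Execute the first step of the part `p` of `A`. -/
noncomputable def execPart (A : Prog) : Prog → Prog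
  | .skip => .skip
  | .const i c => .const (i + 30) c
  | .add i j k => .add (i + 30) (j + 30) (k + 30)
  | .sub i j k => .sub (i + 30) (j + 30) (k + 30)
  | .load i b j => .load (i + 30) (b + 5) (j + 30)
  | .store b i j => .store (b + 5) (i + 30) (j + 30) ;; touch (i + 30)
  | .flip i => .flip (i + 30)
  -- The part to be executed first has to end up on top of the stack.
  | .seq p q => pushConst (A.index q) ;; pushConst (A.index p)
  | .ite i p q => .ite (i + 30) (pushConst (A.index p)) (pushConst (A.index q))
  | .loop i p =>
      .ite (i + 30) (pushConst (A.index (.loop i p)) ;; pushConst (A.index p)) .skip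

/-- Execute the entry of the list with number `x_vTop`. -/
def dispatch (ex : Prog → Prog) : List Prog → Prog
  | [] => .skip
  | p :: l => .ite vTop (.const 1 1 ;; .sub vTop vTop 1 ;; dispatch ex l) (ex p)

/-- Carry out one step of `A`. -/
noncomputable def interpStep (A : Prog) : Prog :=
  .ite vSp (.const 1 1 ;; .sub vSp vSp 1 ;; .load vTop aStack vSp ;;
    dispatch (execPart A) A.subprogs) .skip

/-- The memory `σ` holds the configuration `c` of a run of `A`, which uses only variables below `V`
and arrays below `W`; all cells that may be nonzero have been recorded, in a list of at most `r`
addresses. -/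
structure Simulates (A : Prog) (V W r : ℕ) (c : Config) (σ : MemState) : Prop where
  var : ∀ i, σ.var (i + 30) = c.2.var i
  arr : ∀ b, σ.arr (b + 5) = c.2.arr b
  sp : σ.var vSp = c.1.length
  -- The head of the list is the top of the stack: an entry lies as high as the number of programs
  -- behind it.
  stack : ∀ l₁ p l₂, c.1 = l₁ ++ p :: l₂ → A.subprogs[σ.arr aStack l₂.length]? = some p
  touched : ∀ b x, c.2.arr b x ≠ 0 → ∃ j < σ.var vTouched, σ.arr aTouched j = x
  touched_le : σ.var vTouched ≤ r
  var_bound : ∀ i, V ≤ i → c.2.var i = 0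
  arr_bound : ∀ b, W ≤ b → ∀ x, c.2.arr b x = 0

variable {A : Prog} {V W r : ℕ} {K : List Prog} {σ σ' : MemState}

theorem Simulates.congr {c : Config} (h : Simulates A V W r c σ)
    (ha : ∀ b, 3 ≤ b → σ'.arr b = σ.arr b)
    (hv : ∀ y, 30 ≤ y ∨ y = vSp ∨ y = vTouched → σ'.var y = σ.var y) :
    Simulates A V W r c σ' where
  var i := by rw [hv _ (by omega), h.var]
  arr b := by rw [ha _ (by omega), h.arr]
  sp := by rw [hv _ (by omega), h.sp]
  stack := by rw [ha _ (by omega)]; exact h.stack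
  touched := by rw [ha _ (by omega), hv _ (by omega)]; exact h.touched
  touched_le := by rw [hv _ (by omega)]; exact h.touched_le
  var_bound := h.var_bound
  arr_bound := h.arr_bound

theorem Simulates.mono {c : Config} {r' : ℕ} (h : Simulates A V W r c σ) (hr : r ≤ r') :
    Simulates A V W r' c σ :=
  { h with touched_le := h.touched_le.trans hr }

theorem Simulates.setVar {i v : ℕ} (h : Simulates A V W r (K, s) σ) (hi : i < V) :
    Simulates A V W r (K, s.setVar i v) (σ.setVar (i + 30) v) where
  var j := by simp [h.var]
  arr b := h.arr b
  sp := by simpa using h.sp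
  stack := h.stack
  touched := by simpa using h.touched
  touched_le := by simpa using h.touched_le
  var_bound j hj := by simpa [show j ≠ i by omega] using h.var_bound j hj
  arr_bound := h.arr_bound

theorem Simulates.push (h : Simulates A V W r (K, s) σ) (hp : p ∈ A.subprogs) :
    Simulates A V W r (p :: K, s) ((pushConst (A.index p)).eval σ) where
  var i := by simp [pushConst, Prog.eval, h.var]
  arr b := by
    rw [← h.arr b]; funext x
    simp [pushConst, Prog.eval]
  sp := by simp [pushConst, Prog.eval, h.sp]
  stack := by
    intro l₁ p' l₂ hl
    cases l₁ with
    | nil =>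
      simp only [List.nil_append, List.cons.injEq] at hl
      obtain ⟨rfl, rfl⟩ := hl
      simp [pushConst, Prog.eval, h.sp, Prog.subprogs_index hp]
    | cons a l₁ =>
      simp only [List.cons_append, List.cons.injEq] at hl
      have := h.stack l₁ p' l₂ hl.2
      have hlen : K.length = l₁.length + (l₂.length + 1) := by
        have := congrArg List.length hl.2
        simpa using this
      simpa [pushConst, Prog.eval, h.sp, show l₂.length ≠ K.length by omega] using this
  touched := by simpa [pushConst, Prog.eval] using h.touched
  touched_le := by simpa [pushConst, Prog.eval] using h.touched_le
  var_bound := h.var_bound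
  arr_bound := h.arr_bound

theorem Simulates.store {b i v : ℕ} (h : Simulates A V W r (K, s) σ) (hb : b < W) {y : ℕ}
    (hy : σ.var y = i) :
    Simulates A V W (r + 1) (K, s.setArr b i v) ((touch y).eval (σ.setArr (b + 5) i v)) where
  var j := by simp [touch, Prog.eval, h.var]
  arr b' := by
    funext x
    simp [touch, Prog.eval, h.arr]
  sp := by simpa [touch, Prog.eval] using h.sp
  stack := by simpa [touch, Prog.eval] using h.stack
  touched := by
    intro b' x hx
    simp only [MemState.setArr_arr] at hx
    by_cases hxi : x = i
    · exact ⟨σ.var vTouched, by simp [touch, Prog.eval], by simp [touch, Prog.eval, hy, hxi]⟩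
    · rw [if_neg (by tauto)] at hx
      obtain ⟨j, hj, hj'⟩ := h.touched b' x hx
      exact ⟨j, by simp [touch, Prog.eval]; omega,
        by simp [touch, Prog.eval, hj', show j ≠ σ.var vTouched by omega]⟩
  touched_le := by simpa [touch, Prog.eval] using h.touched_le
  var_bound := h.var_bound
  arr_bound b' hb' x := by
    have := h.arr_bound b' hb' x
    simpa [show b' ≠ b by omega] using this

/-- A single step stores into at most one cell, hence at most one new address in the list. The bound
of 20 steps covers the longest case. -/
theorem Simulates.execPart (hV : ∀ y, A.WritesVar y → y < V) (hW : ∀ y, A.WritesArr y → y < W)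
    (h : Simulates A V W r (K, s) σ) (hp : p ∈ A.subprogs) :
    Yields (execPart A p) σ 20 (machineStep (p :: K, s)) (Simulates A V W (r + 1)) := by
  have hv : ∀ y, p.WritesVar y → y < V := fun y hy => hV y (hy.of_mem_subprogs hp)
  have hw : ∀ y, p.WritesArr y → y < W := fun y hy => hW y (hy.of_mem_subprogs hp)
  have hsub := Prog.subprogs_subset hp
  have h' := h.mono (Nat.le_succ r)
  cases p with
  | skip => exact (Yields.straight (p := .skip) trivial h').mono (by simp [Prog.cost])
  | const i c =>
    exact (Yields.straight (p := .const (i + 30) c) trivial (h'.setVar (hv i rfl))).mono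
      (by simp [Prog.cost])
  | add i j k =>
    refine (Yields.straight (p := .add (i + 30) (j + 30) (k + 30)) trivial ?_).mono
      (by simp [Prog.cost])
    rw [Prog.eval, h.var, h.var]
    exact h'.setVar (hv i rfl)
  | sub i j k =>
    refine (Yields.straight (p := .sub (i + 30) (j + 30) (k + 30)) trivial ?_).mono
      (by simp [Prog.cost])
    rw [Prog.eval, h.var, h.var]
    exact h'.setVar (hv i rfl)
  | load i b j =>
    refine (Yields.straight (p := .load (i + 30) (b + 5) (j + 30)) trivial ?_).mono
      (by simp [Prog.cost])
    rw [Prog.eval, h.var, h.arr]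
    exact h'.setVar (hv i rfl)
  | store b i j =>
    refine (Yields.straight (p := .store (b + 5) (i + 30) (j + 30) ;; touch (i + 30))
      (by simp [Prog.Straight, touch]) ?_).mono (by simp [Prog.cost, touch])
    rw [Prog.eval, Prog.eval, h.var, h.var]
    exact h.store (hw b rfl) (h.var i)
  | flip i =>
    refine Yields.mono (T₁ := 1) ?_ (by omega)
    exact Yields.map (R := fun c σ' => σ' = σ.setVar (i + 30) (if c then 1 else 0)) _
      (Yields.flip fun b => rfl) fun b s' hs' _ => by rw [hs']; exact h'.setVar (hv i rfl)
  | seq p q =>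
    have hq' : q ∈ A.subprogs := hsub (by simp [Prog.subprogs, Prog.self_mem_subprogs])
    have hp' : p ∈ A.subprogs := hsub (by simp [Prog.subprogs, Prog.self_mem_subprogs])
    exact (Yields.straight (p := pushConst (A.index q) ;; pushConst (A.index p))
      (by simp [Prog.Straight, pushConst]) ((h'.push hq').push hp')).mono
      (by simp [Prog.cost, pushConst])
  | ite i p q =>
    have hq' : q ∈ A.subprogs := hsub (by simp [Prog.subprogs, Prog.self_mem_subprogs])
    have hp' : p ∈ A.subprogs := hsub (by simp [Prog.subprogs, Prog.self_mem_subprogs])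
    refine (Yields.straight (p := .ite (i + 30) (pushConst (A.index p)) (pushConst (A.index q)))
      (by simp [Prog.Straight, pushConst]) ?_).mono (by simp [Prog.cost, pushConst])
    rw [Prog.eval, h.var]
    split_ifs with h0
    · exact h'.push hp'
    · exact h'.push hq'
  | loop i p =>
    have hp' : p ∈ A.subprogs := hsub (by simp [Prog.subprogs, Prog.self_mem_subprogs])
    by_cases h0 : s.var i = 0
    · rw [show machineStep (Prog.loop i p :: K, s) = PMF.pure (K, s) by simp [machineStep, h0]]
      refine (Yields.straight (p := .ite (i + 30)
        (pushConst (A.index (.loop i p)) ;; pushConst (A.index p)) .skip)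
        (by simp [Prog.Straight, pushConst]) ?_).mono (by simp [Prog.cost, pushConst])
      rw [Prog.eval, h.var, if_neg (by simpa using h0)]
      exact h'
    · rw [show machineStep (Prog.loop i p :: K, s) = PMF.pure (p :: .loop i p :: K, s) by
        simp [machineStep, h0]]
      refine (Yields.straight (p := .ite (i + 30)
        (pushConst (A.index (.loop i p)) ;; pushConst (A.index p)) .skip)
        (by simp [Prog.Straight, pushConst]) ?_).mono (by simp [Prog.cost, pushConst])
      rw [Prog.eval, h.var, if_pos (by simpa using h0)]
      exact (h'.push hp).push hp'

/-- The number on top of the stack is counted down along the list; each entry passed over costs five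
steps. -/
theorem Yields.dispatch {μ : PMF α} {R : α → MemState → Prop} {ex : Prog → Prog}
    {l : List Prog} (hl : l[σ.var vTop]? = some p)
    (h : ∀ σ', σ'.arr = σ.arr → (∀ y, y ≠ 1 → y ≠ vTop → σ'.var y = σ.var y) →
      Yields (ex p) σ' T μ R) :
    Yields (dispatch ex l) σ (5 * l.length + T) μ R := by
  induction l generalizing σ with
  | nil => simp at hl
  | cons q l ih =>
    refine Yields.mono (T₁ := 5 * l.length + T + 4 + 1) ?_ (by simp; omega)
    refine Yields.ite (fun h0 => ?_) (fun h0 => ?_)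
    · have hl' : l[σ.var vTop - 1]? = some p := by
        obtain ⟨m, hm⟩ := Nat.exists_eq_succ_of_ne_zero h0
        rw [hm] at hl ⊢
        simpa using hl
      refine Yields.mono (Yields.straight_seq (p := .const 1 1) trivial
        (Yields.straight_seq (p := .sub vTop vTop 1) trivial
          (ih (by simpa [Prog.eval] using hl') ?_))) (T₂ := 5 * l.length + T + 4)
        (by simp [Prog.cost]; omega)
      intro σ' ha hv
      refine h σ' ha fun y h1 h2 => ?_
      rw [hv y h1 h2]
      simp [Prog.eval, h1, h2]
    · rw [h0] at hl
      simp at hl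
      subst hl
      exact (h σ rfl fun _ _ _ => rfl).mono (by omega)

theorem Simulates.interpStep (hV : ∀ y, A.WritesVar y → y < V)
    (hW : ∀ y, A.WritesArr y → y < W) {c : Config} (h : Simulates A V W r c σ) :
    Yields (interpStep A) σ (5 * A.subprogs.length + 30) (machineStep c)
      (Simulates A V W (r + 1)) := by
  refine Yields.mono (T₁ := 5 * A.subprogs.length + 29 + 1) ?_ le_rfl
  obtain ⟨K, s⟩ := c
  cases K with
  | nil =>
    refine Yields.ite (fun h0 => absurd h.sp h0) fun h0 => ?_
    rw [machineStep_halted]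
    exact (Yields.straight (p := .skip) trivial (h.mono (Nat.le_succ r))).mono
      (by simp [Prog.cost])
  | cons p K =>
    refine Yields.ite (fun h0 => ?_) fun h0 => by have := h.sp; simp_all
    refine Yields.mono (Yields.straight_seq (p := .const 1 1) trivial
      (Yields.straight_seq (p := .sub vSp vSp 1) trivial
        (Yields.straight_seq (p := .load vTop aStack vSp) trivial
          (Yields.dispatch (T := 20) (p := p) ?_ ?_)))) (by simp [Prog.cost]; omega)
    · have := h.stack [] p K rfl
      simpa [Prog.eval, h.sp] using this
    · intro σ' ha hv
      refine Simulates.execPart (r := r) hV hW ?_ ?_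
      · refine Simulates.congr (σ := σ.setVar vSp K.length) ?_ (fun b _ => by rw [ha]; rfl)
          fun y hy => ?_
        · exact
          { var := fun i => by simpa using h.var i
            arr := h.arr
            sp := by simp
            stack := fun l₁ p' l₂ hl => h.stack (p :: l₁) p' l₂ (by
              simp only at hl
              simp [hl])
            touched := by simpa using h.touched
            touched_le := by simpa using h.touched_le
            var_bound := h.var_bound
            arr_bound := h.arr_bound }
        · have h1 : y ≠ 1 := by omega
          have h2 : y ≠ vTop := by omega
          rw [hv y h1 h2]
          have := h.sp
          simp [Prog.eval, h1, h2, this]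
      · exact List.mem_of_getElem? (h.stack [] p K rfl)

theorem execPart_writesVar {p : Prog} {y : ℕ} (h : (execPart A p).WritesVar y) :
    y = 1 ∨ y = vSp ∨ y = vTop ∨ y = vTouched ∨ 30 ≤ y := by
  cases p <;> simp [execPart, pushConst, touch, Prog.WritesVar] at h <;> omega

theorem execPart_writesArr {p : Prog} {y : ℕ} (h : (execPart A p).WritesArr y) :
    y = aStack ∨ y = aTouched ∨ 5 ≤ y := by
  cases p <;> simp [execPart, pushConst, touch, Prog.WritesArr] at h <;> omega

theorem dispatch_writesVar {l : List Prog} {y : ℕ}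
    (h : (dispatch (execPart A) l).WritesVar y) :
    y = 1 ∨ y = vSp ∨ y = vTop ∨ y = vTouched ∨ 30 ≤ y := by
  induction l with
  | nil => exact h.elim
  | cons p l ih =>
    simp only [dispatch, Prog.WritesVar] at h
    rcases h with (h | h | h) | h
    exacts [by omega, by omega, ih h, execPart_writesVar h]

theorem dispatch_writesArr {l : List Prog} {y : ℕ}
    (h : (dispatch (execPart A) l).WritesArr y) :
    y = aStack ∨ y = aTouched ∨ 5 ≤ y := by
  induction l with
  | nil => exact h.elim
  | cons p l ih =>
    simp only [dispatch, Prog.WritesArr, false_or] at h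
    rcases h with h | h
    exacts [ih h, execPart_writesArr h]

theorem interpStep_writesVar {y : ℕ} (h : (interpStep A).WritesVar y) :
    y = 1 ∨ y = vSp ∨ y = vTop ∨ y = vTouched ∨ 30 ≤ y := by
  simp only [interpStep, Prog.WritesVar, or_false] at h
  rcases h with h | h | h | h
  exacts [by omega, by omega, by omega, dispatch_writesVar h]

theorem interpStep_writesArr {y : ℕ} (h : (interpStep A).WritesArr y) :
    y = aStack ∨ y = aTouched ∨ 5 ≤ y := by
  simp only [interpStep, Prog.WritesArr, or_false, false_or] at h
  exact dispatch_writesArr h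

/-- Carry out `x_vFuel` steps of `A`. -/
noncomputable def interp (A : Prog) : Prog := forDown vFuel (interpStep A)

theorem iterDown_machineStep (t : ℕ) (c : Config) :
    iterDown (fun _ => machineStep) t c = runFor t c := by
  induction t generalizing c with
  | zero => rfl
  | succ t ih =>
    rw [iterDown, runFor]
    congr 1; funext c; exact ih c

theorem Simulates.interp (hV : ∀ y, A.WritesVar y → y < V)
    (hW : ∀ y, A.WritesArr y → y < W) {c : Config} (h : Simulates A V W r c σ) {t : ℕ}
    (ht : σ.var vFuel = t) :
    Yields (interp A) σ (t * (5 * A.subprogs.length + 36) + 1) (runFor t c)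
      (Simulates A V W (r + t)) := by
  have := Yields.forDown (p := _root_.interpStep A) (s := σ)
    (T := 5 * A.subprogs.length + 30) (κ := fun _ => machineStep) (x := vFuel) (N := t) (a := c)
    -- With the counter at `j`, `t - j` steps have been simulated and at most as many addresses
    -- recorded.
    (fun j c s => j ≤ t ∧ Simulates A V W (r + (t - j)) c s) (by decide)
    (fun h => by have := interpStep_writesVar h; omega)
    ?_ ?_ ht ⟨le_rfl, by simpa using h⟩
  · rw [iterDown_machineStep] at this
    exact this.conseq le_rfl fun c s' _ hc _ => by simpa using hc.1.2
  · rintro j c s v ⟨hj, hs⟩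
    refine ⟨hj, ?_⟩
    refine hs.congr (fun _ _ => rfl) fun y hy => ?_
    simp [show y ≠ vFuel by omega, show y ≠ 1 by omega]
  · rintro j c s hj - ⟨hj', hs⟩ -
    refine (hs.interpStep hV hW).conseq le_rfl fun c' s' _ hc' _ => ⟨by omega, ?_⟩
    exact hc'.mono (by omega)

end

/-! ### Programs for random rows and their time bounds -/

section

variable {α β : Type} {p q : Prog} {s : MemState} {T T₁ T₂ : ℕ}

/-! ### Time bounds -/

theorem mul_pow_le_mul_pow {X a d D : ℕ} (hX : 1 ≤ X) (hd : d ≤ D) : a * X ^ d ≤ a * X ^ D :=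
  Nat.mul_le_mul_left _ (Nat.pow_le_pow_right hX hd)

/-- Time bounds are kept in the form `c * X ^ d`, with `X` above all parameters; a counting loop
then raises the degree by one and the constant by seven. -/
theorem loop_time_le {X N : ℕ} (c d : ℕ) {D : ℕ} (hX : 1 ≤ X) (hN : N ≤ X)
    (hD : D = d + 1 := by rfl) : N * (c * X ^ d + 6) + 1 ≤ (c + 7) * X ^ D := by
  subst hD
  have h1 : 1 ≤ X ^ (d + 1) := Nat.one_le_pow _ _ hX
  have h2 : X ≤ X ^ (d + 1) := by
    calc X = X ^ 1 := (pow_one X).symm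
      _ ≤ X ^ (d + 1) := Nat.pow_le_pow_right hX (by omega)
  calc N * (c * X ^ d + 6) + 1 ≤ X * (c * X ^ d + 6) + 1 := by gcongr
    _ = c * X ^ (d + 1) + 6 * X + 1 := by ring
    _ ≤ (c + 7) * X ^ (d + 1) := by linarith

/-! ### Sampling -/

/-- `x_d := x_u * x_w + x_v`. -/
def mulAdd (d u w v : ℕ) : Prog :=
  .const 1 0 ;; .add vCtr u 1 ;; .add d v 1 ;; forDown vCtr (.add d d w)

/-- There is no unit-cost multiplication, so the product is a repeated addition, whose time is
governed by the factor in `u` alone. -/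
theorem runs_mulAdd {d u w v : ℕ} (hd1 : d ≠ 1) (hdc : d ≠ vCtr) (hdw : d ≠ w) (hw1 : w ≠ 1)
    (hwc : w ≠ vCtr) (hu1 : u ≠ 1) (hv1 : v ≠ 1) (hvc : v ≠ vCtr) (hX : s.var u ≤ T)
    (h1 : 1 ≤ T) :
    Runs (mulAdd d u w v) s (14 * T) fun s' => s'.var d = s.var u * s.var w + s.var v := by
  refine Yields.mono (Yields.straight_seq (p := .const 1 0) trivial
    (Yields.straight_seq (p := .add vCtr u 1) trivial
      (Yields.straight_seq (p := .add d v 1) trivial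
        (Yields.conseq (Runs.forDown (T := 1) (N := s.var u)
          (fun j s' => s'.var d + j * s.var w = s.var u * s.var w + s.var v) ?_ ?_ ?_ ?_ ?_ ?_)
          le_rfl ?_)))) (by simp [Prog.cost]; omega)
  · decide
  · simpa [Prog.WritesVar] using hdc.symm
  · intro j s' x h
    simpa [hd1, hdc] using h
  · intro j s' hj _ h hf
    refine Runs.straight (p := .add d d w) trivial ?_
    have hw : s'.var w = s.var w := by
      rw [hf.var w (by simp [forDown, Prog.WritesVar, hw1, hwc, hdw.symm])]
      simp [Prog.eval, hw1, hwc, hdw.symm]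
    simp only [Prog.eval, MemState.setVar_var, if_true, hw]
    rw [← h]; ring
  · simp [Prog.eval, hu1, hdc.symm]
  · simp [Prog.eval, hv1, hvc]
    ring
  · intro _ s' _ h _
    simpa using h.1

/-- Append `L` random bits to the binary expansion of `r`. -/
noncomputable def randBits (L r : ℕ) : PMF ℕ :=
  iterDown (fun _ r => fairCoin.map fun b => r + r + if b then 1 else 0) L r

/-- A random number below `n`, if `n ≤ 2 ^ L ≤ 2 * n`. -/
noncomputable def randVertex (n L : ℕ) : PMF ℕ :=
  (randBits L 0).map fun r => if n ≤ r then r - n else r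

/-- `x_vU := ` a random vertex. -/
def sampleVertex : Prog :=
  .const vU 0 ;; .const 1 0 ;; .add vCtr vLog 1 ;;
  forDown vCtr (.flip vX ;; .add vU vU vU ;; .add vU vU vX) ;;
  .const 1 1 ;; .add vX vU 1 ;; .sub vX vX vSize ;; .ite vX (.sub vU vU vSize) .skip

theorem yields_sampleVertex {X n L : ℕ} (hn : s.var vSize = n) (hL : s.var vLog = L)
    (hLX : L ≤ X) (hX : 1 ≤ X) :
    Yields sampleVertex s (30 * X) (randVertex n L) fun v s' => s'.var vU = v := by
  have hloop : Yields (forDown vCtr (.flip vX ;; .add vU vU vU ;; .add vU vU vX))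
      (((s.setVar vU 0).setVar 1 0).setVar vCtr L) (L * 11 + 1) (randBits L 0)
      fun r s' => s'.var vU = r := by
    refine (Yields.forDown (T := 5) (fun _ r s' => s'.var vU = r) (by decide)
      (by simp [Prog.WritesVar]) ?_ ?_ ?_ ?_).conseq (by omega) fun _ _ _ h _ => h.1
    · intro j r s' v h
      simpa using h
    · intro j r s' _ _ h _
      refine Yields.map (p := _) (R := fun b s'' => s''.var vU = r + r + if b then 1 else 0)
        (fun b : Bool => r + r + if b then 1 else 0) ?_ fun b s'' h _ => h
      refine (Yields.seq_runs (T₁ := 1) (T₂ := 3) (R := fun b s'' =>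
        s'' = s'.setVar vX (if b then 1 else 0)) (Yields.flip fun b => rfl) ?_).mono (by omega)
      rintro b _ rfl _
      refine Runs.straight (p := .add vU vU vU ;; .add vU vU vX) (by simp [Prog.Straight]) ?_
      simp [Prog.eval, h]
    · simp
    · simp
  refine Yields.mono (Yields.straight_seq (p := .const vU 0) trivial
    (Yields.straight_seq (p := .const 1 0) trivial
      (Yields.straight_seq (p := .add vCtr vLog 1) (T := L * 11 + 12) trivial ?_)))
    (by simp [Prog.cost]; omega)
  simp only [Prog.eval]
  rw [show ((s.setVar vU 0).setVar 1 0).var vLog + ((s.setVar vU 0).setVar 1 0).var 1 = L by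
    simp [hL]]
  refine Yields.map (R := fun r s' => s'.var vU = if n ≤ r then r - n else r) (p := _)
    (fun r => if n ≤ r then r - n else r) ?_ fun r s'' h _ => h
  refine (Yields.seq_runs hloop fun r s' hr hf => Runs.straight
    (p := .const 1 1 ;; .add vX vU 1 ;; .sub vX vX vSize ;; .ite vX (.sub vU vU vSize) .skip)
    (by simp [Prog.Straight]) ?_).mono (by simp [Prog.cost])
  have hn' : s'.var vSize = n := by
    rw [hf.var vSize (by simp [forDown, Prog.WritesVar])]
    simpa using hn
  by_cases h : n ≤ r
  · simp [Prog.eval, hr, hn', h, show r + 1 - n ≠ 0 by omega]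
  · simp [Prog.eval, hr, hn', h, show r + 1 - n = 0 by omega]

/-- Fill the first `N` entries of `w` with independent samples. -/
noncomputable def fill (μ : PMF α) (N : ℕ) (w : ℕ → α) : PMF (ℕ → α) :=
  iterDown (fun j w => μ.map (Function.update w j)) N w

/-- `N` rows of `ℓ` random vertices each. -/
noncomputable def randRows (n L ℓ N : ℕ) : PMF (ℕ → ℕ → ℕ) :=
  fill (fill (randVertex n L) ℓ 0) N 0

/-- Fill row `x_vI` with random vertices. -/
def sampleRow : Prog :=
  .const 1 0 ;; .add vA vLen 1 ;;
  forDown vA (sampleVertex ;; mulAdd vAddr vI vLen vA ;; .store aRows vAddr vU)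

/-- The rows lie one after the other in a single array and are filled from the last to the first;
the second clause protects those already filled. -/
theorem yields_sampleRow {X n L ℓ i : ℕ} (hn : s.var vSize = n) (hL : s.var vLog = L)
    (hℓ : s.var vLen = ℓ) (hi : s.var vI = i) (hLX : L ≤ X) (hℓX : ℓ ≤ X) (hiX : i ≤ X)
    (hX : 1 ≤ X) :
    Yields sampleRow s (60 * X ^ 2) (fill (randVertex n L) ℓ 0) fun w s' =>
      (∀ a < ℓ, s'.arr aRows (i * ℓ + a) = w a) ∧
      ∀ x, i * ℓ + ℓ ≤ x → s'.arr aRows x = s.arr aRows x := by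
  have htime : 4 + (ℓ * (47 * X ^ 1 + 6) + 1) ≤ 60 * X ^ 2 := by
    have := loop_time_le 47 1 (D := 2) hX hℓX
    have h1 : 1 ≤ X ^ 2 := Nat.one_le_pow _ _ hX
    omega
  refine Yields.mono (Yields.straight_seq (p := .const 1 0) trivial
    (Yields.straight_seq (p := .add vA vLen 1) trivial
      (Yields.conseq (Yields.forDown (T := 47 * X ^ 1) (N := ℓ) (a := 0)
        (fun j w s' => (∀ a, j ≤ a → a < ℓ → s'.arr aRows (i * ℓ + a) = w a) ∧
          ∀ x, i * ℓ + ℓ ≤ x → s'.arr aRows x = s.arr aRows x) ?_ ?_ ?_ ?_ ?_ ?_)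
        le_rfl ?_))) (by simp [Prog.cost] at htime ⊢; omega)
  · decide
  · simp [sampleVertex, mulAdd, forDown, Prog.WritesVar]
  · intro j w s' v h
    exact h
  · intro j w s' hj hA h hf
    have hn' : s'.var vSize = n := by
      rw [hf.var _ (by simp [sampleVertex, mulAdd, forDown, Prog.WritesVar])]
      simpa [Prog.eval] using hn
    have hL' : s'.var vLog = L := by
      rw [hf.var _ (by simp [sampleVertex, mulAdd, forDown, Prog.WritesVar])]
      simpa [Prog.eval] using hL
    have hℓ' : s'.var vLen = ℓ := by
      rw [hf.var _ (by simp [sampleVertex, mulAdd, forDown, Prog.WritesVar])]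
      simpa [Prog.eval] using hℓ
    have hi' : s'.var vI = i := by
      rw [hf.var _ (by simp [sampleVertex, mulAdd, forDown, Prog.WritesVar])]
      simpa [Prog.eval] using hi
    refine Yields.map (p := _) (R := fun v s'' => (∀ a, j ≤ a → a < ℓ →
        s''.arr aRows (i * ℓ + a) = Function.update w j v a) ∧
          ∀ x, i * ℓ + ℓ ≤ x → s''.arr aRows x = s.arr aRows x) (Function.update w j) ?_
      fun _ _ h _ => h
    refine (Yields.seq_runs (yields_sampleVertex hn' hL' hLX hX) (T₂ := 14 * X + 2) ?_).mono (by
      rw [pow_one]; omega)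
    intro v s1 hv hf1
    refine (Runs.seq (runs_mulAdd (T := X) (s := s1) (d := vAddr) (u := vI) (w := vLen) (v := vA)
      (by decide) (by decide) (by decide) (by decide) (by decide) (by decide) (by decide)
      (by decide) ?_ hX) (T₂ := 1) ?_).mono (by omega)
    · rw [hf1.var _ (by simp [sampleVertex, forDown, Prog.WritesVar]), hi']
      exact hiX
    · intro s2 h2 hf2
      refine Yields.straight (p := .store aRows vAddr vU) trivial ?_
      have hU : s2.var vU = v := by
        rw [hf2.var _ (by simp [mulAdd, forDown, Prog.WritesVar]), hv]
      have hAd : s2.var vAddr = i * ℓ + j := by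
        rw [h2, hf1.var _ (by simp [sampleVertex, forDown, Prog.WritesVar]),
          hf1.var vLen (by simp [sampleVertex, forDown, Prog.WritesVar]),
          hf1.var vA (by simp [sampleVertex, forDown, Prog.WritesVar]), hi', hℓ', hA]
      have harr : s2.arr aRows = s'.arr aRows := by
        rw [hf2.arr _ (by simp [mulAdd, forDown, Prog.WritesArr]),
          hf1.arr _ (by simp [sampleVertex, forDown, Prog.WritesArr])]
      constructor
      · intro a hja ha
        by_cases haj : a = j
        · subst haj
          simp [Prog.eval, hU, hAd]
        · have := h.1 a (by omega) ha
          simp [Prog.eval, hAd, haj, harr, this]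
      · intro x hx
        have := h.2 x hx
        simp [Prog.eval, hAd, show x ≠ i * ℓ + j by omega, harr, this]
  · simp [Prog.eval, hℓ]
  · exact ⟨fun a h1 h2 => by omega, fun x _ => rfl⟩
  · intro w s' _ h _
    exact ⟨fun a ha => h.1.1 a (Nat.zero_le _) ha, h.1.2⟩

/-- Fill all rows with random vertices. -/
def sampleRows : Prog := .const 1 0 ;; .add vI vCount 1 ;; forDown vI sampleRow

theorem yields_sampleRows {X n L ℓ N : ℕ} (hn : s.var vSize = n) (hL : s.var vLog = L)
    (hℓ : s.var vLen = ℓ) (hN : s.var vCount = N) (hLX : L ≤ X) (hℓX : ℓ ≤ X) (hNX : N ≤ X)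
    (hX : 1 ≤ X) :
    Yields sampleRows s (80 * X ^ 3) (randRows n L ℓ N) fun w s' =>
      ∀ i < N, ∀ a < ℓ, s'.arr aRows (i * ℓ + a) = w i a := by
  have htime : 4 + (N * (60 * X ^ 2 + 6) + 1) ≤ 80 * X ^ 3 := by
    have := loop_time_le 60 2 (D := 3) hX hNX
    have h1 : 1 ≤ X ^ 3 := Nat.one_le_pow _ _ hX
    omega
  refine Yields.mono (Yields.straight_seq (p := .const 1 0) trivial
    (Yields.straight_seq (p := .add vI vCount 1) trivial
      (Yields.conseq (Yields.forDown (T := 60 * X ^ 2) (N := N) (a := 0)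
        (fun j w s' => ∀ i, j ≤ i → i < N → ∀ a < ℓ, s'.arr aRows (i * ℓ + a) = w i a)
        ?_ ?_ ?_ ?_ ?_ ?_)
        le_rfl ?_))) (by simp [Prog.cost] at htime ⊢; omega)
  · decide
  · simp [sampleRow, sampleVertex, mulAdd, forDown, Prog.WritesVar]
  · intro j w s' v h
    exact h
  · intro j w s' hj hI h hf
    have hw : ∀ y, y = vSize ∨ y = vLog ∨ y = vLen → s'.var y = s.var y := by
      intro y hy
      rw [hf.var _ (by
        rcases hy with rfl | rfl | rfl <;>
          simp [sampleRow, sampleVertex, mulAdd, forDown, Prog.WritesVar])]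
      rcases hy with rfl | rfl | rfl <;> simp [Prog.eval]
    refine Yields.map (p := _) (R := fun v s'' => ∀ i, j ≤ i → i < N → ∀ a < ℓ,
        s''.arr aRows (i * ℓ + a) = Function.update w j v i a) (Function.update w j) ?_
      fun _ _ h _ => h
    refine (yields_sampleRow ((hw _ (by simp)).trans hn) ((hw _ (by simp)).trans hL)
      ((hw _ (by simp)).trans hℓ) hI hLX hℓX (by omega) hX).conseq le_rfl ?_
    intro v s1 _ h1 _ i hji hiN a ha
    by_cases hij : i = j
    · subst hij
      simp [h1.1 a ha]
    · rw [Function.update_of_ne hij, h1.2, h i (by omega) hiN a ha]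
      have : (j + 1) * ℓ ≤ i * ℓ := Nat.mul_le_mul_right _ (by omega)
      rw [Nat.succ_mul] at this
      omega
  · simp [Prog.eval, hN]
  · intro i h1 h2; omega
  · intro w s' _ h _ i hi
    exact h.1 i (Nat.zero_le _) hi

end

section

variable {α β : Type} {p q : Prog} {s : MemState} {T T₁ T₂ : ℕ}

/-! ### The graph of rows -/

/-- Adjacency of vertices given as natural numbers. -/
def adjNat {n : ℕ} (G : SimpleGraph (Fin n)) (u v : ℕ) : Prop :=
  ∃ (hu : u < n) (hv : v < n), G.Adj ⟨u, hu⟩ ⟨v, hv⟩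

theorem adjNat.symm {n : ℕ} {G : SimpleGraph (Fin n)} {u v : ℕ} (h : adjNat G u v) :
    adjNat G v u := by
  obtain ⟨hu, hv, h⟩ := h
  exact ⟨hv, hu, h.symm⟩

theorem adjNat_coe {n : ℕ} {G : SimpleGraph (Fin n)} {u v : Fin n} :
    adjNat G u v ↔ G.Adj u v := ⟨fun ⟨_, _, h⟩ => h, fun h => ⟨u.2, v.2, h⟩⟩

open Classical in
/-- The entries of the adjacency matrix. -/
noncomputable def adjBit {n : ℕ} (G : SimpleGraph (Fin n)) (u v : ℕ) : ℕ :=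
  if adjNat G u v then 1 else 0

theorem graphInput_arr {n : ℕ} (G : SimpleGraph (Fin n)) (k : ℕ) {u v : ℕ}
    (hu : u < n) (hv : v < n) : (graphInput G k).arr 0 (u * n + v) = adjBit G u v := by
  classical
  simp only [graphInput, adjBit, true_and]
  refine if_congr ?_ rfl rfl
  constructor
  · rintro ⟨u', v', h, he⟩
    have h1 : u = u' := by
      have := congrArg (· / n) he
      beta_reduce at this
      rwa [Nat.mul_comm, Nat.mul_add_div (by omega), Nat.mul_comm (u' : ℕ),
        Nat.mul_add_div (by omega), Nat.div_eq_of_lt hv, Nat.div_eq_of_lt v'.2] at this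
    subst h1
    have h2 : v = v' := by omega
    subst h2
    exact adjNat_coe.2 h
  · rintro ⟨h1, h2, h⟩
    exact ⟨_, _, h, rfl⟩

theorem graphInput_arr_of_le {n : ℕ} (G : SimpleGraph (Fin n)) (k : ℕ) {x : ℕ}
    (hx : n * n ≤ x) : (graphInput G k).arr 0 x = 0 := by
  simp only [graphInput]
  refine if_neg ?_
  rintro ⟨-, u, v, -, he⟩
  have : ((u : ℕ) + 1) * n ≤ n * n := Nat.mul_le_mul_right _ u.2
  rw [Nat.succ_mul] at this
  have := v.2
  omega

/-- The graph on the first `N` rows of `w` in which two rows are adjacent if every entry of one is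
equal or adjacent to every entry of the other. -/
def rowGraph {n : ℕ} (G : SimpleGraph (Fin n)) (ℓ N : ℕ) (w : ℕ → ℕ → ℕ) :
    SimpleGraph (Fin N) where
  -- Equality has to be allowed, since rows drawn from a clique may share vertices.
  Adj i j := i ≠ j ∧ ∀ a < ℓ, ∀ b < ℓ, w i a = w j b ∨ adjNat G (w i a) (w j b)
  symm := ⟨fun _ _ h => ⟨h.1.symm, fun a ha b hb =>
    (h.2 b hb a ha).imp Eq.symm adjNat.symm⟩⟩
  loopless := ⟨fun _ h => h.1 rfl⟩

theorem adjNat_rowGraph {n : ℕ} {G : SimpleGraph (Fin n)} {ℓ N : ℕ} {w : ℕ → ℕ → ℕ} {i j : ℕ}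
    (hi : i < N) (hj : j < N) : adjNat (rowGraph G ℓ N w) i j ↔
      i ≠ j ∧ ∀ a < ℓ, ∀ b < ℓ, w i a = w j b ∨ adjNat G (w i a) (w j b) := by
  simp [adjNat, rowGraph, hi, hj]

/-- The memory holds the graph `G` and the rows `w`. -/
structure HoldsRows {n : ℕ} (G : SimpleGraph (Fin n)) (ℓ N : ℕ) (w : ℕ → ℕ → ℕ)
    (s : MemState) : Prop where
  size : s.var vSize = n
  len : s.var vLen = ℓ
  count : s.var vCount = N
  graph : ∀ u < n, ∀ v < n, s.arr aGraph (u * n + v) = adjBit G u v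
  rows : ∀ i < N, ∀ a < ℓ, s.arr aRows (i * ℓ + a) = w i a

variable {n : ℕ} {G : SimpleGraph (Fin n)} {ℓ N X : ℕ} {w : ℕ → ℕ → ℕ}

theorem HoldsRows.congr {s s' : MemState} (h : HoldsRows G ℓ N w s)
    (hv : ∀ y, y = vSize ∨ y = vLen ∨ y = vCount → s'.var y = s.var y)
    (ha : ∀ b, b = aGraph ∨ b = aRows → s'.arr b = s.arr b) : HoldsRows G ℓ N w s' where
  size := by rw [hv _ (by simp), h.size]
  len := by rw [hv _ (by simp), h.len]
  count := by rw [hv _ (by simp), h.count]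
  graph := by rw [ha _ (by simp)]; exact h.graph
  rows := by rw [ha _ (by simp)]; exact h.rows

theorem HoldsRows.frame {s s' : MemState} (h : HoldsRows G ℓ N w s) (hf : Frame p s s')
    (hv : ¬ p.WritesVar vSize ∧ ¬ p.WritesVar vLen ∧ ¬ p.WritesVar vCount)
    (ha : ¬ p.WritesArr aGraph ∧ ¬ p.WritesArr aRows) : HoldsRows G ℓ N w s' :=
  h.congr (by rintro y (rfl | rfl | rfl) <;> exact hf.var _ (by tauto))
    (by rintro y (rfl | rfl) <;> exact hf.arr _ (by tauto))

/-- Set `x_vOk` to `0` unless entry `x_vA` of row `x_vI` is equal or adjacent to entry `x_vB` of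
row `x_vJ`. -/
def checkEntries : Prog :=
  mulAdd vAddr vI vLen vA ;; .load vU aRows vAddr ;;
  mulAdd vAddr vJ vLen vB ;; .load vV aRows vAddr ;;
  -- The sum of the two truncated differences vanishes exactly when the entries agree.
  .sub vX vU vV ;; .sub vY vV vU ;; .add vX vX vY ;;
  .ite vX (mulAdd vAddr vU vSize vV ;; .load vX aGraph vAddr ;; .ite vX .skip (.const vOk 0)) .skip

open Classical in
theorem runs_checkEntries (h : HoldsRows G ℓ N w s) (hw : ∀ i < N, ∀ a < ℓ, w i a < n)
    (hnX : n ≤ X) (hNX : N ≤ X) (hX : 1 ≤ X) {i j a b : ℕ}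
    (hi : s.var vI = i) (hj : s.var vJ = j) (ha : s.var vA = a) (hb : s.var vB = b)
    (hiN : i < N) (hjN : j < N) (haℓ : a < ℓ) (hbℓ : b < ℓ) :
    Runs checkEntries s (80 * X) fun s' => s'.var vOk =
      if w i a = w j b ∨ adjNat G (w i a) (w j b) then s.var vOk else 0 := by
  refine Yields.mono (T₁ := 14 * X + (1 + (14 * X + (1 + (1 + (1 + (1 + (14 * X + 6 + 1) + 1) + 1)
    + 1) + 1) + 1) + 1) + 1) ?_ (by omega)
  refine Runs.seq (runs_mulAdd (T := X) (by decide) (by decide) (by decide) (by decide) (by decide)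
    (by decide) (by decide) (by decide) (by rw [hi]; omega) hX) fun s1 h1 hf1 => ?_
  have e1 : s1.var vAddr = i * ℓ + a := by rw [h1, hi, ha, h.len]
  have r1 : HoldsRows G ℓ N w s1 := h.frame hf1 (by simp [mulAdd, forDown, Prog.WritesVar])
    (by simp [mulAdd, forDown, Prog.WritesArr])
  have j1 : s1.var vJ = j := by rw [hf1.var _ (by simp [mulAdd, forDown, Prog.WritesVar]), hj]
  have b1 : s1.var vB = b := by rw [hf1.var _ (by simp [mulAdd, forDown, Prog.WritesVar]), hb]
  have o1 : s1.var vOk = s.var vOk := hf1.var _ (by simp [mulAdd, forDown, Prog.WritesVar])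
  refine Yields.straight_seq (p := .load vU aRows vAddr) trivial ?_
  simp only [Prog.eval]
  rw [e1, r1.rows i hiN a haℓ]
  refine Runs.seq (runs_mulAdd (T := X) (by decide) (by decide) (by decide) (by decide) (by decide)
    (by decide) (by decide) (by decide) (by simp [j1]; omega) hX) fun s2 h2 hf2 => ?_
  have e2 : s2.var vAddr = j * ℓ + b := by rw [h2]; simp [j1, b1, r1.len]
  have r2 : HoldsRows G ℓ N w s2 := HoldsRows.frame
    (r1.congr (s' := s1.setVar vU (w i a)) (by rintro y (rfl | rfl | rfl) <;> simp)
      (fun _ _ => rfl)) hf2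
    (by simp [mulAdd, forDown, Prog.WritesVar]) (by simp [mulAdd, forDown, Prog.WritesArr])
  have u2 : s2.var vU = w i a := by
    rw [hf2.var _ (by simp [mulAdd, forDown, Prog.WritesVar])]; simp
  have o2 : s2.var vOk = s.var vOk := by
    rw [hf2.var _ (by simp [mulAdd, forDown, Prog.WritesVar])]; simp [o1]
  refine Yields.straight_seq (p := .load vV aRows vAddr) trivial
    (Yields.straight_seq (p := .sub vX vU vV) trivial
    (Yields.straight_seq (p := .sub vY vV vU) trivial
    (Yields.straight_seq (p := .add vX vX vY) trivial ?_)))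
  simp only [Prog.eval]
  rw [e2, r2.rows j hjN b hbℓ]
  have hu := hw i hiN a haℓ
  have hv := hw j hjN b hbℓ
  refine Yields.ite (fun h0 => ?_) (fun h0 => ?_)
  · have hne : w i a ≠ w j b := by
      intro he; simp [u2, he] at h0
    refine Yields.mono (T₁ := 14 * X + (1 + 2 + 1) + 1) ?_ (by omega)
    refine Runs.seq (runs_mulAdd (T := X) (by decide) (by decide) (by decide) (by decide)
      (by decide) (by decide) (by decide) (by decide) (by simp [u2]; omega) hX) fun s3 h3 hf3 => ?_
    have e3 : s3.var vAddr = w i a * n + w j b := by rw [h3]; simp [u2, r2.size]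
    have g3 : s3.arr aGraph = s2.arr aGraph := by
      rw [hf3.arr _ (by simp [mulAdd, forDown, Prog.WritesArr])]; simp
    have o3 : s3.var vOk = s.var vOk := by
      rw [hf3.var _ (by simp [mulAdd, forDown, Prog.WritesVar])]; simp [o2]
    refine Runs.straight (p := .load vX aGraph vAddr ;; .ite vX .skip (.const vOk 0))
      (by simp [Prog.Straight]) ?_
    have hbit : s3.arr aGraph (s3.var vAddr) = adjBit G (w i a) (w j b) := by
      rw [g3, e3, r2.graph _ hu _ hv]
    by_cases hadj : adjNat G (w i a) (w j b)
    · simp [Prog.eval, hbit, adjBit, hadj, o3]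
    · simp [Prog.eval, hbit, adjBit, hadj, hne]
  · have he : w i a = w j b := by
      simp [u2] at h0; omega
    refine (Runs.straight (p := .skip) trivial ?_).conseq (by simp [Prog.cost]) fun _ h _ => h
    simp [Prog.eval, o2, he]

/-- Compute in `x_vOk` whether rows `x_vI` and `x_vJ` are adjacent. -/
def compareRows : Prog :=
  .const vOk 1 ;; .sub vX vI vJ ;; .sub vY vJ vI ;; .add vX vX vY ;;
  .ite vX .skip (.const vOk 0) ;;
  .const 1 0 ;; .add vA vLen 1 ;;
  forDown vA (.const 1 0 ;; .add vB vLen 1 ;; forDown vB checkEntries)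

theorem runs_compareRows (h : HoldsRows G ℓ N w s) (hw : ∀ i < N, ∀ a < ℓ, w i a < n)
    (hnX : n ≤ X) (hNX : N ≤ X) (hℓX : ℓ ≤ X) (hX : 1 ≤ X) {i j : ℕ}
    (hi : s.var vI = i) (hj : s.var vJ = j) (hiN : i < N) (hjN : j < N) :
    Runs compareRows s (120 * X ^ 3) fun s' => s'.var vOk = adjBit (rowGraph G ℓ N w) i j := by
  classical
  have ht1 := loop_time_le 80 1 (D := 2) hX hℓX
  have ht2 := loop_time_le 91 2 (D := 3) hX hℓX
  have hX2 : 1 ≤ X ^ 2 := Nat.one_le_pow _ _ hX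
  have hX3 : 1 ≤ X ^ 3 := Nat.one_le_pow _ _ hX
  simp only [pow_one] at ht1
  refine Yields.mono (Yields.straight_seq (p := .const vOk 1) trivial
    (Yields.straight_seq (p := .sub vX vI vJ) trivial
    (Yields.straight_seq (p := .sub vY vJ vI) trivial
    (Yields.straight_seq (p := .add vX vX vY) trivial
    (Yields.straight_seq (p := .ite vX .skip (.const vOk 0)) (by simp [Prog.Straight])
    (Yields.straight_seq (p := .const 1 0) trivial
    (Yields.straight_seq (p := .add vA vLen 1) trivial
    (T := ℓ * (91 * X ^ 2 + 6) + 1) ?_))))))) (by simp [Prog.cost]; omega)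
  generalize hs0 : Prog.eval (.add vA vLen 1) _ = s0
  have r0 : HoldsRows G ℓ N w s0 := by
    refine h.congr ?_ ?_
    · rintro y (rfl | rfl | rfl) <;> rw [← hs0] <;> simp [Prog.eval] <;> split_ifs <;> simp
    · rintro y (rfl | rfl) <;> rw [← hs0] <;> simp [Prog.eval] <;> split_ifs <;> simp
  have i0 : s0.var vI = i := by
    rw [← hs0]; simp [Prog.eval]; split_ifs <;> simp [hi]
  have j0 : s0.var vJ = j := by
    rw [← hs0]; simp [Prog.eval]; split_ifs <;> simp [hj]
  have a0 : s0.var vA = ℓ := by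
    rw [← hs0]; simp [Prog.eval]; split_ifs <;> simp [h.len]
  have o0 : s0.var vOk = if i ≠ j then 1 else 0 := by
    rw [← hs0]; simp [Prog.eval, hi, hj]; split_ifs <;> simp <;> omega
  clear hs0
  have hwr : ∀ y, y = vI ∨ y = vJ ∨ y = vSize ∨ y = vLen ∨ y = vCount →
      ¬ (forDown vA (.const 1 0 ;; .add vB vLen 1 ;; forDown vB checkEntries)).WritesVar y := by
    rintro y (rfl | rfl | rfl | rfl | rfl) <;>
      simp [forDown, checkEntries, mulAdd, Prog.WritesVar]
  have hwa : ∀ y,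
      ¬ (forDown vA (.const 1 0 ;; .add vB vLen 1 ;; forDown vB checkEntries)).WritesArr y := by
    simp [forDown, checkEntries, mulAdd, Prog.WritesArr]
  have hwr' : ∀ y, y = vI ∨ y = vJ ∨ y = vA ∨ y = vSize ∨ y = vLen ∨ y = vCount →
      ¬ (forDown vB checkEntries).WritesVar y := by
    rintro y (rfl | rfl | rfl | rfl | rfl | rfl) <;>
      simp [forDown, checkEntries, mulAdd, Prog.WritesVar]
  have hwa' : ∀ y, ¬ (forDown vB checkEntries).WritesArr y := by
    simp [forDown, checkEntries, mulAdd, Prog.WritesArr]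
  refine (Runs.forDown (T := 91 * X ^ 2) (N := ℓ) (fun a s' => s'.var vOk =
    if i ≠ j ∧ ∀ a', a ≤ a' → a' < ℓ → ∀ b < ℓ, w i a' = w j b ∨ adjNat G (w i a') (w j b)
    then 1 else 0) (by decide) ?_ ?_ ?_ a0 ?_).conseq le_rfl ?_
  · simp [forDown, checkEntries, mulAdd, Prog.WritesVar]
  · intro a s' v h
    simpa using h
  · intro a s1 haℓ ha ho hf
    have r1 : HoldsRows G ℓ N w s1 := r0.frame hf
      ⟨hwr _ (by simp), hwr _ (by simp), hwr _ (by simp)⟩ ⟨hwa _, hwa _⟩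
    have i1 : s1.var vI = i := by rw [hf.var _ (hwr _ (by simp)), i0]
    have j1 : s1.var vJ = j := by rw [hf.var _ (hwr _ (by simp)), j0]
    refine Yields.mono (Yields.straight_seq (p := .const 1 0) trivial
      (Yields.straight_seq (p := .add vB vLen 1) trivial
      (T := ℓ * (80 * X + 6) + 1) ?_)) (by simp [Prog.cost]; omega)
    -- Invariant: the entries after `a` have been compared with the whole other row, and entry `a`
    -- with the entries from `b` on.
    refine (Runs.forDown (T := 80 * X) (N := ℓ) (fun b s' => s'.var vOk =
      if (i ≠ j ∧ ∀ a', a + 1 ≤ a' → a' < ℓ → ∀ b < ℓ, w i a' = w j b ∨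
        adjNat G (w i a') (w j b)) ∧ ∀ b', b ≤ b' → b' < ℓ → w i a = w j b' ∨
        adjNat G (w i a) (w j b')
      then 1 else 0) (by decide) ?_ ?_ ?_ ?_ ?_).conseq le_rfl ?_
    · simp [checkEntries, mulAdd, forDown, Prog.WritesVar]
    · intro b s' v h
      simpa using h
    · intro b s2 hbℓ hb ho2 hf2
      have r2 : HoldsRows G ℓ N w s2 := HoldsRows.frame
        (r1.congr (by rintro y (rfl | rfl | rfl) <;> simp [Prog.eval])
          (by rintro y (rfl | rfl) <;> simp [Prog.eval])) hf2
        ⟨hwr' _ (by simp), hwr' _ (by simp), hwr' _ (by simp)⟩ ⟨hwa' _, hwa' _⟩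
      have i2 : s2.var vI = i := by
        rw [hf2.var _ (hwr' _ (by simp))]; simp [Prog.eval, i1]
      have j2 : s2.var vJ = j := by
        rw [hf2.var _ (hwr' _ (by simp))]; simp [Prog.eval, j1]
      have a2 : s2.var vA = a := by
        rw [hf2.var _ (hwr' _ (by simp))]; simp [Prog.eval, ha]
      refine (runs_checkEntries r2 hw hnX hNX hX i2 j2 a2 hb hiN hjN haℓ hbℓ).conseq le_rfl ?_
      intro s3 h3 _
      rw [h3, ho2]
      by_cases hc : w i a = w j b ∨ adjNat G (w i a) (w j b)
      · rw [if_pos hc]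
        refine if_congr (and_congr_right fun _ => ?_) rfl rfl
        constructor
        · intro H b' hb' hb'ℓ
          rcases Nat.eq_or_lt_of_le hb' with rfl | hlt
          · exact hc
          · exact H b' hlt hb'ℓ
        · exact fun H b' hb' => H b' (by omega)
      · rw [if_neg hc, if_neg]
        exact fun H => hc (H.2 b le_rfl hbℓ)
    · simp [Prog.eval, r1.len]
    · simp only [Prog.eval, MemState.setVar_var]
      simp only [show ((vOk : ℕ) = vB) = False by simp, show ((vOk : ℕ) = 1) = False by simp,
        if_false, ho]
      refine if_congr ?_ rfl rfl
      refine ⟨fun H => ⟨H, fun b' h1 h2 => by omega⟩, fun H => H.1⟩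
    · intro s2 h2 _
      rw [h2.1]
      refine if_congr ?_ rfl rfl
      constructor
      · rintro ⟨⟨h1, h2⟩, h3⟩
        refine ⟨h1, fun a' ha' ha'ℓ b hb => ?_⟩
        rcases Nat.eq_or_lt_of_le ha' with rfl | hlt
        · exact h3 b (Nat.zero_le _) hb
        · exact h2 a' hlt ha'ℓ b hb
      · rintro ⟨h1, h2⟩
        exact ⟨⟨h1, fun a' ha' => h2 a' (by omega)⟩, fun b _ hb => h2 a le_rfl haℓ b hb⟩
  · rw [o0]
    refine if_congr ?_ rfl rfl
    exact ⟨fun H => ⟨H, fun a' h1 h2 => by omega⟩, fun H => H.1⟩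
  · intro s' h' _
    rw [h'.1, adjBit]
    refine if_congr ?_ rfl rfl
    rw [adjNat_rowGraph hiN hjN]
    exact ⟨fun H => ⟨H.1, fun a ha => H.2 a (Nat.zero_le _) ha⟩,
      fun H => ⟨H.1, fun a _ ha => H.2 a ha⟩⟩

end

/-! ### Preparing the input of the simulated program -/

section

variable {α β : Type} {p q : Prog} {s σ : MemState} {T T₁ T₂ : ℕ}
variable {n : ℕ} {G : SimpleGraph (Fin n)} {ℓ N X : ℕ} {w : ℕ → ℕ → ℕ}
variable {A : Prog} {V W r : ℕ}

theorem mul_add_inj {N i j i' j' : ℕ} (hj : j < N) (hj' : j' < N)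
    (h : i * N + j = i' * N + j') : i = i' ∧ j = j' := by
  have h1 : i = i' := by
    have := congrArg (· / N) h
    beta_reduce at this
    rwa [Nat.mul_comm, Nat.mul_add_div (by omega), Nat.mul_comm i',
      Nat.mul_add_div (by omega), Nat.div_eq_of_lt hj, Nat.div_eq_of_lt hj'] at this
  subst h1
  exact ⟨rfl, by omega⟩

/-! ### Writing the graph of rows into the memory -/

/-- The memory in which everything is zero. -/
def zeroMem : MemState := ⟨0, 0⟩

/-- The entries of the adjacency matrix of `H` that satisfy `P` have been written into the memory of
the simulated program. -/
def Written (A : Prog) (V W r : ℕ) (H : SimpleGraph (Fin N)) (P : ℕ → ℕ → Prop)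
    (σ : MemState) : Prop :=
  ∃ M : MemState, Simulates A V W r ([], M) σ ∧ (∀ i, M.var i = 0) ∧
    (∀ b, b ≠ 0 → ∀ x, M.arr b x = 0) ∧ (∀ x, N * N ≤ x → M.arr 0 x = 0) ∧
    ∀ i < N, ∀ j < N, P i j → M.arr 0 (i * N + j) = adjBit H i j ∧
      σ.arr aAdj (i * N + j) = adjBit H i j

theorem Written.congr {H : SimpleGraph (Fin N)} {P Q : ℕ → ℕ → Prop} {σ σ' : MemState}
    (h : Written A V W r H P σ) (ha : ∀ b, 2 ≤ b → σ'.arr b = σ.arr b)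
    (hv : ∀ y, 30 ≤ y ∨ y = vSp ∨ y = vTouched → σ'.var y = σ.var y)
    (hPQ : ∀ i < N, ∀ j < N, Q i j → P i j) :
    Written A V W r H Q σ' := by
  obtain ⟨M, h1, h2, h3, h4, h5⟩ := h
  refine ⟨M, h1.congr (fun b hb => ha b (by omega)) hv, h2, h3, h4, fun i hi j hj hij => ?_⟩
  rw [ha _ (by omega)]
  exact h5 i hi j hj (hPQ i hi j hj hij)

/-- Write the entry of the adjacency matrix for the rows `x_vI` and `x_vJ`. -/
def buildEntry : Prog :=
  compareRows ;; mulAdd vAddr vI vCount vJ ;; .store aAdj vAddr vOk ;; .store 5 vAddr vOk ;;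
  touch vAddr

theorem compareRows_writesVar {y : ℕ} (h : compareRows.WritesVar y) :
    y = 1 ∨ 13 ≤ y ∧ y ≤ 20 ∨ y = vX ∨ y = vY := by
  simp [compareRows, checkEntries, mulAdd, forDown, Prog.WritesVar] at h
  omega

theorem compareRows_writesArr (y : ℕ) : ¬ compareRows.WritesArr y := by
  simp [compareRows, checkEntries, mulAdd, forDown, Prog.WritesArr]

/-- Each entry is stored twice: in the input array of the simulated program, which may overwrite it,
and in `aAdj`, from which the output is checked afterwards. -/
theorem runs_buildEntry (hW : 0 < W) (h : HoldsRows G ℓ N w s)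
    (hw : ∀ i < N, ∀ a < ℓ, w i a < n)
    (hnX : n ≤ X) (hNX : N ≤ X) (hℓX : ℓ ≤ X) (hX : 1 ≤ X) {i j : ℕ}
    (hi : s.var vI = i) (hj : s.var vJ = j) (hiN : i < N) (hjN : j < N) {P : ℕ → ℕ → Prop}
    (hB : Written A V W r (rowGraph G ℓ N w) P s) :
    Runs buildEntry s (150 * X ^ 3) (Written A V W (r + 1) (rowGraph G ℓ N w)
      fun i' j' => P i' j' ∨ i' = i ∧ j' = j) := by
  have hX3 : X ≤ X ^ 3 := by
    calc X = X ^ 1 := (pow_one X).symm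
      _ ≤ X ^ 3 := Nat.pow_le_pow_right hX (by omega)
  refine Yields.mono (T₁ := 120 * X ^ 3 + (14 * X + 9 + 1) + 1) ?_ (by omega)
  refine Runs.seq (runs_compareRows h hw hnX hNX hℓX hX hi hj hiN hjN) fun s1 h1 hf1 => ?_
  have v1 : ∀ y, y ≠ 1 → ¬ (13 ≤ y ∧ y ≤ 20) → y ≠ vX → y ≠ vY → s1.var y = s.var y :=
    fun y _ _ _ _ => hf1.var y fun hy => by
      have := compareRows_writesVar hy
      omega
  have b1 : Written A V W r (rowGraph G ℓ N w) P s1 :=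
    hB.congr (fun b _ => hf1.arr b (compareRows_writesArr b))
      (fun y hy => v1 y (by omega) (by omega) (by omega) (by omega)) fun _ _ _ _ h => h
  refine Runs.seq (runs_mulAdd (T := X) (by decide) (by decide) (by decide) (by decide) (by decide)
    (by decide) (by decide) (by decide)
    (by rw [v1 _ (by decide) (by decide) (by decide) (by decide), hi]; omega) hX) fun s2 h2 hf2 => ?_
  have e2 : s2.var vAddr = i * N + j := by
    rw [h2, v1 vI (by decide) (by decide) (by decide) (by decide),
      v1 vJ (by decide) (by decide) (by decide) (by decide),
      v1 vCount (by decide) (by decide) (by decide) (by decide), hi, hj, h.count]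
  have o2 : s2.var vOk = adjBit (rowGraph G ℓ N w) i j := by
    rw [hf2.var _ (by simp [mulAdd, forDown, Prog.WritesVar]), h1]
  have b2 : Written A V W r (rowGraph G ℓ N w) P s2 :=
    b1.congr (fun b _ => hf2.arr b (by simp [mulAdd, forDown, Prog.WritesArr]))
      (fun y hy => hf2.var y (by simp [mulAdd, forDown, Prog.WritesVar]; omega)) fun _ _ _ _ h => h
  refine Yields.straight (p := .store aAdj vAddr vOk ;; .store 5 vAddr vOk ;; touch vAddr)
    (by simp [Prog.Straight, touch]) ?_
  simp only [Prog.eval, MemState.setArr_var, e2, o2]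
  obtain ⟨M, m1, m2, m3, m4, m5⟩ := b2
  have m1' : Simulates A V W r ([], M)
      (s2.setArr aAdj (i * N + j) (adjBit (rowGraph G ℓ N w) i j)) := by
    refine m1.congr (fun b hb => ?_) fun y _ => rfl
    funext x
    simp [show b ≠ 2 by omega]
  have hlt : i * N + j < N * N := by
    have : (i + 1) * N ≤ N * N := Nat.mul_le_mul_right _ hiN
    rw [Nat.succ_mul] at this
    omega
  refine ⟨M.setArr 0 (i * N + j) (adjBit (rowGraph G ℓ N w) i j),
    m1'.store (b := 0) hW (by simp [e2]), m2, ?_, ?_, ?_⟩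
  · intro b hb x
    simp [hb, m3 b hb x]
  · intro x hx
    simp [show x ≠ i * N + j by omega, m4 x hx]
  · intro i' hi' j' hj' hij
    by_cases heq : i' * N + j' = i * N + j
    · obtain ⟨rfl, rfl⟩ := mul_add_inj hj' hjN heq
      simp [touch, Prog.eval]
    · rcases hij with hP | ⟨rfl, rfl⟩
      · have := m5 i' hi' j' hj' hP
        simpa [touch, Prog.eval, heq] using this
      · exact absurd rfl heq

/-- Write the row of the adjacency matrix for the row `x_vI`. -/
def buildLine : Prog := .const 1 0 ;; .add vJ vCount 1 ;; forDown vJ buildEntry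

theorem buildEntry_writesVar {y : ℕ} (h : buildEntry.WritesVar y) :
    y = 1 ∨ 13 ≤ y ∧ y ≤ 20 ∨ y = vTouched ∨ y = vX ∨ y = vY := by
  simp only [buildEntry, Prog.WritesVar] at h
  rcases h with h | h | h
  · have := compareRows_writesVar h
    omega
  all_goals simp [mulAdd, touch, forDown, Prog.WritesVar] at h; omega

theorem buildEntry_writesArr {y : ℕ} (h : buildEntry.WritesArr y) : 2 ≤ y := by
  simp only [buildEntry, Prog.WritesArr] at h
  rcases h with h | h | h
  · exact absurd h (compareRows_writesArr y)
  all_goals simp [mulAdd, touch, forDown, Prog.WritesArr] at h <;> omega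

theorem buildLine_writesVar {y : ℕ} (h : buildLine.WritesVar y) :
    y = 1 ∨ 12 ≤ y ∧ y ≤ 20 ∨ y = vTouched ∨ y = vX ∨ y = vY := by
  simp only [buildLine, forDown, Prog.WritesVar] at h
  rcases h with h | h | h | h | h
  all_goals first | omega | (have := buildEntry_writesVar h; omega)

theorem buildLine_writesArr {y : ℕ} (h : buildLine.WritesArr y) : 2 ≤ y := by
  simp only [buildLine, forDown, Prog.WritesArr, false_or] at h
  exact buildEntry_writesArr h

theorem HoldsRows.frame' {s s' : MemState} (h : HoldsRows G ℓ N w s) (hf : Frame p s s')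
    (hv : ∀ y, p.WritesVar y → y = 1 ∨ 11 ≤ y) (ha : ∀ y, p.WritesArr y → 2 ≤ y) :
    HoldsRows G ℓ N w s' :=
  h.congr (fun y hy => hf.var y fun h' => by have := hv y h'; omega)
    (fun y hy => hf.arr y fun h' => by have := ha y h'; omega)

theorem runs_buildLine (hW : 0 < W) (h : HoldsRows G ℓ N w s) (hw : ∀ i < N, ∀ a < ℓ, w i a < n)
    (hnX : n ≤ X) (hNX : N ≤ X) (hℓX : ℓ ≤ X) (hX : 1 ≤ X) {i : ℕ}
    (hi : s.var vI = i) (hiN : i < N)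
    (hB : Written A V W r (rowGraph G ℓ N w) (fun i' _ => i < i') s) :
    Runs buildLine s (165 * X ^ 4) (Written A V W (r + N) (rowGraph G ℓ N w)
      fun i' _ => i ≤ i') := by
  have ht := loop_time_le 150 3 (D := 4) hX hNX
  have hX4 : 1 ≤ X ^ 4 := Nat.one_le_pow _ _ hX
  refine Yields.mono (Yields.straight_seq (p := .const 1 0) trivial
    (Yields.straight_seq (p := .add vJ vCount 1) trivial
    (T := N * (150 * X ^ 3 + 6) + 1) ?_)) (by simp [Prog.cost]; omega)
  refine (Runs.forDown (T := 150 * X ^ 3) (N := N) (fun j s' => j ≤ N ∧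
    Written A V W (r + (N - j)) (rowGraph G ℓ N w) (fun i' j' => i < i' ∨ i' = i ∧ j ≤ j') s')
    (by decide) (fun h => by have := buildEntry_writesVar h; omega) ?_ ?_ ?_ ?_).conseq le_rfl ?_
  · rintro j s' v ⟨hj, h⟩
    refine ⟨hj, h.congr (fun _ _ => rfl) (fun y hy => ?_) fun _ _ _ _ h => h⟩
    simp [show y ≠ vJ by omega, show y ≠ 1 by omega]
  · rintro j s1 hj hJ ⟨-, hB1⟩ hf
    have hs : ∀ y, (forDown vJ buildEntry).WritesVar y → y = 1 ∨ 12 ≤ y := by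
      intro y hy
      simp only [forDown, Prog.WritesVar] at hy
      rcases hy with h | h | h
      · omega
      · omega
      · have := buildEntry_writesVar h; omega
    have r1 : HoldsRows G ℓ N w s1 := by
      refine HoldsRows.frame' (p := forDown vJ buildEntry) (h.congr ?_ ?_) hf
        (fun y hy => by have := hs y hy; omega) ?_
      · intro y hy
        simp [Prog.eval, show y ≠ vJ by omega, show y ≠ 1 by omega]
      · intro y _
        simp [Prog.eval]
      · intro y hy
        simp only [forDown, Prog.WritesArr, false_or] at hy
        exact buildEntry_writesArr hy
    have i1 : s1.var vI = i := by
      rw [hf.var _ fun hy => by have := hs _ hy; omega]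
      simp [Prog.eval, hi]
    refine (runs_buildEntry hW r1 hw hnX hNX hℓX hX i1 hJ hiN hj hB1).conseq le_rfl ?_
    intro s2 h2 _
    refine ⟨hj.le, ?_⟩
    rw [show r + (N - (j + 1)) + 1 = r + (N - j) by omega] at h2
    refine h2.congr (fun _ _ => rfl) (fun _ _ => rfl) ?_
    rintro i' - j' - (h | ⟨h, h'⟩)
    · exact Or.inl (Or.inl h)
    · rcases Nat.eq_or_lt_of_le h' with h' | h'
      · exact Or.inr ⟨h, h'.symm⟩
      · exact Or.inl (Or.inr ⟨h, h'⟩)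
  · simp [Prog.eval, h.count]
  · refine ⟨le_rfl, ?_⟩
    rw [Nat.sub_self, Nat.add_zero]
    refine hB.congr (fun y _ => by simp [Prog.eval]) (fun y hy => ?_) ?_
    · simp [Prog.eval, show y ≠ vJ by omega, show y ≠ 1 by omega]
    · rintro i' - j' hj' (h | ⟨h, h'⟩)
      · exact h
      · omega
  · rintro s2 ⟨⟨-, h2⟩, -⟩ _
    refine h2.congr (fun _ _ => rfl) (fun _ _ => rfl) ?_
    rintro i' - j' - h
    rcases Nat.eq_or_lt_of_le h with h | h
    · exact Or.inr ⟨h.symm, Nat.zero_le _⟩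
    · exact Or.inl h

/-- Write the adjacency matrix of the graph of rows. -/
def buildGraph : Prog := .const 1 0 ;; .add vI vCount 1 ;; forDown vI buildLine

theorem buildGraph_writesVar {y : ℕ} (h : buildGraph.WritesVar y) :
    y = 1 ∨ 11 ≤ y ∧ y ≤ 20 ∨ y = vTouched ∨ y = vX ∨ y = vY := by
  simp only [buildGraph, forDown, Prog.WritesVar] at h
  rcases h with h | h | h | h | h
  all_goals first | omega | (have := buildLine_writesVar h; omega)

theorem buildGraph_writesArr {y : ℕ} (h : buildGraph.WritesArr y) : 2 ≤ y := by
  simp only [buildGraph, forDown, Prog.WritesArr, false_or] at h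
  exact buildLine_writesArr h

theorem runs_buildGraph (hW : 0 < W) (h : HoldsRows G ℓ N w s) (hw : ∀ i < N, ∀ a < ℓ, w i a < n)
    (hnX : n ≤ X) (hNX : N ≤ X) (hℓX : ℓ ≤ X) (hX : 1 ≤ X)
    (hB : Simulates A V W 0 ([], zeroMem) s) :
    Runs buildGraph s (180 * X ^ 5) (Written A V W (N * N) (rowGraph G ℓ N w)
      fun _ _ => True) := by
  have ht := loop_time_le 165 4 (D := 5) hX hNX
  have hX5 : 1 ≤ X ^ 5 := Nat.one_le_pow _ _ hX
  refine Yields.mono (Yields.straight_seq (p := .const 1 0) trivial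
    (Yields.straight_seq (p := .add vI vCount 1) trivial
    (T := N * (165 * X ^ 4 + 6) + 1) ?_)) (by simp [Prog.cost]; omega)
  refine (Runs.forDown (T := 165 * X ^ 4) (N := N) (fun i s' => i ≤ N ∧
    Written A V W ((N - i) * N) (rowGraph G ℓ N w) (fun i' _ => i ≤ i') s')
    (by decide) (fun h => by have := buildLine_writesVar h; omega) ?_ ?_ ?_ ?_).conseq le_rfl ?_
  · rintro j s' v ⟨hj, h⟩
    refine ⟨hj, h.congr (fun _ _ => rfl) (fun y hy => ?_) fun _ _ _ _ h => h⟩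
    simp [show y ≠ vI by omega, show y ≠ 1 by omega]
  · rintro i s1 hi hI ⟨-, hB1⟩ hf
    have r1 : HoldsRows G ℓ N w s1 := by
      refine HoldsRows.frame' (p := forDown vI buildLine) (h.congr ?_ ?_) hf ?_ ?_
      · intro y hy
        simp [Prog.eval, show y ≠ vI by omega, show y ≠ 1 by omega]
      · intro y _
        simp [Prog.eval]
      · intro y hy
        simp only [forDown, Prog.WritesVar] at hy
        rcases hy with h | h | h
        · omega
        · omega
        · have := buildLine_writesVar h; omega
      · intro y hy
        simp only [forDown, Prog.WritesArr, false_or] at hy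
        exact buildLine_writesArr hy
    refine (runs_buildLine hW r1 hw hnX hNX hℓX hX hI hi hB1).conseq le_rfl ?_
    intro s2 h2 _
    refine ⟨hi.le, ?_⟩
    rwa [← Nat.succ_mul, show (N - (i + 1)).succ = N - i by omega] at h2
  · simp [Prog.eval, h.count]
  · refine ⟨le_rfl, zeroMem, ?_, fun _ => rfl, fun _ _ _ => rfl, fun _ _ => rfl,
      fun i hi j _ h => by omega⟩
    rw [Nat.sub_self, Nat.zero_mul]
    refine hB.congr (fun y _ => by simp [Prog.eval]) (fun y hy => ?_)
    simp [Prog.eval, show y ≠ vI by omega, show y ≠ 1 by omega]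
  · rintro s2 ⟨⟨-, h2⟩, -⟩ _
    refine h2.congr (fun _ _ => rfl) (fun _ _ => rfl) ?_
    exact fun i' _ j' _ _ => Nat.zero_le _

/-! ### Starting the simulation -/

/-- Put the number of rows and `c * x_vSide` into the input variables, and start `A`. -/
noncomputable def startRun (A : Prog) (c : ℕ) : Prog :=
  .const vX c ;; .const vU 0 ;; mulAdd vY vX vSide vU ;; .const 1 0 ;; .add 31 vY 1 ;;
  .add 30 vCount 1 ;; .add vFuel vTime 1 ;; pushConst (A.index A)

/-- Division with remainder by `N` reaches every cell below `N * N`. Equality of all the arrays is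
needed because the guarantees for `A` concern exactly this memory. -/
theorem Written.eq_graphInput {H : SimpleGraph (Fin N)} {M : MemState} {k : ℕ}
    (h3 : ∀ b, b ≠ 0 → ∀ x, M.arr b x = 0) (h4 : ∀ x, N * N ≤ x → M.arr 0 x = 0)
    (h5 : ∀ i < N, ∀ j < N, M.arr 0 (i * N + j) = adjBit H i j) :
    M.arr = (graphInput H k).arr := by
  funext b x
  by_cases hb : b = 0
  · subst hb
    by_cases hx : N * N ≤ x
    · rw [h4 x hx, graphInput_arr_of_le H k hx]
    · have hN : 0 < N := by
        rcases Nat.eq_zero_or_pos N with rfl | h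
        · simp at hx
        · exact h
      have h1 : x / N < N := Nat.div_lt_of_lt_mul (by omega)
      have h2 : x % N < N := Nat.mod_lt _ hN
      have hxe : x = x / N * N + x % N := by
        rw [Nat.mul_comm]; exact (Nat.div_add_mod x N).symm
      rw [hxe, h5 _ h1 _ h2, graphInput_arr H k h1 h2]
  · rw [h3 b hb]
    simp [graphInput, hb]

/-- The bound `2 ≤ V` makes room for the input variables `x₀` and `x₁`, which are set even if `A`
never assigns to them. -/
theorem runs_startRun (hV : 2 ≤ V) {H : SimpleGraph (Fin N)} {c t : ℕ}
    (hcX : c ≤ X) (hX : 1 ≤ X)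
    (hN : s.var vCount = N) (ht : s.var vSide = t) (hT : s.var vTime = T)
    (hB : Written A V W r H (fun _ _ => True) s) :
    Runs (startRun A c) s (40 * X) fun s' =>
      Simulates A V W r ([A], graphInput H (c * t)) s' ∧ s'.var vFuel = T ∧
      ∀ i < N, ∀ j < N, s'.arr aAdj (i * N + j) = adjBit H i j := by
  refine Yields.mono (T₁ := 1 + (1 + (14 * X + 15 + 1) + 1) + 1) ?_ (by omega)
  refine Yields.straight_seq (p := .const vX c) trivial
    (Yields.straight_seq (p := .const vU 0) trivial ?_)
  simp only [Prog.eval]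
  refine Runs.seq (runs_mulAdd (T := X) (by decide) (by decide) (by decide) (by decide) (by decide)
    (by decide) (by decide) (by decide) (by simpa using hcX) hX) fun s1 h1 hf1 => ?_
  have e1 : s1.var vY = c * t := by rw [h1]; simp [ht]
  have hw : ∀ y, y ≠ 1 → y ≠ vY → y ≠ vX → y ≠ vU → y ≠ vCtr → s1.var y = s.var y := by
    intro y h1 h2 h3 h4 h5
    rw [hf1.var y (by simp [mulAdd, forDown, Prog.WritesVar, h1, h2, h5])]
    simp [h3, h4]
  have hB1 : Written A V W r H (fun _ _ => True) s1 := by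
    refine hB.congr (fun b _ => ?_) (fun y hy => hw y (by omega) (by omega) (by omega) (by omega)
      (by omega)) fun _ _ _ _ h => h
    rw [hf1.arr b (by simp [mulAdd, forDown, Prog.WritesArr])]
    rfl
  obtain ⟨M, m1, m2, m3, m4, m5⟩ := hB1
  refine (Runs.straight (p := .const 1 0 ;; .add 31 vY 1 ;; .add 30 vCount 1 ;;
    .add vFuel vTime 1 ;; pushConst (A.index A)) (by simp [Prog.Straight, pushConst]) ?_).conseq
    (by simp [Prog.cost, pushConst]) fun _ h _ => h
  have hM : graphInput H (c * t) = (M.setVar 1 (c * t)).setVar 0 N := by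
    ext y
    · simp [graphInput, m2]
    · rw [← Written.eq_graphInput m3 m4 fun i hi j hj => (m5 i hi j hj trivial).1]
      rfl
  refine ⟨?_, ?_, ?_⟩
  · rw [hM]
    simp only [Prog.eval]
    refine Simulates.push ?_ A.self_mem_subprogs
    have := (m1.setVar (i := 1) (v := c * t) (by omega)).setVar (i := 0) (v := N) (by omega)
    refine this.congr (fun _ _ => rfl) fun y hy => ?_
    simp [e1, hw vCount, hN]
    split_ifs <;> omega
  · simp [Prog.eval, pushConst, hw vTime, hT]
  · intro i hi j hj
    have := (m5 i hi j hj trivial).2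
    simpa [Prog.eval, pushConst] using this

end

/-! ### Checking the output and restoring the memory -/

section

variable {α β : Type} {p q : Prog} {s σ : MemState} {T T₁ T₂ : ℕ}
variable {n : ℕ} {G : SimpleGraph (Fin n)} {ℓ N X : ℕ} {w : ℕ → ℕ → ℕ}
variable {A : Prog} {V W r : ℕ}

/-! ### Inspecting the output of the simulated program -/

/-- The arrays `a₀` and `a₁` of `M` list vertices of `H` that form a copy of `K_{t,t}`. -/
def ListsBiclique (H : SimpleGraph (Fin N)) (t : ℕ) (M : MemState) : Prop :=
  -- A larger output is fine: only its first `t` entries on each side are inspected.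
  t ≤ M.var 0 ∧ ∀ i < t, ∀ j < t, adjNat H (M.arr 0 i) (M.arr 1 j) ∧
    (i ≠ j → M.arr 0 i ≠ M.arr 0 j ∧ M.arr 1 i ≠ M.arr 1 j)

/-- Set `x_vOk` to `0` if the entries `x_vI` and `x_vJ` of the output are at fault. -/
def checkOutput : Prog :=
  .load vU 5 vI ;; .load vV 6 vJ ;; .load vA 5 vJ ;; .load vB 6 vI ;;
  -- The truncated difference `u + 1 - N` is zero exactly when `u < N`: the output may be garbage,
  -- so its range is tested before an address is computed.
  .const 1 1 ;; .add vX vU 1 ;; .sub vX vX vCount ;; .add vY vV 1 ;; .sub vY vY vCount ;;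
  .add vX vX vY ;;
  (.ite vX (.const vOk 0)
    (mulAdd vAddr vU vCount vV ;; .load vX aAdj vAddr ;; .ite vX .skip (.const vOk 0))) ;;
  .sub vX vI vJ ;; .sub vY vJ vI ;; .add vX vX vY ;;
  .ite vX (.sub vX vU vA ;; .sub vY vA vU ;; .add vX vX vY ;; .ite vX .skip (.const vOk 0) ;;
    .sub vX vV vB ;; .sub vY vB vV ;; .add vX vX vY ;; .ite vX .skip (.const vOk 0)) .skip

open Classical in
theorem runs_checkOutput {H : SimpleGraph (Fin N)} {M : MemState} {i j : ℕ}
    (hNX : N ≤ X) (hX : 1 ≤ X)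
    (hN : s.var vCount = N) (hadj : ∀ i < N, ∀ j < N, s.arr aAdj (i * N + j) = adjBit H i j)
    (h0 : s.arr 5 = M.arr 0) (h1 : s.arr 6 = M.arr 1) (hi : s.var vI = i) (hj : s.var vJ = j) :
    Runs checkOutput s (80 * X) fun s' => s'.var vOk =
      if adjNat H (M.arr 0 i) (M.arr 1 j) ∧
        (i ≠ j → M.arr 0 i ≠ M.arr 0 j ∧ M.arr 1 i ≠ M.arr 1 j) then s.var vOk else 0 := by
  refine Yields.mono (T₁ := 20 + (14 * X + 6 + 26)) ?_ (by omega)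
  refine Yields.mono (Yields.straight_seq (p := .load vU 5 vI) trivial
    (Yields.straight_seq (p := .load vV 6 vJ) trivial
    (Yields.straight_seq (p := .load vA 5 vJ) trivial
    (Yields.straight_seq (p := .load vB 6 vI) trivial
    (Yields.straight_seq (p := .const 1 1) trivial
    (Yields.straight_seq (p := .add vX vU 1) trivial
    (Yields.straight_seq (p := .sub vX vX vCount) trivial
    (Yields.straight_seq (p := .add vY vV 1) trivial
    (Yields.straight_seq (p := .sub vY vY vCount) trivial
    (Yields.straight_seq (p := .add vX vX vY) (T := 14 * X + 6 + 26) trivial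
    ?_)))))))))) (by simp [Prog.cost]; omega)
  generalize hs1 : Prog.eval (.add vX vX vY) _ = s1
  have i1 : s1.var vI = i := by simp [← hs1, Prog.eval, hi]
  have j1 : s1.var vJ = j := by simp [← hs1, Prog.eval, hj]
  have u1 : s1.var vU = M.arr 0 i := by simp [← hs1, Prog.eval, h0, hi]
  have v1 : s1.var vV = M.arr 1 j := by simp [← hs1, Prog.eval, h1, hj]
  have a1 : s1.var vA = M.arr 0 j := by simp [← hs1, Prog.eval, h0, hj]
  have b1 : s1.var vB = M.arr 1 i := by simp [← hs1, Prog.eval, h1, hi]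
  have n1 : s1.var vCount = N := by simp [← hs1, Prog.eval, hN]
  have o1 : s1.var vOk = s.var vOk := by simp [← hs1, Prog.eval]
  have x1 : s1.var vX = (M.arr 0 i + 1 - N) + (M.arr 1 j + 1 - N) := by
    simp [← hs1, Prog.eval, h0, h1, hi, hj, hN]
  have adj1 : s1.arr aAdj = s.arr aAdj := by simp [← hs1, Prog.eval]
  clear hs1
  refine Yields.mono (T₁ := (14 * X + 6) + 25 + 1) ?_ (by omega)
  refine Runs.seq (T₁ := 14 * X + 6) (T₂ := 25) (Q := fun s2 => s2.var vOk =
    if adjNat H (M.arr 0 i) (M.arr 1 j) then s.var vOk else 0) ?_ fun s2 o2 hf2 => ?_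
  · refine Yields.ite (fun hx => ?_) fun hx => ?_
    · refine (Runs.straight (p := .const vOk 0) trivial ?_).conseq (by simp [Prog.cost])
        fun _ h _ => h
      have : ¬ adjNat H (M.arr 0 i) (M.arr 1 j) := by
        rintro ⟨h2, h3, -⟩
        rw [x1] at hx
        omega
      simp [Prog.eval, this]
    · rw [x1] at hx
      have hu : M.arr 0 i < N := by omega
      have hv : M.arr 1 j < N := by omega
      refine Yields.mono (T₁ := 14 * X + 4 + 1) ?_ (by omega)
      refine Runs.seq (runs_mulAdd (T := X) (by decide) (by decide) (by decide) (by decide)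
        (by decide) (by decide) (by decide) (by decide) (by rw [u1]; omega) hX)
        fun s3 h3 hf3 => ?_
      have e3 : s3.arr aAdj (s3.var vAddr) = adjBit H (M.arr 0 i) (M.arr 1 j) := by
        rw [h3, u1, v1, n1, hf3.arr _ (by simp [mulAdd, forDown, Prog.WritesArr]), adj1,
          hadj _ hu _ hv]
      have o3 : s3.var vOk = s.var vOk := by
        rw [hf3.var _ (by simp [mulAdd, forDown, Prog.WritesVar]), o1]
      refine Runs.straight (p := .load vX aAdj vAddr ;; .ite vX .skip (.const vOk 0))
        (by simp [Prog.Straight]) ?_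
      by_cases ha : adjNat H (M.arr 0 i) (M.arr 1 j)
      · simp [Prog.eval, e3, adjBit, ha, o3]
      · simp [Prog.eval, e3, adjBit, ha]
  · have hw : ∀ y, y = vI ∨ y = vJ ∨ y = vU ∨ y = vV ∨ y = vA ∨ y = vB →
        s2.var y = s1.var y := by
      intro y hy
      refine hf2.var y ?_
      simp [mulAdd, forDown, Prog.WritesVar]
      omega
    refine (Runs.straight (p := .sub vX vI vJ ;; .sub vY vJ vI ;; .add vX vX vY ;;
      .ite vX (.sub vX vU vA ;; .sub vY vA vU ;; .add vX vX vY ;; .ite vX .skip (.const vOk 0) ;;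
      .sub vX vV vB ;; .sub vY vB vV ;; .add vX vX vY ;; .ite vX .skip (.const vOk 0)) .skip)
      (by simp [Prog.Straight]) ?_).conseq (by simp [Prog.cost]) fun _ h _ => h
    have i2 := (hw vI (by simp)).trans i1
    have j2 := (hw vJ (by simp)).trans j1
    have u2 := (hw vU (by simp)).trans u1
    have v2 := (hw vV (by simp)).trans v1
    have a2 := (hw vA (by simp)).trans a1
    have b2 := (hw vB (by simp)).trans b1
    by_cases hij : i = j
    · subst hij
      simp [Prog.eval, i2, j2, o2]
    · have hij' : ¬ (i - j = 0 ∧ j - i = 0) := by omega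
      by_cases hA : M.arr 0 i = M.arr 0 j
      · simp [Prog.eval, i2, j2, u2, v2, a2, b2, hij, hij', hA]
        split_ifs <;> simp
      · have hA' : ¬ (M.arr 0 i - M.arr 0 j = 0 ∧ M.arr 0 j - M.arr 0 i = 0) := by omega
        by_cases hB : M.arr 1 i = M.arr 1 j
        · simp [Prog.eval, i2, j2, u2, v2, a2, b2, hij, hij', hA, hA', hB]
        · have hB' : ¬ (M.arr 1 j - M.arr 1 i = 0 ∧ M.arr 1 i - M.arr 1 j = 0) := by omega
          simp [Prog.eval, i2, j2, u2, v2, a2, b2, hij, hij', hA, hA', hB, hB', o2]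

/-- Check the output for one value of `x_vI`. -/
def checkOutputLine : Prog := .const 1 0 ;; .add vJ vSide 1 ;; forDown vJ checkOutput

open Classical in
theorem runs_checkOutputLine {H : SimpleGraph (Fin N)} {M : MemState} {i t : ℕ}
    (hNX : N ≤ X) (htX : t ≤ X) (hX : 1 ≤ X)
    (hN : s.var vCount = N) (hadj : ∀ i < N, ∀ j < N, s.arr aAdj (i * N + j) = adjBit H i j)
    (h0 : s.arr 5 = M.arr 0) (h1 : s.arr 6 = M.arr 1) (hi : s.var vI = i)
    (ht : s.var vSide = t) :
    Runs checkOutputLine s (100 * X ^ 2) fun s' => s'.var vOk =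
      if ∀ j < t, adjNat H (M.arr 0 i) (M.arr 1 j) ∧
        (i ≠ j → M.arr 0 i ≠ M.arr 0 j ∧ M.arr 1 i ≠ M.arr 1 j) then s.var vOk else 0 := by
  have ht' := loop_time_le 80 1 (D := 2) hX htX
  have hX2 : 1 ≤ X ^ 2 := Nat.one_le_pow _ _ hX
  rw [pow_one] at ht'
  refine Yields.mono (Yields.straight_seq (p := .const 1 0) trivial
    (Yields.straight_seq (p := .add vJ vSide 1) trivial
    (T := t * (80 * X + 6) + 1) ?_)) (by simp [Prog.cost]; omega)
  have hw : ∀ y, y = vI ∨ y = vCount → ¬ (forDown vJ checkOutput).WritesVar y := by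
    rintro y (rfl | rfl) <;> simp [forDown, checkOutput, mulAdd, Prog.WritesVar]
  have hwa : ∀ y, ¬ (forDown vJ checkOutput).WritesArr y := by
    simp [forDown, checkOutput, mulAdd, Prog.WritesArr]
  refine (Runs.forDown (T := 80 * X) (N := t) (fun j s' => s'.var vOk =
    if ∀ j', j ≤ j' → j' < t → adjNat H (M.arr 0 i) (M.arr 1 j') ∧
        (i ≠ j' → M.arr 0 i ≠ M.arr 0 j' ∧ M.arr 1 i ≠ M.arr 1 j') then s.var vOk else 0)
    (by decide) (by simp [forDown, checkOutput, mulAdd, Prog.WritesVar]) ?_ ?_ ?_ ?_).conseq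
    le_rfl ?_
  · intro j s' v h
    simpa using h
  · intro j s1 hj hJ ho hf
    refine (runs_checkOutput (s := s1) (H := H) (M := M) (i := i) (j := j) hNX hX ?_ ?_ ?_ ?_ ?_
      hJ).conseq le_rfl ?_
    · rw [hf.var _ (hw _ (by simp))]; simp [Prog.eval, hN]
    · rw [hf.arr _ (hwa _)]; simpa [Prog.eval] using hadj
    · rw [hf.arr _ (hwa _)]; simpa [Prog.eval] using h0
    · rw [hf.arr _ (hwa _)]; simpa [Prog.eval] using h1
    · rw [hf.var _ (hw _ (by simp))]; simp [Prog.eval, hi]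
    intro s2 h2 _
    rw [h2, ho]
    by_cases hc : adjNat H (M.arr 0 i) (M.arr 1 j) ∧
        (i ≠ j → M.arr 0 i ≠ M.arr 0 j ∧ M.arr 1 i ≠ M.arr 1 j)
    · rw [if_pos hc]
      refine if_congr ?_ rfl rfl
      constructor
      · intro h j' hj' hj't
        rcases Nat.eq_or_lt_of_le hj' with rfl | hlt
        · exact hc
        · exact h j' hlt hj't
      · exact fun h j' hj' => h j' (by omega)
    · rw [if_neg hc, if_neg]
      exact fun h => hc (h j le_rfl hj)
  · simp [Prog.eval, ht]
  · rw [if_pos fun j' h1 h2 => by omega]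
    simp [Prog.eval]
  · intro s' h' _
    rw [h'.1]
    exact if_congr ⟨fun h j hj => h j (Nat.zero_le _) hj, fun h j _ hj => h j hj⟩ rfl rfl

/-- The result of a run: `none` if it has not halted, and otherwise whether a biclique has been
found. -/
abbrev Verdict : Type := Option Bool

/-- The number under which a verdict is stored. -/
def Verdict.code : Verdict → ℕ
  | none => 0
  | some false => 1
  | some true => 2

open Classical in
/-- The verdict on the configuration of the simulated program. -/
noncomputable def verdict (H : SimpleGraph (Fin N)) (t : ℕ) (c : Config) : Verdict :=
  if c.1 = [] then some (decide (ListsBiclique H t c.2)) else none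

/-- Compute the verdict in `x_vRes`. -/
def judge : Prog :=
  .ite vSp (.const vRes 0)
    (.const vOk 1 ;; .sub vX vSide 30 ;; .ite vX (.const vOk 0) .skip ;;
      .const 1 0 ;; .add vI vSide 1 ;; forDown vI checkOutputLine ;;
      .const 1 1 ;; .add vRes vOk 1)

theorem checkOutputLine_writesVar {y : ℕ} (h : checkOutputLine.WritesVar y) :
    y = 1 ∨ 12 ≤ y ∧ y ≤ 20 ∨ y = vX ∨ y = vY := by
  simp [checkOutputLine, checkOutput, mulAdd, forDown, Prog.WritesVar] at h
  omega

theorem checkOutputLine_writesArr (y : ℕ) : ¬ checkOutputLine.WritesArr y := by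
  simp [checkOutputLine, checkOutput, mulAdd, forDown, Prog.WritesArr]

theorem judge_writesVar {y : ℕ} (h : judge.WritesVar y) :
    y = 1 ∨ 11 ≤ y ∧ y ≤ 20 ∨ y = vX ∨ y = vY := by
  simp only [judge, forDown, Prog.WritesVar] at h
  by_cases hy : checkOutputLine.WritesVar y
  · have := checkOutputLine_writesVar hy
    omega
  · simp [hy] at h
    omega

theorem judge_writesArr (y : ℕ) : ¬ judge.WritesArr y := by
  simp [judge, forDown, Prog.WritesArr, checkOutputLine_writesArr]

theorem runs_judge {H : SimpleGraph (Fin N)} {c : Config} {t : ℕ}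
    (hNX : N ≤ X) (htX : t ≤ X) (hX : 1 ≤ X) (hS : Simulates A V W r c s)
    (hN : s.var vCount = N) (hadj : ∀ i < N, ∀ j < N, s.arr aAdj (i * N + j) = adjBit H i j)
    (ht : s.var vSide = t) :
    Runs judge s (130 * X ^ 3) fun s' => s'.var vRes = (verdict H t c).code := by
  classical
  have ht' := loop_time_le 100 2 (D := 3) hX htX
  have hX3 : 1 ≤ X ^ 3 := Nat.one_le_pow _ _ hX
  refine Yields.mono (T₁ := (t * (100 * X ^ 2 + 6) + 1 + 17) + 1) ?_ (by omega)
  refine Yields.ite (fun h0 => ?_) fun h0 => ?_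
  · refine (Runs.straight (p := .const vRes 0) trivial ?_).conseq (by simp [Prog.cost])
      fun _ h _ => h
    have : c.1 ≠ [] := by
      intro hc
      rw [hS.sp, hc] at h0
      simp at h0
    simp [Prog.eval, verdict, this, Verdict.code]
  have hc : c.1 = [] := by
    rw [hS.sp] at h0
    simpa using h0
  refine Yields.mono (Yields.straight_seq (p := .const vOk 1) trivial
    (Yields.straight_seq (p := .sub vX vSide 30) trivial
    (Yields.straight_seq (p := .ite vX (.const vOk 0) .skip) (by simp [Prog.Straight])
    (Yields.straight_seq (p := .const 1 0) trivial
    (Yields.straight_seq (p := .add vI vSide 1) trivial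
    (T := t * (100 * X ^ 2 + 6) + 1 + 3 + 1) ?_))))) (by simp [Prog.cost]; omega)
  generalize hs0 : Prog.eval (.add vI vSide 1) _ = s0
  have v0 : s.var 30 = c.2.var 0 := hS.var 0
  have o0 : s0.var vOk = if t ≤ c.2.var 0 then 1 else 0 := by
    simp [← hs0, Prog.eval, ht, v0]; split_ifs <;> simp <;> omega
  have w0 : ∀ y, y = vCount ∨ y = vSide → s0.var y = s.var y := by
    rintro y (rfl | rfl) <;> simp [← hs0, Prog.eval] <;> split_ifs <;> simp
  have i0 : s0.var vI = t := by
    simp [← hs0, Prog.eval, ht]; split_ifs <;> simp [ht]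
  have a0 : s0.arr = s.arr := by
    simp [← hs0, Prog.eval]; split_ifs <;> simp
  clear hs0
  have hw : ∀ y, y = vCount ∨ y = vSide → ¬ (forDown vI checkOutputLine).WritesVar y := by
    intro y hy h
    simp only [forDown, Prog.WritesVar] at h
    rcases h with h | h | h
    · omega
    · omega
    · have := checkOutputLine_writesVar h; omega
  have hwa : ∀ y, ¬ (forDown vI checkOutputLine).WritesArr y := by
    simp [forDown, Prog.WritesArr, checkOutputLine_writesArr]
  refine Runs.seq (T₁ := t * (100 * X ^ 2 + 6) + 1) (T₂ := 3)
    (Q := fun s' => s'.var vOk = if ListsBiclique H t c.2 then 1 else 0) ?_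
    fun s1 h1 hf1 => ?_
  · refine (Runs.forDown (T := 100 * X ^ 2) (N := t) (fun i s' => s'.var vOk =
      if t ≤ c.2.var 0 ∧ ∀ i', i ≤ i' → i' < t → ∀ j < t,
        adjNat H (c.2.arr 0 i') (c.2.arr 1 j) ∧
        (i' ≠ j → c.2.arr 0 i' ≠ c.2.arr 0 j ∧ c.2.arr 1 i' ≠ c.2.arr 1 j) then 1 else 0)
      (by decide) (fun h => by have := checkOutputLine_writesVar h; omega) ?_ ?_ i0 ?_).conseq
      le_rfl ?_
    · intro i s' v h
      simpa using h
    · intro i s1 hi hI ho hf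
      refine (runs_checkOutputLine (s := s1) (H := H) (M := c.2) (i := i) (t := t) hNX htX hX
        ?_ ?_ ?_ ?_ hI ?_).conseq le_rfl ?_
      · rw [hf.var _ (hw _ (by simp)), w0 _ (by simp), hN]
      · rw [hf.arr _ (hwa _), a0]; exact hadj
      · rw [hf.arr _ (hwa _), a0]; exact hS.arr 0
      · rw [hf.arr _ (hwa _), a0]; exact hS.arr 1
      · rw [hf.var _ (hw _ (by simp)), w0 _ (by simp), ht]
      intro s2 h2 _
      rw [h2, ho]
      by_cases hc : ∀ j < t, adjNat H (c.2.arr 0 i) (c.2.arr 1 j) ∧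
          (i ≠ j → c.2.arr 0 i ≠ c.2.arr 0 j ∧ c.2.arr 1 i ≠ c.2.arr 1 j)
      · rw [if_pos hc]
        refine if_congr (and_congr_right fun _ => ?_) rfl rfl
        constructor
        · intro h i' hi' hi't
          rcases Nat.eq_or_lt_of_le hi' with rfl | hlt
          · exact hc
          · exact h i' hlt hi't
        · exact fun h i' hi' => h i' (by omega)
      · rw [if_neg hc, if_neg]
        exact fun h => hc (h.2 i le_rfl hi)
    · rw [o0]
      refine if_congr ?_ rfl rfl
      exact ⟨fun h => ⟨h, fun i' h1 h2 => by omega⟩, fun h => h.1⟩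
    · intro s' h' _
      rw [h'.1]
      refine if_congr (and_congr_right fun _ => ?_) rfl rfl
      exact ⟨fun h i hi => h i (Nat.zero_le _) hi, fun h i _ hi => h i hi⟩
  · refine (Runs.straight (p := .const 1 1 ;; .add vRes vOk 1) (by simp [Prog.Straight]) ?_).conseq
      (by simp [Prog.cost]) fun _ h _ => h
    by_cases hL : ListsBiclique H t c.2
    · simp [Prog.eval, h1, verdict, hc, hL, Verdict.code]
    · simp [Prog.eval, h1, verdict, hc, hL, Verdict.code]

/-! ### Clearing the memory of the simulated program -/

/-- Set cell `x_vX` of the first `W` arrays of the simulated program to `x_vY`. -/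
def clearCells : ℕ → Prog
  | 0 => .skip
  | W + 1 => .store (W + 5) vX vY ;; clearCells W

theorem clearCells_straight (W : ℕ) : (clearCells W).Straight := by
  induction W with
  | zero => trivial
  | succ W ih => exact ⟨trivial, ih⟩

theorem clearCells_cost (W : ℕ) : (clearCells W).cost = 2 * W + 1 := by
  induction W with
  | zero => rfl
  | succ W ih => simp only [clearCells, Prog.cost, ih]; ring

theorem clearCells_writesArr {W y : ℕ} (h : (clearCells W).WritesArr y) : 5 ≤ y := by
  induction W with
  | zero => exact h.elim
  | succ W ih =>
    simp only [clearCells, Prog.WritesArr] at h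
    rcases h with h | h
    · omega
    · exact ih h

theorem clearCells_writesVar (W y : ℕ) : ¬ (clearCells W).WritesVar y := by
  induction W with
  | zero => exact id
  | succ W ih => simp [clearCells, Prog.WritesVar, ih]

theorem clearCells_eval (W : ℕ) (s : MemState) (b x : ℕ) :
    ((clearCells W).eval s).arr b x =
      if 5 ≤ b ∧ b < W + 5 ∧ x = s.var vX then s.var vY else s.arr b x := by
  induction W generalizing s with
  | zero =>
    rw [if_neg (by omega)]; rfl
  | succ W ih =>
    simp only [clearCells, Prog.eval, ih, MemState.setArr_var, MemState.setArr_arr]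
    split_ifs <;> first | rfl | omega

/-- Set the first `V` variables of the simulated program to `0`. -/
def clearVars : ℕ → Prog
  | 0 => .const vSp 0
  | V + 1 => .const (V + 30) 0 ;; clearVars V

theorem clearVars_straight (V : ℕ) : (clearVars V).Straight := by
  induction V with
  | zero => trivial
  | succ V ih => exact ⟨trivial, ih⟩

theorem clearVars_cost (V : ℕ) : (clearVars V).cost = 2 * V + 1 := by
  induction V with
  | zero => rfl
  | succ V ih => simp only [clearVars, Prog.cost, ih]; ring

theorem clearVars_writesArr (V y : ℕ) : ¬ (clearVars V).WritesArr y := by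
  induction V with
  | zero => exact id
  | succ V ih => simp [clearVars, Prog.WritesArr, ih]

theorem clearVars_writesVar {V y : ℕ} (h : (clearVars V).WritesVar y) : y = vSp ∨ 30 ≤ y := by
  induction V with
  | zero => exact Or.inl h
  | succ V ih =>
    simp only [clearVars, Prog.WritesVar] at h
    rcases h with h | h
    · omega
    · exact ih h

theorem clearVars_eval (V : ℕ) (s : MemState) (y : ℕ) :
    ((clearVars V).eval s).var y =
      if y = vSp ∨ 30 ≤ y ∧ y < V + 30 then 0 else s.var y := by
  induction V generalizing s with
  | zero =>
    simp only [clearVars, Prog.eval, MemState.setVar_var]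
    split_ifs <;> first | rfl | omega
  | succ V ih =>
    simp only [clearVars, Prog.eval, ih, MemState.setVar_var]
    split_ifs <;> first | rfl | omega

theorem clearVars_eval_arr (V : ℕ) (s : MemState) : ((clearVars V).eval s).arr = s.arr := by
  induction V generalizing s with
  | zero => rfl
  | succ V ih => simp only [clearVars, Prog.eval, ih, MemState.setVar_arr]

/-- Clear the memory of the simulated program. -/
def cleanup (V W : ℕ) : Prog :=
  forDown vTouched (.load vX aTouched vTouched ;; .const vY 0 ;; clearCells W) ;; clearVars V

theorem cleanup_writesVar {V W y : ℕ} (h : (cleanup V W).WritesVar y) : y = 1 ∨ 21 ≤ y := by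
  simp only [cleanup, forDown, Prog.WritesVar, clearCells_writesVar, or_false] at h
  rcases h with h | h
  · omega
  · have := clearVars_writesVar h; omega

theorem cleanup_writesArr {V W y : ℕ} (h : (cleanup V W).WritesArr y) : 5 ≤ y := by
  simp only [cleanup, forDown, Prog.WritesArr, false_or, clearVars_writesArr, or_false] at h
  exact clearCells_writesArr h

/-- The simulated run may have used addresses scattered over an unbounded range. Every nonzero cell
has its address in the recorded list, so clearing the listed addresses in all `W` arrays restores
the zero memory in time proportional to `r`. -/
theorem runs_cleanup {c : Config} (hS : Simulates A V W r c s) :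
    Runs (cleanup V W) s (r * (2 * W + 11) + 2 * V + 3) (Simulates A V W 0 ([], zeroMem)) := by
  have hr := Nat.mul_le_mul_right (2 * W + 11) hS.touched_le
  refine Yields.mono (T₁ := s.var vTouched * (2 * W + 5 + 6) + 1 + (2 * V + 1) + 1) ?_ (by
    ring_nf at hr ⊢; omega)
  have hwv : ∀ y, y ≠ 1 → y ≠ vTouched → y ≠ vX → y ≠ vY → ¬ (forDown vTouched
      (.load vX aTouched vTouched ;; .const vY 0 ;; clearCells W)).WritesVar y := by
    intro y h1 h2 h3 h4
    simp [forDown, Prog.WritesVar, clearCells_writesVar, h1, h2, h3, h4]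
  have hwa : ∀ y, y < 5 → ¬ (forDown vTouched
      (.load vX aTouched vTouched ;; .const vY 0 ;; clearCells W)).WritesArr y := by
    intro y h1 h2
    simp only [forDown, Prog.WritesArr, false_or] at h2
    have := clearCells_writesArr h2
    omega
  refine Runs.seq (Q := fun s' => (∀ b x, s'.arr (b + 5) x = 0) ∧ s'.var vTouched = 0) ?_ ?_
  · refine (Runs.forDown (T := 2 * W + 5) (N := s.var vTouched) (fun j s' =>
      -- What is still nonzero has its address among the first `j` entries of the list.
      ∀ b x, s'.arr (b + 5) x ≠ 0 → b < W ∧ ∃ j' < j, s.arr aTouched j' = x)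
      (by decide) (by simp [Prog.WritesVar, clearCells_writesVar]) ?_ ?_ rfl ?_).conseq le_rfl ?_
    · intro j s' v h
      exact h
    · intro j s1 hj hJ h1 hf
      refine (Runs.straight (p := .load vX aTouched vTouched ;; .const vY 0 ;; clearCells W)
        ⟨trivial, trivial, clearCells_straight W⟩ ?_).conseq
        (by simp [Prog.cost, clearCells_cost]; omega) fun _ h _ => h
      intro b x hbx
      simp only [Prog.eval, clearCells_eval] at hbx
      simp [hJ, hf.arr aTouched (hwa _ (by omega))] at hbx
      obtain ⟨hb, j', hj', hx⟩ := h1 b x hbx.2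
      refine ⟨hb, j', ?_, hx⟩
      have : j' ≠ j := by
        rintro rfl
        exact hbx.1 hb hx.symm
      omega
    · intro b x hbx
      rw [hS.arr] at hbx
      refine ⟨?_, hS.touched b x hbx⟩
      by_contra hb
      exact hbx (hS.arr_bound b (by omega) x)
    · intro s' h' _
      refine ⟨fun b x => ?_, h'.2⟩
      by_contra hne
      obtain ⟨-, j', hj', -⟩ := h'.1 b x hne
      omega
  · rintro s1 ⟨h1, h1'⟩ hf1
    refine (Runs.straight (clearVars_straight V) ?_).conseq (by rw [clearVars_cost])
      fun _ h _ => h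
    exact
      { var := fun i => by
          rw [clearVars_eval]
          split_ifs with h
          · rfl
          · rw [hf1.var _ (hwv _ (by omega) (by omega) (by omega) (by omega)), hS.var,
              hS.var_bound i (by omega)]
            rfl
        arr := fun b => by
          rw [clearVars_eval_arr]
          funext x
          exact h1 b x
        sp := by rw [clearVars_eval]; simp
        stack := fun l₁ p l₂ h => by simp at h
        touched := fun b x h => absurd rfl h
        touched_le := by rw [clearVars_eval]; simp [h1']
        var_bound := fun _ _ => rfl
        arr_bound := fun _ _ _ => rfl }

end

section

variable {α β : Type} {p q : Prog} {s σ : MemState} {T T₁ T₂ : ℕ}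
variable {n : ℕ} {G : SimpleGraph (Fin n)} {ℓ N X : ℕ} {w : ℕ → ℕ → ℕ}
variable {A : Prog} {V W r : ℕ}

/-! ### The distribution of the rows -/

theorem fairCoin_apply (b : Bool) : fairCoin b = 2⁻¹ := by
  simp [fairCoin]

/-- The appended bits are the last `L` binary digits of `v`, all strings being equally likely; the
digits before them form `v / 2 ^ L`, which must be `r`. -/
theorem randBits_apply (L r v : ℕ) :
    randBits L r v = if v / 2 ^ L = r then (2⁻¹ : ℝ≥0∞) ^ L else 0 := by
  induction L generalizing r with
  | zero =>
    rw [randBits, iterDown, PMF.pure_apply]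
    simp
  | succ L ih =>
    have h : randBits (L + 1) r =
        fairCoin.bind fun b => randBits L (r + r + if b then 1 else 0) := by
      rw [randBits, iterDown, PMF.bind_map]; rfl
    rw [h, PMF.bind_apply, tsum_fintype]
    simp only [Fintype.univ_bool, ih, fairCoin_apply]
    rw [Finset.sum_pair (by decide)]
    have hd : v / 2 ^ (L + 1) = v / 2 ^ L / 2 := by rw [pow_succ, Nat.div_div_eq_div_mul]
    rw [hd]
    generalize v / 2 ^ L = x
    simp only [if_true]
    by_cases h1 : x = r + r + 1
    · have h2 : x / 2 = r := by omega
      rw [if_pos h1, if_neg (by simp; omega), if_pos h2]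
      simp [pow_succ, mul_comm]
    · by_cases h3 : x = r + r
      · have h2 : x / 2 = r := by omega
        rw [if_neg h1, if_pos (by simpa using h3), if_pos h2]
        simp [pow_succ, mul_comm]
      · rw [if_neg h1, if_neg (by simpa using h3), if_neg (by omega)]
        simp

theorem randBits_lt {L v : ℕ} (h : v ∈ (randBits L 0).support) : v < 2 ^ L := by
  rw [PMF.mem_support_iff, randBits_apply] at h
  by_contra hv
  rw [if_neg] at h
  · exact h rfl
  · intro h0
    rw [Nat.div_eq_zero_iff] at h0
    have := Nat.two_pow_pos L
    omega

theorem randVertex_lt {n L v : ℕ} (hL : 2 ^ L ≤ 2 * n)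
    (h : v ∈ (randVertex n L).support) : v < n := by
  rw [randVertex, PMF.support_map] at h
  obtain ⟨r, hr, rfl⟩ := h
  have := randBits_lt hr
  beta_reduce
  split_ifs <;> omega

theorem fill_support {μ : PMF α} {N : ℕ} {w w' : ℕ → α} (h : w' ∈ (fill μ N w).support) :
    (∀ i < N, w' i ∈ μ.support) ∧ ∀ i, N ≤ i → w' i = w i := by
  induction N generalizing w with
  | zero =>
    simp [fill, iterDown] at h
    subst h
    exact ⟨fun i hi => by omega, fun _ _ => rfl⟩
  | succ N ih =>
    rw [fill, iterDown, PMF.bind_map, PMF.mem_support_bind_iff] at h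
    obtain ⟨v, hv, h⟩ := h
    obtain ⟨h1, h2⟩ := ih h
    refine ⟨fun i hi => ?_, fun i hi => ?_⟩
    · rcases Nat.eq_or_lt_of_le (Nat.le_of_lt_succ hi) with rfl | hlt
      · rw [h2 i le_rfl]
        simpa using hv
      · exact h1 i hlt
    · rw [h2 i (by omega), Function.update_of_ne (by omega)]

theorem randRows_lt {n L ℓ N : ℕ} {w : ℕ → ℕ → ℕ} (hL : 2 ^ L ≤ 2 * n)
    (h : w ∈ (randRows n L ℓ N).support) : ∀ i < N, ∀ a < ℓ, w i a < n :=
  fun i hi a ha => randVertex_lt hL ((fill_support ((fill_support h).1 i hi)).1 a ha)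

/-! ### One trial -/

/-- The verdict on a run of `A` on the graph of random rows. -/
noncomputable def trialDist (A : Prog) (c : ℕ) {n : ℕ} (G : SimpleGraph (Fin n))
    (L ℓ N t T : ℕ) : PMF Verdict :=
  (randRows n L ℓ N).bind fun w =>
    (runFor T ([A], graphInput (rowGraph G ℓ N w) (c * t))).map (verdict (rowGraph G ℓ N w) t)

/-- One trial. -/
noncomputable def trial (A : Prog) (c V W : ℕ) : Prog :=
  sampleRows ;; buildGraph ;; startRun A c ;; interp A ;; judge ;; cleanup V W

/-- The memory holds the graph `G` and the parameters of a trial, and the memory of the simulated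
program is clear. -/
structure TrialReady (A : Prog) (V W : ℕ) {n : ℕ} (G : SimpleGraph (Fin n)) (L ℓ N t T : ℕ)
    (s : MemState) : Prop where
  size : s.var vSize = n
  log : s.var vLog = L
  len : s.var vLen = ℓ
  count : s.var vCount = N
  side : s.var vSide = t
  time : s.var vTime = T
  graph : ∀ u < n, ∀ v < n, s.arr aGraph (u * n + v) = adjBit G u v
  clear : Simulates A V W 0 ([], zeroMem) s

theorem sampleRows_writesVar {y : ℕ} (h : sampleRows.WritesVar y) :
    y = 1 ∨ 11 ≤ y ∧ y ≤ 20 ∨ y = vX := by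
  simp [sampleRows, sampleRow, sampleVertex, mulAdd, forDown, Prog.WritesVar] at h
  omega

theorem sampleRows_writesArr {y : ℕ} (h : sampleRows.WritesArr y) : y = aRows := by
  simpa [sampleRows, sampleRow, sampleVertex, mulAdd, forDown, Prog.WritesArr] using h

theorem startRun_writesVar {A : Prog} {c y : ℕ} (h : (startRun A c).WritesVar y) :
    y = 1 ∨ 11 ≤ y := by
  simp [startRun, pushConst, mulAdd, forDown, Prog.WritesVar] at h
  omega

theorem startRun_writesArr {A : Prog} {c y : ℕ} (h : (startRun A c).WritesArr y) :
    y = aStack := by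
  simpa [startRun, pushConst, mulAdd, forDown, Prog.WritesArr] using h

theorem interp_writesVar {A : Prog} {y : ℕ} (h : (interp A).WritesVar y) :
    y = 1 ∨ 21 ≤ y := by
  simp only [interp, forDown, Prog.WritesVar] at h
  rcases h with h | h | h
  · omega
  · omega
  · have := interpStep_writesVar h; omega

theorem interp_writesArr {A : Prog} {y : ℕ} (h : (interp A).WritesArr y) : 3 ≤ y := by
  simp only [interp, forDown, Prog.WritesArr, false_or] at h
  have := interpStep_writesArr h
  omega

theorem trial_writesVar {A : Prog} {c V W y : ℕ} (h : (trial A c V W).WritesVar y) :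
    y = 1 ∨ 11 ≤ y := by
  simp only [trial, Prog.WritesVar] at h
  rcases h with h | h | h | h | h | h
  · have := sampleRows_writesVar h; omega
  · have := buildGraph_writesVar h; omega
  · have := startRun_writesVar h; omega
  · have := interp_writesVar h; omega
  · have := judge_writesVar h; omega
  · have := cleanup_writesVar h; omega

theorem trial_writesArr {A : Prog} {c V W y : ℕ} (h : (trial A c V W).WritesArr y) :
    1 ≤ y := by
  simp only [trial, Prog.WritesArr] at h
  rcases h with h | h | h | h | h | h
  · have := sampleRows_writesArr h; omega
  · have := buildGraph_writesArr h; omega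
  · have := startRun_writesArr h; omega
  · have := interp_writesArr h; omega
  · exact absurd h (judge_writesArr y)
  · have := cleanup_writesArr h; omega

/-- The constant in the running time of a trial. -/
def trialConst (A : Prog) (V W : ℕ) : ℕ := 5 * A.subprogs.length + 4 * W + 2 * V + 600

/-- The degree 5 comes from the adjacency matrix of the rows: two loops over rows, two over entries,
and a multiplication by repeated addition inside. -/
theorem yields_trial (hV : ∀ y, A.WritesVar y → y < V) (hW : ∀ y, A.WritesArr y → y < W)
    (hV2 : 2 ≤ V) (hW0 : 0 < W) {c L t : ℕ} (h : TrialReady A V W G L ℓ N t T s)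
    (hn : 1 ≤ n) (hL : 2 ^ L ≤ 2 * n) (hnX : n ≤ X) (hLX : L ≤ X) (hℓX : ℓ ≤ X) (hNX : N ≤ X)
    (htX : t ≤ X) (hTX : T ≤ X) (hcX : c ≤ X) :
    Yields (trial A c V W) s (trialConst A V W * X ^ 5) (trialDist A c G L ℓ N t T)
      fun o s' => s'.var vRes = Verdict.code o ∧ Simulates A V W 0 ([], zeroMem) s' := by
  have hX : 1 ≤ X := hn.trans hnX
  set a := A.subprogs.length with ha
  refine Yields.mono (T₁ := 80 * X ^ 3 + (180 * X ^ 5 + (40 * X + ((T * (5 * a + 36) + 1) +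
    (130 * X ^ 3 + ((N * N + T) * (2 * W + 11) + 2 * V + 3) + 1) + 1) + 1) + 1) + 1) ?_ ?_
  · refine Yields.seq (R := fun w s1 => w ∈ (randRows n L ℓ N).support ∧
        ∀ i < N, ∀ a < ℓ, s1.arr aRows (i * ℓ + a) = w i a)
      ((yields_sampleRows h.size h.log h.len h.count hLX hℓX hNX hX).conseq le_rfl
        fun w s1 hw h1 _ => ⟨hw, h1⟩) ?_
    rintro w s1 ⟨hw, h1⟩ hf1
    have hw' := randRows_lt hL hw
    have v1 : ∀ y, y ≤ 10 → y ≠ 1 → s1.var y = s.var y := fun y hy hy1 =>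
      hf1.var y fun h => by have := sampleRows_writesVar h; omega
    have r1 : HoldsRows G ℓ N w s1 :=
      { size := by rw [v1 _ (by omega) (by omega), h.size]
        len := by rw [v1 _ (by omega) (by omega), h.len]
        count := by rw [v1 _ (by omega) (by omega), h.count]
        graph := by
          rw [hf1.arr _ fun h => by have := sampleRows_writesArr h; omega]
          exact h.graph
        rows := h1 }
    have c1 : Simulates A V W 0 ([], zeroMem) s1 :=
      h.clear.congr (fun b hb => hf1.arr b fun h => by have := sampleRows_writesArr h; omega)
        (fun y hy => hf1.var y fun h => by have := sampleRows_writesVar h; omega)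
    refine Runs.seq (runs_buildGraph hW0 r1 hw' hnX hNX hℓX hX c1) fun s2 h2 hf2 => ?_
    have v2 : ∀ y, y ≤ 10 → y ≠ 1 → s2.var y = s.var y := fun y hy hy1 => by
      rw [hf2.var y fun h => by have := buildGraph_writesVar h; omega, v1 y hy hy1]
    refine Runs.seq (runs_startRun (c := c) (t := t) (T := T) hV2 hcX hX
      (by rw [v2 _ (by omega) (by omega), h.count]) (by rw [v2 _ (by omega) (by omega), h.side])
      (by rw [v2 _ (by omega) (by omega), h.time]) h2) fun s3 h3 hf3 => ?_
    have v3 : ∀ y, y ≤ 10 → y ≠ 1 → s3.var y = s.var y := fun y hy hy1 => by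
      rw [hf3.var y fun h => by have := startRun_writesVar h; omega, v2 y hy hy1]
    obtain ⟨sim3, fuel3, adj3⟩ := h3
    refine Yields.map (p := _) (R := fun c s' =>
      s'.var vRes = (verdict (rowGraph G ℓ N w) t c).code ∧ Simulates A V W 0 ([], zeroMem) s')
      (verdict (rowGraph G ℓ N w) t) ?_ fun _ _ h _ => h
    refine Yields.seq_runs (sim3.interp hV hW fuel3) fun cf s4 sim4 hf4 => ?_
    have v4 : ∀ y, y ≤ 10 → y ≠ 1 → s4.var y = s.var y := fun y hy hy1 => by
      rw [hf4.var y fun h => by have := interp_writesVar h; omega, v3 y hy hy1]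
    refine Runs.seq (runs_judge (H := rowGraph G ℓ N w) (t := t) hNX htX hX sim4
      (by rw [v4 _ (by omega) (by omega), h.count]) ?_
      (by rw [v4 _ (by omega) (by omega), h.side])) fun s5 h5 hf5 => ?_
    · rw [hf4.arr _ fun h => by have := interp_writesArr h; omega]
      exact adj3
    have sim5 : Simulates A V W (N * N + T) cf s5 :=
      sim4.congr (fun b _ => hf5.arr b (judge_writesArr b))
        (fun y hy => hf5.var y fun h => by have := judge_writesVar h; omega)
    refine (runs_cleanup sim5).conseq le_rfl fun s6 h6 hf6 => ⟨?_, h6⟩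
    rw [hf6.var _ fun h => by have := cleanup_writesVar h; omega, h5]
  · have e1 : 1 ≤ X ^ 5 := Nat.one_le_pow _ _ hX
    have e2 : X ≤ X ^ 5 := by
      calc X = X ^ 1 := (pow_one X).symm
        _ ≤ X ^ 5 := Nat.pow_le_pow_right hX (by omega)
    have e3 : X ^ 3 ≤ X ^ 5 := Nat.pow_le_pow_right hX (by omega)
    have e4 : X ^ 2 ≤ X ^ 5 := Nat.pow_le_pow_right hX (by omega)
    have e5 : N * N + T ≤ 2 * X ^ 5 := by
      have : N * N ≤ X ^ 2 := by rw [pow_two]; exact Nat.mul_le_mul hNX hNX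
      omega
    have e6 : (N * N + T) * (2 * W + 11) ≤ 2 * X ^ 5 * (2 * W + 11) := Nat.mul_le_mul_right _ e5
    have e7 : T * (5 * a + 36) ≤ X ^ 5 * (5 * a + 36) := Nat.mul_le_mul_right _ (hTX.trans e2)
    have e8 : 2 * V * 1 ≤ 2 * V * X ^ 5 := Nat.mul_le_mul_left _ e1
    simp only [trialConst, ← ha]
    nlinarith

end

/-! ### Parameters of the search -/

section

variable {α β : Type} {p q : Prog} {s σ : MemState} {T T₁ T₂ : ℕ}
variable {n : ℕ} {G : SimpleGraph (Fin n)} {ℓ N X : ℕ} {w : ℕ → ℕ → ℕ}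
variable {A : Prog} {V W r : ℕ}

/-! ### The search -/

/-- The index of the invariant is the number of rounds still to come. -/
theorem Runs.loop {x f : ℕ} (I : ℕ → MemState → Prop)
    (hstep : ∀ j s', I (j + 1) s' → j < f → Frame (.loop x p) s s' →
      s'.var x ≠ 0 ∧ Runs p s' T (I j))
    (hexit : ∀ s', I 0 s' → s'.var x = 0) (h0 : I f s) :
    Runs (.loop x p) s (f * (T + 1) + 1) (I 0) := by
  suffices H : ∀ j s', j ≤ f → I j s' → Frame (.loop x p) s s' →
      Runs (.loop x p) s' (j * (T + 1) + 1) (I 0) from H f s le_rfl h0 (Frame.refl _ _)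
  intro j
  induction j with
  | zero =>
    exact fun s' _ h _ => (Yields.loop_exit (a := ()) (R := fun _ => I 0) (hexit s' h) h).mono
      (by omega)
  | succ j ih =>
    intro s' hj h hf
    obtain ⟨h1, h2⟩ := hstep j s' h hj hf
    refine Yields.loop_step h1 ((Runs.seq h2 fun s'' h'' hf'' =>
      ih s'' (by omega) h'' (hf.trans (hf''.mono (fun _ h => h) fun _ h => h))).mono
      (le_of_eq (by ring)))

/-- The number of entries of a row, up to a constant factor. -/
def rowExp (L t : ℕ) : ℕ := (20 * L + t - 1) / t

/-- The number is `20 * L / t` rounded up. Its minimality says that subtracting `t` from `20 * L`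
reaches zero after exactly this many rounds, which is how `computeParams` finds it. -/
theorem rowExp_spec {L t : ℕ} (ht : 1 ≤ t) :
    20 * L ≤ rowExp L t * t ∧ ∀ i, i < rowExp L t → i * t < 20 * L := by
  have h := Nat.div_add_mod (20 * L + t - 1) t
  have h2 := Nat.mod_lt (20 * L + t - 1) (show t > 0 by omega)
  unfold rowExp
  constructor
  · rw [mul_comm _ t]; omega
  · intro i hi
    have : (i + 1) * t ≤ (20 * L + t - 1) / t * t := Nat.mul_le_mul_right _ hi
    rw [Nat.succ_mul, mul_comm ((20 * L + t - 1) / t)] at this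
    omega

theorem rowExp_le {L t : ℕ} (ht : 1 ≤ t) : rowExp L t ≤ 20 * L := by
  by_contra h
  have := (rowExp_spec (L := L) ht).2 (20 * L) (by omega)
  have h2 : 20 * L * 1 ≤ 20 * L * t := Nat.mul_le_mul_left _ ht
  omega

/-- The number of entries of a row. -/
def rowLen (e L t : ℕ) : ℕ := (e + 1) * rowExp L t

/-- The number of rows. -/
def rowCount (e L t : ℕ) : ℕ := 2 ^ (e * L * rowExp L t)

/-- Multiply `x_vCount` by `2 ^ e`. -/
def doubleCount : ℕ → Prog
  | 0 => .skip
  | e + 1 => .add vCount vCount vCount ;; doubleCount e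

theorem doubleCount_straight (e : ℕ) : (doubleCount e).Straight := by
  induction e with
  | zero => trivial
  | succ e ih => exact ⟨trivial, ih⟩

theorem doubleCount_cost (e : ℕ) : (doubleCount e).cost = 2 * e + 1 := by
  induction e with
  | zero => rfl
  | succ e ih => simp only [doubleCount, Prog.cost, ih]; ring

theorem doubleCount_writesVar {e y : ℕ} (h : (doubleCount e).WritesVar y) : y = vCount := by
  induction e with
  | zero => exact h.elim
  | succ e ih =>
    simp only [doubleCount, Prog.WritesVar] at h
    exact h.elim id ih

theorem doubleCount_writesArr (e y : ℕ) : ¬ (doubleCount e).WritesArr y := by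
  induction e with
  | zero => exact id
  | succ e ih => simp [doubleCount, Prog.WritesArr, ih]

theorem doubleCount_eval (e : ℕ) (s : MemState) :
    ((doubleCount e).eval s).var vCount = s.var vCount * 2 ^ e := by
  induction e generalizing s with
  | zero => simp [doubleCount, Prog.eval]
  | succ e ih =>
    simp only [doubleCount, Prog.eval, ih, MemState.setVar_var, if_true]
    ring

/-- Compute the number of rows and of their entries. -/
def computeParams (e : ℕ) : Prog :=
  .const vX 20 ;; .const vU 0 ;; mulAdd vAcc vX vLog vU ;; .const vLen 0 ;; .const vCount 1 ;;
  .loop vAcc (.sub vAcc vAcc vSide ;; .const 1 (e + 1) ;; .add vLen vLen 1 ;; .const 1 0 ;;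
    .add vI vLog 1 ;; forDown vI (doubleCount e))

theorem computeParams_writesVar {e y : ℕ} (h : (computeParams e).WritesVar y) :
    y = 1 ∨ 8 ≤ y ∧ y ≤ 20 ∨ y = vX := by
  by_cases hd : (doubleCount e).WritesVar y
  · have := doubleCount_writesVar hd; omega
  · simp [computeParams, mulAdd, forDown, Prog.WritesVar, hd] at h
    omega

theorem computeParams_writesArr (e y : ℕ) : ¬ (computeParams e).WritesArr y := by
  simp [computeParams, mulAdd, forDown, Prog.WritesArr, doubleCount_writesArr]

/-- The number of rows may far exceed the current time bound, yet it is computed quickly by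
doubling, since an addition takes one step; a trial that is too large can then be skipped. -/
theorem runs_computeParams {e L t : ℕ} (hL : s.var vLog = L) (ht : s.var vSide = t) (ht1 : 1 ≤ t)
    (hLX : L ≤ X) (hX : 1 ≤ X) :
    Runs (computeParams e) s ((40 * e + 700) * X ^ 2) fun s' =>
      s'.var vLen = rowLen e L t ∧ s'.var vCount = rowCount e L t := by
  obtain ⟨hm1, hm2⟩ := rowExp_spec (L := L) ht1
  have hm := rowExp_le (L := L) ht1
  set m := rowExp L t with hmdef
  refine Yields.mono (T₁ := 1 + (1 + (14 * (20 * X) + (1 + (1 + (m * ((L * (2 * e + 1 + 6) + 1 + 10)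
    + 1) + 1) + 1) + 1) + 1) + 1) + 1) ?_ ?_
  · refine Yields.straight_seq (p := .const vX 20) trivial
      (Yields.straight_seq (p := .const vU 0) trivial ?_)
    simp only [Prog.eval]
    refine Runs.seq (runs_mulAdd (T := 20 * X) (by decide) (by decide) (by decide) (by decide)
      (by decide) (by decide) (by decide) (by decide) (by simp; omega) (by omega))
      fun s1 h1 hf1 => ?_
    have a1 : s1.var vAcc = 20 * L := by rw [h1]; simp [hL]
    have l1 : s1.var vLog = L := by
      rw [hf1.var _ (by simp [mulAdd, forDown, Prog.WritesVar])]; simp [hL]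
    have t1 : s1.var vSide = t := by
      rw [hf1.var _ (by simp [mulAdd, forDown, Prog.WritesVar])]; simp [ht]
    refine Yields.straight_seq (p := .const vLen 0) trivial
      (Yields.straight_seq (p := .const vCount 1) trivial ?_)
    simp only [Prog.eval]
    have hw : ∀ y, y = vLog ∨ y = vSide → ¬ (Prog.loop vAcc (.sub vAcc vAcc vSide ;;
        .const 1 (e + 1) ;; .add vLen vLen 1 ;; .const 1 0 ;;
        .add vI vLog 1 ;; forDown vI (doubleCount e))).WritesVar y := by
      intro y hy h
      by_cases hd : (doubleCount e).WritesVar y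
      · have := doubleCount_writesVar hd; omega
      · simp [forDown, Prog.WritesVar, hd] at h
        omega
    refine (Runs.loop (T := L * (2 * e + 1 + 6) + 1 + 10) (f := m) (fun j s' => j ≤ m ∧
      s'.var vAcc = 20 * L - (m - j) * t ∧ s'.var vLen = (e + 1) * (m - j) ∧
      s'.var vCount = 2 ^ (e * L * (m - j))) ?_ ?_ ?_).conseq le_rfl ?_
    · rintro j s2 ⟨-, hacc, hlen, hcnt⟩ hj hf
      have l2 : s2.var vLog = L := by
        rw [hf.var _ (hw _ (by simp))]; simp [l1]
      have t2 : s2.var vSide = t := by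
        rw [hf.var _ (hw _ (by simp))]; simp [t1]
      refine ⟨?_, ?_⟩
      · rw [hacc]
        have := hm2 (m - (j + 1)) (by omega)
        omega
      refine Yields.mono (Yields.straight_seq (p := .sub vAcc vAcc vSide) trivial
        (Yields.straight_seq (p := .const 1 (e + 1)) trivial
        (Yields.straight_seq (p := .add vLen vLen 1) trivial
        (Yields.straight_seq (p := .const 1 0) trivial
        (Yields.straight_seq (p := .add vI vLog 1) (T := L * (2 * e + 1 + 6) + 1) trivial
        ?_))))) (by simp [Prog.cost]; omega)
      generalize hs3 : Prog.eval (.add vI vLog 1) _ = s3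
      have i3 : s3.var vI = L := by simp [← hs3, Prog.eval, l2]
      have acc3 : s3.var vAcc = 20 * L - (m - j) * t := by
        have he : (m - j) * t = (m - (j + 1)) * t + t := by
          rw [show m - j = (m - (j + 1)) + 1 by omega, Nat.succ_mul]
        simp [← hs3, Prog.eval, hacc, t2]
        omega
      have len3 : s3.var vLen = (e + 1) * (m - j) := by
        simp [← hs3, Prog.eval, hlen]
        rw [show m - j = (m - (j + 1)) + 1 by omega]
        ring
      have cnt3 : s3.var vCount = 2 ^ (e * L * (m - (j + 1))) := by
        simp [← hs3, Prog.eval, hcnt]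
      clear hs3
      have hw3 : ∀ y, y = vAcc ∨ y = vLen → ¬ (forDown vI (doubleCount e)).WritesVar y := by
        intro y hy h
        by_cases hd : (doubleCount e).WritesVar y
        · have := doubleCount_writesVar hd; omega
        · simp [forDown, Prog.WritesVar, hd] at h
          omega
      refine (Runs.forDown (T := 2 * e + 1) (N := L) (fun i s' => i ≤ L ∧ s'.var vCount =
        2 ^ (e * L * (m - (j + 1)) + e * (L - i))) (by decide)
        (fun h => by have := doubleCount_writesVar h; omega) ?_ ?_ i3 ?_).conseq le_rfl ?_
      · rintro i s' v ⟨hi, h⟩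
        exact ⟨hi, by simpa using h⟩
      · rintro i s4 hi hI ⟨-, h4⟩ _
        refine (Runs.straight (doubleCount_straight e) ?_).conseq (by rw [doubleCount_cost])
          fun _ h _ => h
        refine ⟨hi.le, ?_⟩
        rw [doubleCount_eval, h4, ← pow_add, show L - i = (L - (i + 1)) + 1 by omega]
        congr 1; ring
      · exact ⟨le_rfl, by simp [cnt3]⟩
      · rintro s5 ⟨⟨-, h5⟩, -⟩ hf5
        refine ⟨by omega, ?_, ?_, ?_⟩
        · rw [hf5.var _ (hw3 _ (by simp)), acc3]
        · rw [hf5.var _ (hw3 _ (by simp)), len3]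
        · rw [h5, show m - j = (m - (j + 1)) + 1 by omega]
          congr 1
    · rintro s' ⟨-, h, -⟩
      rw [h]
      simp
      exact Nat.sub_eq_zero_of_le hm1
    · exact ⟨le_rfl, by simp [a1], by simp, by simp⟩
    · rintro s' ⟨-, -, h1, h2⟩ _
      exact ⟨by simpa [rowLen] using h1, by simpa [rowCount] using h2⟩
  · have e1 : 1 ≤ X ^ 2 := Nat.one_le_pow _ _ hX
    have e2 : X ≤ X ^ 2 := by nlinarith
    have e3 : m * ((L * (2 * e + 1 + 6) + 1 + 10) + 1) ≤
        20 * X * ((X * (2 * e + 1 + 6) + 1 + 10) + 1) := by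
      gcongr
      omega
    have e4 : 20 * X * ((X * (2 * e + 1 + 6) + 1 + 10) + 1) =
        (40 * e + 140) * X ^ 2 + 240 * X := by ring
    have e5 : (40 * e + 700) * X ^ 2 = (40 * e + 140) * X ^ 2 + 560 * X ^ 2 := by ring
    omega

end

/-! ### The search over time bounds and side lengths -/

section

variable {α β : Type} {p q : Prog} {s σ : MemState} {T T₁ T₂ : ℕ}
variable {n : ℕ} {G : SimpleGraph (Fin n)} {ℓ N X : ℕ} {w : ℕ → ℕ → ℕ}
variable {A : Prog} {V W r : ℕ}

/-- The state of the search: the position in the list of all pairs of a time bound and a side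
length, the number of trials left at this position, and the result, if there is one. -/
abbrev SearchState : Type := ℕ × ℕ × Verdict

/-- The distribution of the verdict of a trial at position `j`. -/
noncomputable def stepDist (A : Prog) (c e : ℕ) {n : ℕ} (G : SimpleGraph (Fin n)) (L j : ℕ) :
    PMF Verdict :=
  if rowCount e L (L - j % L) ≤ 2 ^ (j / L) then
    trialDist A c G L (rowLen e L (L - j % L)) (rowCount e L (L - j % L)) (L - j % L) (2 ^ (j / L))
  else PMF.pure none

/-- What to do after a trial: a biclique is an answer; after `n` runs in a row without one, so is its
absence; and if the run has not halted, go on to the next position. -/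
def advance (n : ℕ) (a : SearchState) : Verdict → SearchState
  | none => (a.1 + 1, n, none)
  | some false => (a.1, a.2.1 - 1, if a.2.1 - 1 = 0 then some false else none)
  | some true => (a.1, a.2.1, some true)

/-- One step of the search. -/
noncomputable def searchKernel (A : Prog) (c e : ℕ) {n : ℕ} (G : SimpleGraph (Fin n)) (L : ℕ)
    (a : SearchState) : PMF SearchState :=
  (stepDist A c e G L a.1).map (advance n a)

/-- The search has not ended. -/
def SearchState.Running (a : SearchState) : Prop := a.2.2 = none

/-- The potential `(J - a.1) * n + a.2.1` drops in every step that does not end the search: a failed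
trial lowers the counter, and a move to the next position trades one block of `n` for a fresh
counter. At position `J` every run halts, so `J` is never passed. -/
theorem searchKernel_halts {c e L J : ℕ} (hn : 1 ≤ n)
    (hJ : none ∉ (stepDist A c e G L J).support) (f : ℕ) (a : SearchState) (ha : a.1 ≤ J)
    (hr : 1 ≤ a.2.1) (hf : (J - a.1) * n + a.2.1 ≤ f) :
    ∀ b ∈ (whileKernel (searchKernel A c e G L) SearchState.Running f a).support,
      ¬ b.Running := by
  induction f generalizing a with
  | zero => omega
  | succ f ih =>
    intro b hb
    rw [whileKernel] at hb
    split_ifs at hb with hrun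
    · rw [PMF.mem_support_bind_iff] at hb
      obtain ⟨a', ha', hb⟩ := hb
      rw [searchKernel, PMF.support_map] at ha'
      obtain ⟨o, ho, rfl⟩ := ha'
      have hdone : ∀ x : SearchState, ¬ x.Running →
          b ∈ (whileKernel (searchKernel A c e G L) SearchState.Running f x).support →
          ¬ b.Running := by
        intro x hx hb
        cases f with
        | zero =>
          simp [whileKernel] at hb
          rwa [hb]
        | succ f =>
          simp [whileKernel, hx] at hb
          rwa [hb]
      match o with
      | none =>
        have hne : a.1 ≠ J := by
          rintro rfl
          exact hJ ho
        refine ih (a.1 + 1, n, none) (by simp only; omega) hn ?_ b hb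
        have : (J - a.1) * n = (J - (a.1 + 1)) * n + n := by
          rw [show J - a.1 = (J - (a.1 + 1)) + 1 by omega, Nat.succ_mul]
        simp only
        omega
      | some false =>
        by_cases h0 : a.2.1 - 1 = 0
        · exact hdone _ (by simp [advance, SearchState.Running, h0]) hb
        · refine ih (advance n a (some false)) ha ?_ ?_ b hb
          · change 1 ≤ a.2.1 - 1
            omega
          · change (J - a.1) * n + (a.2.1 - 1) ≤ f
            omega
      | some true => exact hdone _ (by simp [advance, SearchState.Running]) hb
    · simp at hb
      rwa [hb]

open Classical in
/-- The memory holds the state of the search. -/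
structure SearchReady (A : Prog) (V W : ℕ) {n : ℕ} (G : SimpleGraph (Fin n)) (L J : ℕ)
    (a : SearchState) (s : MemState) : Prop where
  size : s.var vSize = n
  log : s.var vLog = L
  time : s.var vTime = 2 ^ (a.1 / L)
  side : s.var vSide = L - a.1 % L
  rep : s.var vRep = a.2.1
  run : s.var vRun = if a.Running then 1 else 0
  ans : s.var vAns = if a.2.2 = some true then 1 else 0
  graph : ∀ u < n, ∀ v < n, s.arr aGraph (u * n + v) = adjBit G u v
  clear : Simulates A V W 0 ([], zeroMem) s
  le : a.1 ≤ J

/-- Update the state of the search. -/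
def updateSearch : Prog :=
  .ite vRes
    (.const 1 1 ;; .sub vX vRes 1 ;;
      .ite vX (.const vRun 0 ;; .const vAns 1) (.sub vRep vRep 1 ;; .ite vRep .skip (.const vRun 0)))
    (.const 1 0 ;; .add vRep vSize 1 ;; .const 1 1 ;; .sub vSide vSide 1 ;;
      .ite vSide .skip (.add vTime vTime vTime ;; .const 1 0 ;; .add vSide vLog 1))

/-- One step of the search. -/
noncomputable def searchStep (A : Prog) (c e V W : ℕ) : Prog :=
  computeParams e ;; .sub vX vCount vTime ;; (.ite vX (.const vRes 0) (trial A c V W)) ;;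
  updateSearch

/-- Position `j` stands for the time bound `2 ^ (j / L)` and the side `L - j % L`: the side runs
from `L` down to `1`, then the time bound doubles and the side starts again at `L`. -/
theorem succ_div_mod (L j : ℕ) (hL : 1 ≤ L) :
    L - (j + 1) % L = (if L - j % L - 1 = 0 then L else L - j % L - 1) ∧
    (j + 1) / L = if L - j % L - 1 = 0 then j / L + 1 else j / L := by
  have h1 := Nat.div_add_mod j L
  have h2 := Nat.mod_lt j (show L > 0 by omega)
  by_cases h : L - j % L - 1 = 0
  · have he : j + 1 = L * (j / L + 1) := by rw [Nat.mul_succ]; omega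
    have h3 : (j + 1) / L = j / L + 1 := by
      rw [he, Nat.mul_div_cancel_left _ (by omega)]
    have h4 : (j + 1) % L = 0 := by rw [he, Nat.mul_mod_right]
    simp [h, h3, h4]
  · have he : j + 1 = L * (j / L) + (j % L + 1) := by omega
    have h5 : j % L + 1 < L := by omega
    have h3 : (j + 1) / L = j / L := by
      rw [he, Nat.mul_add_div (by omega), Nat.div_eq_of_lt h5, Nat.add_zero]
    have h4 : (j + 1) % L = j % L + 1 := by
      rw [he, Nat.mul_add_mod, Nat.mod_eq_of_lt h5]
    simp only [h, h3, h4, if_false, and_true]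
    omega

theorem runs_updateSearch {L J : ℕ} {a : SearchState} {o : Verdict} (hL : 1 ≤ L)
    (h : SearchReady A V W G L J a s) (ha : a.Running) (ho : s.var vRes = Verdict.code o)
    (hJ : (advance n a o).1 ≤ J) :
    Runs updateSearch s 20 (SearchReady A V W G L J (advance n a o)) := by
  refine (Runs.straight (p := updateSearch) (by simp [updateSearch, Prog.Straight]) ?_).conseq
    (by simp [Prog.cost, updateSearch]) fun _ h _ => h
  have hrun := h.run
  have hans := h.ans
  simp only [SearchState.Running] at ha
  simp only [SearchState.Running, ha] at hrun hans
  match o with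
  | none =>
    simp only [Verdict.code] at ho
    obtain ⟨e1, e2⟩ := succ_div_mod L a.1 hL
    by_cases h0 : L - a.1 % L - 1 = 0
    · rw [if_pos h0] at e1 e2
      have ev : updateSearch.eval s = ((((((((s.setVar 1 0).setVar vRep n).setVar 1 1).setVar
          vSide 0).setVar vTime (2 ^ (a.1 / L) + 2 ^ (a.1 / L))).setVar 1 0).setVar vSide L)) := by
        simp [updateSearch, Prog.eval, ho, h.side, h0, h.size, h.time, h.log]
      rw [ev]
      exact
        { size := by simp [h.size]
          log := by simp [h.log]
          time := by simp [advance, e2, pow_succ, mul_two]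
          side := by simp [advance, e1]
          rep := by simp [advance]
          run := by simpa [advance, SearchState.Running] using hrun
          ans := by simpa [advance] using hans
          graph := h.graph
          clear := h.clear.congr (fun _ _ => rfl) fun y hy => by
            simp [show y ≠ 6 by omega, show y ≠ 1 by omega, show y ≠ 5 by omega,
              show y ≠ 7 by omega]
          le := hJ }
    · rw [if_neg h0] at e1 e2
      have ev : updateSearch.eval s = ((((s.setVar 1 0).setVar vRep n).setVar 1 1).setVar
          vSide (L - a.1 % L - 1)) := by
        simp [updateSearch, Prog.eval, ho, h.side, h0, h.size]
      rw [ev]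
      exact
        { size := by simp [h.size]
          log := by simp [h.log]
          time := by simp [advance, e2, h.time]
          side := by simp [advance, e1]
          rep := by simp [advance]
          run := by simpa [advance, SearchState.Running] using hrun
          ans := by simpa [advance] using hans
          graph := h.graph
          clear := h.clear.congr (fun _ _ => rfl) fun y hy => by
            simp [show y ≠ 6 by omega, show y ≠ 1 by omega, show y ≠ 7 by omega]
          le := hJ }
  | some false =>
    simp only [Verdict.code] at ho
    by_cases h0 : a.2.1 - 1 = 0
    · have ev : updateSearch.eval s = (((((s.setVar 1 1).setVar vX 0).setVar vRep 0).setVar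
          vRun 0)) := by
        simp [updateSearch, Prog.eval, ho, h.rep, h0]
      rw [ev]
      exact
        { size := by simp [h.size]
          log := by simp [h.log]
          time := by simp [advance, h.time]
          side := by simp [advance, h.side]
          rep := by simp [advance, h0]
          run := by simp [advance, SearchState.Running, h0]
          ans := by simpa [advance, h0] using hans
          graph := h.graph
          clear := h.clear.congr (fun _ _ => rfl) fun y hy => by
            simp [show y ≠ 1 by omega, show y ≠ 7 by omega, show y ≠ 25 by omega,
              show y ≠ 3 by omega]
          le := hJ }
    · have ev : updateSearch.eval s = ((((s.setVar 1 1).setVar vX 0).setVar vRep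
          (a.2.1 - 1))) := by
        simp [updateSearch, Prog.eval, ho, h.rep, h0]
      rw [ev]
      exact
        { size := by simp [h.size]
          log := by simp [h.log]
          time := by simp [advance, h.time]
          side := by simp [advance, h.side]
          rep := by simp [advance]
          run := by simpa [advance, SearchState.Running, h0] using hrun
          ans := by simpa [advance, h0] using hans
          graph := h.graph
          clear := h.clear.congr (fun _ _ => rfl) fun y hy => by
            simp [show y ≠ 1 by omega, show y ≠ 7 by omega, show y ≠ 25 by omega]
          le := hJ }
  | some true =>
    simp only [Verdict.code] at ho
    have ev : updateSearch.eval s = (((((s.setVar 1 1).setVar vX 1).setVar vRun 0).setVar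
        vAns 1)) := by
      simp [updateSearch, Prog.eval, ho]
    rw [ev]
    exact
      { size := by simp [h.size]
        log := by simp [h.log]
        time := by simp [advance, h.time]
        side := by simp [advance, h.side]
        rep := by simp [advance, h.rep]
        run := by simp [advance, SearchState.Running]
        ans := by simp [advance]
        graph := h.graph
        clear := h.clear.congr (fun _ _ => rfl) fun y hy => by
          simp [show y ≠ 1 by omega, show y ≠ 4 by omega, show y ≠ 25 by omega,
            show y ≠ 3 by omega]
        le := hJ }

theorem SearchReady.congr {L J : ℕ} {a : SearchState} {s' : MemState}
    (h : SearchReady A V W G L J a s)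
    (hv : ∀ y, y ≤ 7 → y ≠ 1 → s'.var y = s.var y) (ha : s'.arr aGraph = s.arr aGraph)
    (hc : Simulates A V W 0 ([], zeroMem) s') : SearchReady A V W G L J a s' where
  size := by rw [hv _ (by omega) (by omega), h.size]
  log := by rw [hv _ (by omega) (by omega), h.log]
  time := by rw [hv _ (by omega) (by omega), h.time]
  side := by rw [hv _ (by omega) (by omega), h.side]
  rep := by rw [hv _ (by omega) (by omega), h.rep]
  run := by rw [hv _ (by omega) (by omega), h.run]
  ans := by rw [hv _ (by omega) (by omega), h.ans]
  graph := by rw [ha]; exact h.graph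
  clear := hc
  le := h.le

/-- The constant in the running time of one step of the search. -/
def searchConst (A : Prog) (e V W : ℕ) : ℕ := trialConst A V W + 40 * e + 730

/-- By `hJ` the search never passes position `J`, so the time bound stays below `2 ^ (J / L)`; the
guard in `stepDist` keeps the number of rows below it as well. Hence one `X` bounds everything. -/
theorem yields_searchStep (hV : ∀ y, A.WritesVar y → y < V) (hW : ∀ y, A.WritesArr y → y < W)
    (hV2 : 2 ≤ V) (hW0 : 0 < W) {c e L J : ℕ} {a : SearchState} (he : 1 ≤ e)
    (h : SearchReady A V W G L J a s) (ha : a.Running) (hn : 1 ≤ n) (hL1 : 1 ≤ L)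
    (hL : 2 ^ L ≤ 2 * n) (hnX : n ≤ X) (hLX : L ≤ X) (hcX : c ≤ X)
    (hJX : (e + 1) * 2 ^ (J / L) ≤ X) (hJ : none ∉ (stepDist A c e G L J).support) :
    Yields (searchStep A c e V W) s (searchConst A e V W * X ^ 5) (searchKernel A c e G L a)
      (SearchReady A V W G L J) := by
  have hX : 1 ≤ X := hn.trans hnX
  set t := L - a.1 % L with ht
  have ht1 : 1 ≤ t := by
    have := Nat.mod_lt a.1 (show L > 0 by omega)
    omega
  have hTJ : 2 ^ (a.1 / L) ≤ 2 ^ (J / L) :=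
    Nat.pow_le_pow_right (by omega) (Nat.div_le_div_right h.le)
  have hTX : (e + 1) * 2 ^ (a.1 / L) ≤ X := (Nat.mul_le_mul_left _ hTJ).trans hJX
  have hTX' : 2 ^ (a.1 / L) ≤ X := le_trans (Nat.le_mul_of_pos_left _ (by omega)) hTX
  refine Yields.mono (T₁ := (40 * e + 700) * X ^ 2 + (1 + ((trialConst A V W * X ^ 5 + 1) + 20 + 1)
    + 1) + 1) ?_ ?_
  · refine Runs.seq (runs_computeParams h.log h.side ht1 hLX hX) fun s1 h1 hf1 => ?_
    have hc1 : SearchReady A V W G L J a s1 := by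
      refine h.congr (fun y _ _ => hf1.var y fun hy => ?_)
        (hf1.arr _ (computeParams_writesArr e _))
        (h.clear.congr (fun b _ => hf1.arr b (computeParams_writesArr e b))
          fun y _ => hf1.var y fun hy => ?_)
      · have := computeParams_writesVar hy; omega
      · have := computeParams_writesVar hy; omega
    refine Yields.straight_seq (p := .sub vX vCount vTime) trivial ?_
    simp only [Prog.eval]
    rw [h1.2, hc1.time]
    set s2 := s1.setVar vX (rowCount e L t - 2 ^ (a.1 / L)) with hs2
    have hc2 : SearchReady A V W G L J a s2 :=
      hc1.congr (fun y h1 h2 => by simp [hs2, show y ≠ vX by omega]) rfl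
        (hc1.clear.congr (fun _ _ => rfl) fun y _ => by simp [hs2, show y ≠ vX by omega])
    refine Yields.map (p := _) (R := fun o s' => SearchReady A V W G L J (advance n a o) s')
      (advance n a) ?_ fun _ _ h _ => h
    refine Yields.seq_runs (T₁ := trialConst A V W * X ^ 5 + 1) (T₂ := 20)
      (R := fun o s' => o ∈ (stepDist A c e G L a.1).support ∧ s'.var vRes = Verdict.code o ∧
        SearchReady A V W G L J a s') ?_ ?_
    · refine Yields.conseq (R := fun o s' => s'.var vRes = Verdict.code o ∧
        Simulates A V W 0 ([], zeroMem) s') ?_ le_rfl fun o s' ho h' hf => ⟨ho, h'.1,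
          hc2.congr (fun y h1 h2 => hf.var y fun hy => ?_) (hf.arr _ fun hy => ?_) h'.2⟩
      · by_cases hN : rowCount e L t ≤ 2 ^ (a.1 / L)
        · rw [stepDist, if_pos hN]
          refine Yields.ite (fun h0 => ?_) fun _ => ?_
          · simp [hs2, Nat.sub_eq_zero_of_le hN] at h0
          · refine yields_trial hV hW hV2 hW0 ?_ hn hL hnX hLX ?_ (hN.trans hTX') ?_ hTX' hcX
            · exact
                { size := hc2.size
                  log := hc2.log
                  len := by simpa [hs2] using h1.1
                  count := by simpa [hs2] using h1.2
                  side := hc2.side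
                  time := hc2.time
                  graph := hc2.graph
                  clear := hc2.clear }
            -- A row has `e + 1` times `rowExp L t` entries, and `rowExp L t` is at most the number
            -- of rows, which the guard bounds by the time bound.
            · refine le_trans (Nat.mul_le_mul_left _ ?_) hTX
              refine le_trans ?_ hN
              calc rowExp L t ≤ e * L * rowExp L t :=
                    Nat.le_mul_of_pos_left _ (Nat.mul_pos he hL1)
                _ ≤ 2 ^ (e * L * rowExp L t) := Nat.lt_two_pow_self.le
            · omega
        · rw [stepDist, if_neg hN]
          refine Yields.ite (fun _ => ?_) fun h0 => ?_
          · refine (Yields.straight (p := .const vRes 0) trivial ⟨?_, ?_⟩).mono ?_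
            · have : 1 ≤ trialConst A V W * X ^ 5 := Nat.mul_pos
                (by unfold trialConst; omega) (Nat.one_le_pow _ _ hX)
              simpa [Prog.cost] using this
            · simp [Prog.eval, Verdict.code]
            · refine hc2.clear.congr (fun _ _ => rfl) fun y _ => ?_
              simp [Prog.eval, show y ≠ 20 by omega]
          · simp [hs2] at h0
            omega
      · simp only [Prog.WritesVar] at hy
        rcases hy with hy | hy
        · omega
        · have := trial_writesVar hy; omega
      · simp only [Prog.WritesArr, false_or] at hy
        have := trial_writesArr hy
        omega
    · rintro o s3 ⟨ho, hres, hc3⟩ _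
      refine runs_updateSearch hL1 hc3 ha hres ?_
      match o with
      | none =>
        have hne : a.1 ≠ J := by
          intro hJ'
          rw [hJ'] at ho
          exact hJ ho
        have := h.le
        simp only [advance]
        omega
      | some false => exact h.le
      | some true => exact h.le
  · have e1 : 1 ≤ X ^ 5 := Nat.one_le_pow _ _ hX
    have e2 : (40 * e + 700) * X ^ 2 ≤ (40 * e + 700) * X ^ 5 := mul_pow_le_mul_pow hX (by omega)
    simp only [searchConst]
    nlinarith

/-- Compute the logarithm of the number of vertices. -/
def computeLog : Prog :=
  .const vX 1 ;; .const vLog 0 ;; .sub vY vSize vX ;;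
  .loop vY (.add vX vX vX ;; .const 1 1 ;; .add vLog vLog 1 ;; .sub vY vSize vX)

theorem runs_computeLog (hn : s.var vSize = n) :
    Runs computeLog s (8 * Nat.clog 2 n + 7) fun s' => s'.var vLog = Nat.clog 2 n := by
  set L := Nat.clog 2 n with hL
  refine Yields.mono (Yields.straight_seq (p := .const vX 1) trivial
    (Yields.straight_seq (p := .const vLog 0) trivial
    (Yields.straight_seq (p := .sub vY vSize vX) trivial (T := L * (7 + 1) + 1) ?_)))
    (by simp [Prog.cost]; omega)
  refine (Runs.loop (T := 7) (f := L) (fun j s' => j ≤ L ∧ s'.var vX = 2 ^ (L - j) ∧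
    s'.var vLog = L - j ∧ s'.var vY = n - 2 ^ (L - j)) ?_ ?_ ?_).conseq le_rfl ?_
  · rintro j s1 ⟨-, h1, h2, h3⟩ hj hf
    have n1 : s1.var vSize = n := by
      rw [hf.var _ (by simp [Prog.WritesVar])]; simp [Prog.eval, hn]
    refine ⟨?_, ?_⟩
    · rw [h3]
      have : ¬ n ≤ 2 ^ (L - (j + 1)) := by
        rw [← Nat.clog_le_iff_le_pow (by omega)]
        omega
      omega
    · refine Runs.straight (p := .add vX vX vX ;; .const 1 1 ;; .add vLog vLog 1 ;;
        .sub vY vSize vX) (by simp [Prog.Straight]) ?_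
      have e : L - j = L - (j + 1) + 1 := by omega
      refine ⟨by omega, ?_, ?_, ?_⟩
      · simp [Prog.eval, h1, e, pow_succ, mul_two]
      · simp [Prog.eval, h2]; omega
      · simp [Prog.eval, h1, n1, e, pow_succ, mul_two]
  · rintro s1 ⟨-, h1, h2, h3⟩
    rw [h3]
    exact Nat.sub_eq_zero_of_le (Nat.le_pow_clog (by omega) n)
  · refine ⟨le_rfl, ?_, ?_, ?_⟩ <;> simp [Prog.eval, hn]
  · rintro s1 ⟨-, h1, h2, h3⟩ _
    simpa using h2

/-- The algorithm that distinguishes planted cliques from random graphs. -/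
noncomputable def distinguisher (A : Prog) (c e V W : ℕ) : Prog :=
  computeLog ;; .const vTime 1 ;; .const 1 0 ;; .add vSide vLog 1 ;; .add vRep vSize 1 ;;
  .const vRun 1 ;; .const vAns 0 ;; .loop vRun (searchStep A c e V W) ;;
  .const 1 0 ;; .add 0 vAns 1

/-- The distribution of the result of the search. -/
noncomputable def searchDist (A : Prog) (c e : ℕ) {n : ℕ} (G : SimpleGraph (Fin n)) (J : ℕ) :
    PMF SearchState :=
  whileKernel (searchKernel A c e G (Nat.clog 2 n)) SearchState.Running ((J + 1) * n) (0, n, none)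

/-- The program knows neither `J` nor `X`: they are any witnesses that the search stops, and serve
to bound the number of its steps by `(J + 1) * n` and the cost of each by a multiple of `X ^ 5`. -/
theorem yields_distinguisher (hV : ∀ y, A.WritesVar y → y < V)
    (hW : ∀ y, A.WritesArr y → y < W)
    (hV2 : 2 ≤ V) (hW0 : 0 < W) {c e J : ℕ} (he : 1 ≤ e) (G : SimpleGraph (Fin n)) (hn : 2 ≤ n)
    (hnX : 2 * n ≤ X) (hcX : c ≤ X) (hJX : (e + 1) * 2 ^ (J / Nat.clog 2 n) ≤ X)
    (hJ : none ∉ (stepDist A c e G (Nat.clog 2 n) J).support) :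
    Yields (distinguisher A c e V W) (graphInput G 0)
      ((searchConst A e V W + 40) * (J + 1) * X ^ 6) (searchDist A c e G J)
      fun a s' => s'.var 0 = 1 ↔ a.2.2 = some true := by
  classical
  set L := Nat.clog 2 n with hLdef
  have hL1 : 1 ≤ L := Nat.clog_pos (by omega) hn
  have hL2 : 2 ^ L ≤ 2 * n := by
    have : ¬ n ≤ 2 ^ (L - 1) := by
      rw [← Nat.clog_le_iff_le_pow (by omega)]
      omega
    rw [show L = L - 1 + 1 by omega, pow_succ]
    omega
  have hLX : L ≤ X := by
    have := Nat.lt_two_pow_self (n := L)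
    omega
  refine Yields.mono (T₁ := (8 * L + 7) + (1 + (1 + (1 + (1 + (1 + (1 +
    ((((J + 1) * n) * (searchConst A e V W * X ^ 5 + 1) + 1) + 3 + 1) + 1) + 1) + 1) + 1) + 1) + 1)
    + 1) ?_ ?_
  · refine Runs.seq (runs_computeLog (n := n) (by simp [graphInput])) fun s1 h1 hf1 => ?_
    have v1 : ∀ y, y ≠ 1 → y ≠ 2 → y ≠ 25 → y ≠ 26 → s1.var y = (graphInput G 0).var y := by
      intro y h1 h2 h3 h4
      refine hf1.var y ?_
      simp [computeLog, Prog.WritesVar, h1, h2, h3, h4]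
    have a1 : s1.arr = (graphInput G 0).arr := by
      funext b
      exact hf1.arr b (by simp [computeLog, Prog.WritesArr])
    have n1 : s1.var vSize = n := by
      rw [v1 _ (by omega) (by omega) (by omega) (by omega)]; simp [graphInput]
    refine Yields.straight_seq (p := .const vTime 1) trivial
      (Yields.straight_seq (p := .const 1 0) trivial
      (Yields.straight_seq (p := .add vSide vLog 1) trivial
      (Yields.straight_seq (p := .add vRep vSize 1) trivial
      (Yields.straight_seq (p := .const vRun 1) trivial
      (Yields.straight_seq (p := .const vAns 0) trivial ?_)))))
    generalize hs2 : Prog.eval (.const vAns 0) _ = s2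
    have r2 : SearchReady A V W G L J (0, n, none) s2 :=
      { size := by simp [← hs2, Prog.eval, n1]
        log := by simp [← hs2, Prog.eval, h1, hLdef]
        time := by simp [← hs2, Prog.eval]
        side := by simp [← hs2, Prog.eval, h1, hLdef]
        rep := by simp [← hs2, Prog.eval, n1]
        run := by simp [← hs2, Prog.eval, SearchState.Running]
        ans := by simp [← hs2, Prog.eval]
        graph := by
          intro u hu v hv
          simp only [← hs2, Prog.eval, MemState.setVar_arr, a1]
          exact graphInput_arr G 0 hu hv
        clear :=
          { var := fun i => by
              simp [← hs2, Prog.eval, v1, graphInput, zeroMem]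
            arr := fun b => by
              funext x
              simp [← hs2, Prog.eval, a1, graphInput, zeroMem]
            sp := by simp [← hs2, Prog.eval, v1, graphInput]
            stack := fun l₁ p l₂ h => by simp at h
            touched := fun b x h => absurd rfl h
            touched_le := by simp [← hs2, Prog.eval, v1, graphInput]
            var_bound := fun _ _ => rfl
            arr_bound := fun _ _ _ => rfl }
        le := Nat.zero_le _ }
    clear hs2
    rw [searchDist]
    refine Yields.seq_runs (T₁ := (J + 1) * n * (searchConst A e V W * X ^ 5 + 1) + 1) (T₂ := 3)
      (Yields.loop (κ := searchKernel A c e G L) (f := (J + 1) * n) (T := searchConst A e V W * X ^ 5)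
      (R := SearchReady A V W G L J) (c := SearchState.Running) ?_ ?_ ?_ r2) ?_
    · intro a s' h ha
      rw [h.run, if_neg ha]
    · intro a s' h ha _
      refine ⟨by rw [h.run, if_pos ha]; omega, ?_⟩
      exact yields_searchStep hV hW hV2 hW0 he h ha (by omega) hL1 hL2 (by omega) hLX hcX hJX hJ
    · refine searchKernel_halts (by omega) hJ _ _ (Nat.zero_le _) (by simp only; omega) ?_
      simp only [Nat.sub_zero]
      rw [Nat.succ_mul]
    · rintro a s3 ⟨h3, -⟩ _
      refine Runs.straight (p := .const 1 0 ;; .add 0 vAns 1) (by simp [Prog.Straight]) ?_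
      simp [Prog.eval, h3.ans]
  · have hX : 1 ≤ X := by omega
    have e1 : (J + 1) * n * (searchConst A e V W * X ^ 5 + 1) ≤
        (J + 1) * X * (searchConst A e V W * X ^ 5 + 1) := by
      gcongr
      omega
    have e2 : (J + 1) * X * (searchConst A e V W * X ^ 5 + 1) =
        searchConst A e V W * (J + 1) * X ^ 6 + (J + 1) * X := by ring
    have e3 : X ≤ X ^ 6 := by
      calc X = X ^ 1 := (pow_one X).symm
        _ ≤ X ^ 6 := Nat.pow_le_pow_right hX (by omega)
    have e4 : (J + 1) * X ≤ (J + 1) * X ^ 6 := Nat.mul_le_mul_left _ e3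
    have e5 : 1 * X ^ 6 ≤ (J + 1) * X ^ 6 := Nat.mul_le_mul_right _ (by omega)
    have e6 : (searchConst A e V W + 40) * (J + 1) * X ^ 6 =
      searchConst A e V W * (J + 1) * X ^ 6 + 40 * ((J + 1) * X ^ 6) := by ring
    have e7 : 1 ≤ X ^ 6 := Nat.one_le_pow _ _ hX
    omega

end

/-! ### Probabilistic analysis of a trial -/

section

variable {α β : Type} {p q : Prog} {s σ : MemState} {T T₁ T₂ : ℕ}
variable {n : ℕ} {G : SimpleGraph (Fin n)} {ℓ N X : ℕ} {w : ℕ → ℕ → ℕ}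
variable {A : Prog} {V W r : ℕ}

/-! ### Independence of the rows -/

/-- Independence of the entries: the highest one is drawn first and never changed later, so its
factor splits off. -/
theorem expect_fill_prod (μ : PMF α) (N : ℕ) (w : ℕ → α) (g : ℕ → α → ℝ≥0∞) :
    (fill μ N w).expect (fun ω => ∏ i ∈ Finset.range N, g i (ω i)) =
      ∏ i ∈ Finset.range N, μ.expect (g i) := by
  induction N generalizing w with
  | zero => simp [fill, iterDown, PMF.expect_pure]
  | succ N ih =>
    rw [fill, iterDown, PMF.bind_map, PMF.expect_bind, Finset.prod_range_succ, mul_comm,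
      ← PMF.expect_mul_right]
    refine PMF.expect_congr fun v _ => ?_
    have h := ih (Function.update w N v)
    rw [fill] at h
    simp only [Function.comp]
    rw [← h, ← PMF.expect_mul_left]
    refine PMF.expect_congr fun ω hω => ?_
    rw [Finset.prod_range_succ, (fill_support hω).2 N le_rfl, Function.update_self, mul_comm]

theorem prob_fill_forall (μ : PMF α) (w : ℕ → α) (P : α → Prop) {I : Finset ℕ}
    (hI : I ⊆ Finset.range N) :
    (fill μ N w).prob (fun ω => ∀ i ∈ I, P (ω i)) = μ.prob P ^ I.card := by
  classical
  have h := expect_fill_prod μ N w fun i a => if i ∈ I then {a | P a}.indicator 1 a else 1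
  have h1 : ∏ i ∈ Finset.range N, μ.expect
      (fun a => if i ∈ I then {a | P a}.indicator 1 a else (1 : ℝ≥0∞)) =
      μ.prob P ^ I.card := by
    rw [← Finset.prod_subset hI]
    · rw [← Finset.prod_const]
      exact Finset.prod_congr rfl fun i hi => by simp only [hi, if_true, PMF.prob]
    · intro i _ hi
      simp only [hi, if_false, PMF.expect_const]
  rw [← h1, ← h, PMF.prob]
  refine PMF.expect_congr fun ω _ => ?_
  by_cases hP : ∀ i ∈ I, P (ω i)
  · rw [Set.indicator_of_mem (by exact hP), Finset.prod_eq_one, Pi.one_apply]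
    intro i _
    split_ifs with hi
    · simp [hP i hi]
    · rfl
  · rw [Set.indicator_of_notMem (by exact hP)]
    push Not at hP
    obtain ⟨i, hi, hPi⟩ := hP
    exact (Finset.prod_eq_zero (hI hi) (by simp [hi, hPi])).symm

theorem PMF.prob_mem_finset (μ : PMF α) (S : Finset α) :
    μ.prob (· ∈ S) = ∑ a ∈ S, μ a := by
  classical
  rw [PMF.prob, PMF.expect, tsum_eq_sum (s := S)]
  · exact Finset.sum_congr rfl fun a ha => by simp [ha]
  · intro a ha
    simp [ha]

theorem PMF.prob_eq_apply (μ : PMF α) (a : α) : μ.prob (· = a) = μ a := by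
  have := μ.prob_mem_finset {a}
  simpa using this

theorem randBits_apply_le (L v : ℕ) : randBits L 0 v ≤ (2⁻¹ : ℝ≥0∞) ^ L := by
  rw [randBits_apply]
  split_ifs <;> simp

/-- A vertex `u` arises from at most two bit strings, those of `u` and `u + n`. -/
theorem randVertex_prob_le (n L : ℕ) (U : Finset ℕ) :
    (randVertex n L).prob (· ∈ U) ≤ 2 * U.card * (2⁻¹ : ℝ≥0∞) ^ L := by
  rw [randVertex, PMF.prob_map]
  calc _ ≤ (randBits L 0).prob fun r => ∃ u ∈ U, r = u ∨ r = u + n := by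
        refine PMF.prob_mono fun r _ hr => ⟨_, hr, ?_⟩
        split_ifs <;> omega
    _ ≤ ∑ u ∈ U, (randBits L 0).prob fun r => r = u ∨ r = u + n := PMF.prob_exists_le _ _ _
    _ ≤ ∑ u ∈ U, 2 * (2⁻¹ : ℝ≥0∞) ^ L := by
        refine Finset.sum_le_sum fun u _ => (PMF.prob_or_le _ _ _).trans ?_
        rw [PMF.prob_eq_apply, PMF.prob_eq_apply, two_mul]
        exact add_le_add (randBits_apply_le _ _) (randBits_apply_le _ _)
    _ = _ := by
        rw [Finset.sum_const, nsmul_eq_mul]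
        ring

/-- Each vertex arises at least from its own binary expansion, which has at most `L` digits. -/
theorem le_randVertex_prob {n L : ℕ} (hL : n ≤ 2 ^ L) {S : Finset ℕ} (hS : ∀ u ∈ S, u < n) :
    S.card * (2⁻¹ : ℝ≥0∞) ^ L ≤ (randVertex n L).prob (· ∈ S) := by
  rw [randVertex, PMF.prob_map]
  calc S.card * (2⁻¹ : ℝ≥0∞) ^ L = ∑ u ∈ S, (randBits L 0) u := by
        rw [← nsmul_eq_mul, ← Finset.sum_const]
        refine Finset.sum_congr rfl fun u hu => ?_
        rw [randBits_apply, if_pos (Nat.div_eq_of_lt ((hS u hu).trans_le hL))]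
    _ = (randBits L 0).prob (· ∈ S) := (PMF.prob_mem_finset _ _).symm
    _ ≤ _ := by
        refine PMF.prob_mono fun r _ hr => ?_
        rw [if_neg (by have := hS r hr; omega)]
        exact hr

/-- The row `u` of length `ℓ` lies in `U`. -/
def RowIn (U : Finset ℕ) (ℓ : ℕ) (u : ℕ → ℕ) : Prop := ∀ a ∈ Finset.range ℓ, u a ∈ U

theorem randRow_prob (n L ℓ : ℕ) (U : Finset ℕ) :
    (fill (randVertex n L) ℓ 0).prob (RowIn U ℓ) = (randVertex n L).prob (· ∈ U) ^ ℓ := by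
  have h := prob_fill_forall (randVertex n L) 0 (· ∈ U) (Finset.Subset.refl (Finset.range ℓ))
  rw [Finset.card_range] at h
  exact h

/-- An exponential moment bounds the probability that fewer than `r` of the values satisfy `P`. -/
theorem prob_fill_card_lt (μ : PMF α) (N : ℕ) (w : ℕ → α) (P : α → Prop) [DecidablePred P]
    (r : ℕ) : (fill μ N w).prob (fun ω => ((Finset.range N).filter fun i => P (ω i)).card < r) ≤
      2 ^ r * (1 - 2⁻¹ * μ.prob P) ^ N := by
  -- With `x` the number of values satisfying `P`, the product is `2⁻¹ ^ x`, and each factor has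
  -- mean one minus half the probability of `P`.
  have h := expect_fill_prod μ N w fun _ a => if P a then 2⁻¹ else 1
  have h1 : μ.expect (fun a => if P a then (2⁻¹ : ℝ≥0∞) else 1) = 1 - 2⁻¹ * μ.prob P := by
    have hf : 2⁻¹ * μ.prob P ≠ ∞ := ENNReal.mul_ne_top (by simp)
      (ne_top_of_le_ne_top ENNReal.one_ne_top (μ.prob_le_one P))
    refine ENNReal.eq_sub_of_add_eq hf ?_
    rw [PMF.prob, ← PMF.expect_mul_left, ← PMF.expect_add, ← μ.expect_const 1]
    refine PMF.expect_congr fun a _ => ?_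
    by_cases hP : P a
    · simp [hP, ENNReal.inv_two_add_inv_two]
    · simp [hP, PMF.expect_const]
  rw [h1, Finset.prod_const, Finset.card_range] at h
  rw [← h, ← PMF.expect_mul_left, PMF.prob]
  refine PMF.expect_mono fun ω _ => ?_
  rw [Finset.prod_ite, Finset.prod_const, Finset.prod_const_one, mul_one]
  -- Markov's inequality: `2 ^ r * 2⁻¹ ^ x` is at least `1` when `x < r`.
  by_cases hc : ((Finset.range N).filter fun i => P (ω i)).card < r
  · rw [Set.indicator_of_mem (by exact hc), Pi.one_apply]
    obtain ⟨d, hd⟩ := Nat.exists_eq_add_of_le hc.le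
    generalize ((Finset.range N).filter fun i => P (ω i)).card = x at hd
    rw [hd, pow_add, mul_right_comm, ← mul_pow, ENNReal.mul_inv_cancel (by simp) (by simp), one_pow,
      one_mul]
    exact one_le_pow₀ (by norm_num)
  · rw [Set.indicator_of_notMem (by exact hc)]
    exact zero_le

/-! ### Trials on graphs with a large clique -/

theorem rowGraph_isClique {S : Finset (Fin n)} (hS : G.IsClique (S : Set (Fin n)))
    {I : Finset (Fin N)}
    (hI : ∀ i ∈ I, RowIn (S.map Fin.valEmbedding) ℓ (w i)) :
    (rowGraph G ℓ N w).IsClique (I : Set (Fin N)) := by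
  intro i hi j hj hij
  refine ⟨hij, fun a ha b hb => ?_⟩
  have h1 := hI i hi a (Finset.mem_range.2 ha)
  have h2 := hI j hj b (Finset.mem_range.2 hb)
  rw [Finset.mem_map] at h1 h2
  obtain ⟨u, hu, hu'⟩ := h1
  obtain ⟨v, hv, hv'⟩ := h2
  rw [← hu', ← hv']
  by_cases huv : u = v
  · left; rw [huv]
  · right; exact adjNat_coe.2 (hS hu hv huv)

theorem rowGraph_containsDoubleClique {S : Finset (Fin n)} (hS : G.IsClique (S : Set (Fin n)))
    {k : ℕ} [DecidablePred (RowIn (S.map Fin.valEmbedding) ℓ)]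
    (h : 2 * k ≤ ((Finset.range N).filter fun i => RowIn (S.map Fin.valEmbedding) ℓ (w i)).card) :
    ContainsDoubleClique (rowGraph G ℓ N w) k := by
  classical
  set I : Finset (Fin N) := Finset.univ.filter fun i => RowIn (S.map Fin.valEmbedding) ℓ (w i)
    with hI
  have hc : 2 * k ≤ I.card := by
    refine h.trans ?_
    rw [← Finset.card_map Fin.valEmbedding]
    refine Finset.card_le_card fun i hi => ?_
    rw [Finset.mem_filter, Finset.mem_range] at hi
    exact Finset.mem_map.2 ⟨⟨i, hi.1⟩, by simp [hI, hi.2], rfl⟩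
  obtain ⟨I', hI', hcard⟩ := Finset.exists_subset_card_eq hc
  refine ⟨I', ⟨rowGraph_isClique hS fun i hi => ?_, hcard⟩⟩
  have := hI' hi
  rw [hI, Finset.mem_filter] at this
  exact this.2

theorem RepresentsBiclique.listsBiclique {H : SimpleGraph (Fin N)} {t t' : ℕ} {M : MemState}
    (h : RepresentsBiclique H t' M) (ht : t ≤ t') : ListsBiclique H t M := by
  obtain ⟨h0, L, R, hadj, harr⟩ := h
  refine ⟨by omega, fun i hi j hj => ?_⟩
  have hi1 := harr ⟨i, by omega⟩
  have hj1 := harr ⟨j, by omega⟩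
  simp only at hi1 hj1
  rw [hi1.1, hi1.2, hj1.1, hj1.2]
  refine ⟨adjNat_coe.2 (hadj _ _), fun hij => ⟨fun he => hij ?_, fun he => hij ?_⟩⟩
  · simpa using L.injective (Fin.ext he)
  · simpa using R.injective (Fin.ext he)

/-- If `A` solves an instance, a run of it fails with probability at most `1/3`. -/
theorem verdict_prob_false_le {C : ℝ} (hC : 0 < C) {c t k : ℕ} (hc : C ≤ c) (hk : k = c * t)
    {H : SimpleGraph (Fin N)}
    (h : 2 / 3 ≤ A.outcomeProb (graphInput H k)
      {s | ∃ t : ℕ, (k : ℝ) / C ≤ t ∧ RepresentsBiclique H t s}) (T : ℕ) :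
    ((runFor T ([A], graphInput H k)).map (verdict H t)).prob (· = some false) ≤ 3⁻¹ := by
  set P : Set MemState := {s | ∃ t : ℕ, (k : ℝ) / C ≤ t ∧ RepresentsBiclique H t s} with hP
  rw [Prog.outcomeProb_eq_haltProb] at h
  have h1 := runFor_prob_not_add_haltProb_le T ([A], graphInput H k) P
  have h2 : ((runFor T ([A], graphInput H k)).map (verdict H t)).prob (· = some false) ≤
      (runFor T ([A], graphInput H k)).prob (fun c => c.1 = [] ∧ c.2 ∉ P) := by
    rw [PMF.prob_map]
    refine PMF.prob_mono fun cf _ hcf => ?_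
    unfold verdict at hcf
    split_ifs at hcf with h0
    refine ⟨h0, ?_⟩
    rintro ⟨t', ht', hrep⟩
    simp only [Option.some.injEq, decide_eq_false_iff_not] at hcf
    refine hcf (hrep.listsBiclique ?_)
    -- The guaranteed side is at least `k / C`, that is `c * t / C`, which is at least `t` since `C
    -- ≤ c`.
    have : (t : ℝ) ≤ t' := by
      refine le_trans ?_ ht'
      rw [le_div_iff₀ hC, hk]
      push_cast
      rw [mul_comm]
      gcongr
    exact_mod_cast this
  refine h2.trans ?_
  have h3 : (3⁻¹ : ℝ≥0∞) + 2 / 3 = 1 := by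
    rw [← one_div, ENNReal.div_add_div_same, show (1 : ℝ≥0∞) + 2 = 3 by norm_num,
      ENNReal.div_self (by norm_num) (by norm_num)]
  have h4 : (runFor T ([A], graphInput H k)).prob (fun c => c.1 = [] ∧ c.2 ∉ P) + 2 / 3 ≤
      3⁻¹ + 2 / 3 := by
    rw [h3]
    exact (add_le_add le_rfl h).trans h1
  exact (ENNReal.add_le_add_iff_right
    (ENNReal.div_ne_top (by norm_num) (by norm_num))).1 h4

end

section

variable {α β : Type} {p q : Prog} {s σ : MemState} {T T₁ T₂ : ℕ}
variable {n : ℕ} {G : SimpleGraph (Fin n)} {ℓ N X : ℕ} {w : ℕ → ℕ → ℕ}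
variable {A : Prog} {V W r : ℕ}

/-- There are two ways to fail: fewer than `2 * (c * t)` rows fall into the clique, so that the
promise is not ensured, or the promise holds and `A` errs. -/
theorem trialDist_prob_false_le {C : ℝ} (hC : 0 < C) {c t L : ℕ} (hc : C ≤ c)
    (hA : ApproximatesBiclique C (fun G k => ContainsDoubleClique G k) A) (hk : 1 ≤ c * t)
    (hL : n ≤ 2 ^ L) {S : Finset (Fin n)} (hS : G.IsClique (S : Set (Fin n))) :
    (trialDist A c G L ℓ N t T).prob (· = some false) ≤
      2 ^ (2 * (c * t)) * (1 - 2⁻¹ * (S.card * (2⁻¹ : ℝ≥0∞) ^ L) ^ ℓ) ^ N + 3⁻¹ := by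
  classical
  set S' := S.map Fin.valEmbedding with hS'
  have hlt : ∀ u ∈ S', u < n := by
    intro u hu
    rw [hS', Finset.mem_map] at hu
    obtain ⟨v, -, rfl⟩ := hu
    exact v.2
  rw [trialDist, PMF.prob_bind]
  have h1 : (randRows n L ℓ N).prob (fun w =>
      ((Finset.range N).filter fun i => RowIn S' ℓ (w i)).card < 2 * (c * t)) ≤
      2 ^ (2 * (c * t)) * (1 - 2⁻¹ * (S.card * (2⁻¹ : ℝ≥0∞) ^ L) ^ ℓ) ^ N := by
    have h2 := prob_fill_card_lt (fill (randVertex n L) ℓ 0) N 0 (RowIn S' ℓ) (2 * (c * t))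
    rw [randRow_prob] at h2
    refine h2.trans ?_
    have h3 := le_randVertex_prob hL hlt
    rw [hS', Finset.card_map] at h3
    exact mul_le_mul_right (pow_le_pow_left' (tsub_le_tsub_left
      (mul_le_mul_right (pow_le_pow_left' h3 _) _) _) _) _
  refine le_trans ?_ (add_le_add h1 le_rfl)
  rw [PMF.prob, ← (randRows n L ℓ N).expect_const 3⁻¹, ← PMF.expect_add]
  refine PMF.expect_mono fun w _ => ?_
  by_cases hw : ((Finset.range N).filter fun i => RowIn S' ℓ (w i)).card < 2 * (c * t)
  · rw [Set.indicator_of_mem (by exact hw)]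
    exact (PMF.prob_le_one _ _).trans le_self_add
  · refine le_trans ?_ le_add_self
    refine verdict_prob_false_le hC hc rfl (hA _ _ _ hk ?_) T
    exact rowGraph_containsDoubleClique hS (not_lt.1 hw)

theorem one_sub_pow_le_exp {ρ x : ℝ} (hρ : 0 ≤ ρ) (hx : x ≤ N * ρ) :
    (1 - 2⁻¹ * ENNReal.ofReal ρ) ^ N ≤ ENNReal.ofReal (Real.exp (-(x / 2))) := by
  have h1 : (1 : ℝ≥0∞) - 2⁻¹ * ENNReal.ofReal ρ = ENNReal.ofReal (1 - 2⁻¹ * ρ) := by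
    rw [ENNReal.ofReal_sub _ (by positivity), ENNReal.ofReal_one,
      ENNReal.ofReal_mul (by norm_num), ENNReal.ofReal_inv_of_pos (by norm_num)]
    norm_num
  have h2 : (1 : ℝ) - 2⁻¹ * ρ ≤ Real.exp (-(ρ / 2)) := by
    have := Real.add_one_le_exp (-(ρ / 2))
    linarith
  calc _ ≤ ENNReal.ofReal (Real.exp (-(ρ / 2))) ^ N := by
        rw [h1]
        gcongr
    _ = ENNReal.ofReal (Real.exp (-(N * ρ / 2))) := by
        rw [← ENNReal.ofReal_pow (Real.exp_pos _).le, ← Real.exp_nat_mul]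
        ring_nf
    _ ≤ _ := by gcongr

/-- The bound is `1/6` for too few rows inside the clique plus `1/3` for an error of `A`. It holds
at every position, including those whose time bound is too small: an unfinished run does not count
as a failure. -/
theorem stepDist_prob_false_le {C : ℝ} (hC : 0 < C) {c e L : ℕ} (hc : C ≤ c)
    (hA : ApproximatesBiclique C (fun G k => ContainsDoubleClique G k) A) (hn : 1 ≤ n)
    (hL1 : 1 ≤ L) (hL : n ≤ 2 ^ L) {S : Finset (Fin n)} (hS : G.IsClique (S : Set (Fin n)))
    (hcard : n * 2 ^ L ≤ S.card ^ (e + 1))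
    (hexp : (2 : ℝ) ^ (2 * (c * L)) * Real.exp (-((n : ℝ) / 2)) ≤ 6⁻¹) (j : ℕ) :
    (stepDist A c e G L j).prob (· = some false) ≤ 2⁻¹ := by
  classical
  have hc1 : 1 ≤ c := by
    rcases Nat.eq_zero_or_pos c with rfl | h
    · simp at hc; linarith
    · exact h
  rw [stepDist]
  split_ifs with hN
  swap
  · rw [PMF.prob_pure]; simp
  set t := L - j % L with ht
  have ht1 : 1 ≤ t := by
    have := Nat.mod_lt j (show L > 0 by omega)
    omega
  refine (trialDist_prob_false_le hC hc hA (Nat.mul_pos hc1 ht1) hL hS).trans ?_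
  set m := rowExp L t with hm
  have hm1 : 1 ≤ m := by
    have := (rowExp_spec (L := L) ht1).1
    by_contra h0
    rw [← hm, show m = 0 by omega] at this
    omega
  -- The factor `2 ^ (e * L * m)` cancels all but one of each `e + 1` factors `2⁻¹ ^ L`, which
  -- leaves `(S.card ^ (e + 1) / 2 ^ L) ^ m`.
  have hρ : (n : ℝ) ≤ (rowCount e L t : ℕ) * ((S.card : ℝ) * 2⁻¹ ^ L) ^ rowLen e L t := by
    have e1 : ((rowCount e L t : ℕ) : ℝ) * ((S.card : ℝ) * 2⁻¹ ^ L) ^ rowLen e L t =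
        (((S.card : ℝ) ^ (e + 1)) / 2 ^ L) ^ m := by
      rw [rowCount, rowLen, ← hm]
      push_cast
      rw [div_pow, ← pow_mul, mul_pow, inv_pow, inv_pow, ← pow_mul, ← pow_mul, eq_div_iff (by positivity)]
      have : (2 : ℝ) ^ (L * ((e + 1) * m)) = 2 ^ (e * L * m) * 2 ^ (L * m) := by
        rw [← pow_add]; ring_nf
      rw [this]
      field_simp
    rw [e1]
    have e2 : (n : ℝ) ≤ (S.card : ℝ) ^ (e + 1) / 2 ^ L := by
      rw [le_div_iff₀ (by positivity)]
      exact_mod_cast hcard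
    have e3 : (1 : ℝ) ≤ n := by exact_mod_cast hn
    calc (n : ℝ) = (n : ℝ) ^ 1 := (pow_one _).symm
      _ ≤ (n : ℝ) ^ m := pow_le_pow_right₀ e3 hm1
      _ ≤ _ := pow_le_pow_left₀ (by positivity) e2 _
  have h1 := one_sub_pow_le_exp (by positivity) hρ
  have h2 : ENNReal.ofReal (((S.card : ℝ) * 2⁻¹ ^ L) ^ rowLen e L t) =
      (S.card * (2⁻¹ : ℝ≥0∞) ^ L) ^ rowLen e L t := by
    rw [ENNReal.ofReal_pow (by positivity), ENNReal.ofReal_mul (by positivity),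
      ENNReal.ofReal_pow (by positivity), ENNReal.ofReal_inv_of_pos (by norm_num)]
    simp
  rw [h2] at h1
  calc _ ≤ ENNReal.ofReal ((2 : ℝ) ^ (2 * (c * L)) * Real.exp (-((n : ℝ) / 2))) + 3⁻¹ := by
        rw [ENNReal.ofReal_mul (by positivity), ENNReal.ofReal_pow (by norm_num),
          show ENNReal.ofReal 2 = 2 by simp]
        have : t ≤ L := by omega
        gcongr
        norm_num
    _ ≤ ENNReal.ofReal 6⁻¹ + ENNReal.ofReal 3⁻¹ := by
        refine add_le_add (ENNReal.ofReal_le_ofReal hexp) ?_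
        rw [ENNReal.ofReal_inv_of_pos (by norm_num)]
        simp
    _ = 2⁻¹ := by
        rw [← ENNReal.ofReal_add (by norm_num) (by norm_num),
          show (6⁻¹ : ℝ) + 3⁻¹ = 2⁻¹ by norm_num, ENNReal.ofReal_inv_of_pos (by norm_num)]
        simp

/-! ### Trials on graphs without large joined sets -/

/-- The graph contains `K_{h,h}`, given by its two sides. -/
def HasJoinedSets (G : SimpleGraph (Fin n)) (h : ℕ) : Prop :=
  ∃ P Q : Finset (Fin n), P.card = h ∧ Q.card = h ∧ ∀ u ∈ P, ∀ v ∈ Q, G.Adj u v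

/-- If both sets had more than `2 * h` elements, `h` elements of `P` could be chosen, and then `h`
elements of `Q` avoiding them; disjointness turns "equal or adjacent" into "adjacent". -/
theorem card_le_or_card_le_of_joined {h : ℕ} (hG : ¬ HasJoinedSets G h) {P Q : Finset ℕ}
    (hP : ∀ u ∈ P, u < n) (hQ : ∀ u ∈ Q, u < n)
    (hPQ : ∀ u ∈ P, ∀ v ∈ Q, u = v ∨ adjNat G u v) : P.card ≤ 2 * h ∨ Q.card ≤ 2 * h := by
  by_contra! hc
  obtain ⟨P', hP', hPc⟩ := Finset.exists_subset_card_eq (s := P) (n := h) (by omega)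
  have hd := Finset.le_card_sdiff P' Q
  obtain ⟨Q', hQ', hQc⟩ := Finset.exists_subset_card_eq (s := Q \ P') (n := h) (by omega)
  have hP2 : ∀ u ∈ P', u < n := fun u hu => hP u (hP' hu)
  have hQ2 : ∀ u ∈ Q', u < n := fun u hu => hQ u (Finset.mem_sdiff.1 (hQ' hu)).1
  refine hG ⟨P'.attachFin hP2, Q'.attachFin hQ2, by simpa, by simpa, fun u hu v hv => ?_⟩
  rw [Finset.mem_attachFin] at hu hv
  have hv' := Finset.mem_sdiff.1 (hQ' hv)
  rcases hPQ u (hP' hu) v hv'.1 with he | ha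
  · rw [he] at hu
    exact absurd hu hv'.2
  · exact adjNat_coe.1 ha

theorem exists_rowIn_of_card_le {h t : ℕ} (hn : 2 * h ≤ n) (hw : ∀ i < N, ∀ a < ℓ, w i a < n)
    {I : Finset ℕ} (hI : I ⊆ Finset.range N) (ht : I.card = t)
    (hc : (I.biUnion fun i => (Finset.range ℓ).image (w i)).card ≤ 2 * h) :
    ∃ I ∈ (Finset.range N).powersetCard t, ∃ U ∈ (Finset.range n).powersetCard (2 * h),
      ∀ i ∈ I, RowIn U ℓ (w i) := by
  obtain ⟨U, hU1, hU2, hU3⟩ := Finset.exists_subsuperset_card_eq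
    (s := I.biUnion fun i => (Finset.range ℓ).image (w i)) (t := Finset.range n) (n := 2 * h)
    (by
      intro u hu
      simp only [Finset.mem_biUnion, Finset.mem_image, Finset.mem_range] at hu
      obtain ⟨i, hi, a, ha, rfl⟩ := hu
      exact Finset.mem_range.2 (hw i (Finset.mem_range.1 (hI hi)) a ha)) hc (by simpa)
  refine ⟨I, Finset.mem_powersetCard.2 ⟨hI, ht⟩, U, Finset.mem_powersetCard.2 ⟨hU2, hU3⟩,
    fun i hi a ha => hU1 ?_⟩
  exact Finset.mem_biUnion.2 ⟨i, hi, Finset.mem_image_of_mem _ ha⟩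

/-- Every entry on one side of the biclique is equal or adjacent to every entry on the other, so one
of the two sides has at most `2 * h` entries in total, and its `t` rows lie in a common small set.
-/
theorem ListsBiclique.exists_rowIn {h t : ℕ} {M : MemState} (hG : ¬ HasJoinedSets G h)
    (hn : 2 * h ≤ n) (hw : ∀ i < N, ∀ a < ℓ, w i a < n)
    (hM : ListsBiclique (rowGraph G ℓ N w) t M) :
    ∃ I ∈ (Finset.range N).powersetCard t, ∃ U ∈ (Finset.range n).powersetCard (2 * h),
      ∀ i ∈ I, RowIn U ℓ (w i) := by
  obtain ⟨-, hM⟩ := hM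
  have hI0 : (Finset.range t).image (M.arr 0) ⊆ Finset.range N := by
    intro x hx
    simp only [Finset.mem_image, Finset.mem_range] at hx
    obtain ⟨i, hi, rfl⟩ := hx
    exact Finset.mem_range.2 (hM i hi i hi).1.1
  have hI1 : (Finset.range t).image (M.arr 1) ⊆ Finset.range N := by
    intro x hx
    simp only [Finset.mem_image, Finset.mem_range] at hx
    obtain ⟨i, hi, rfl⟩ := hx
    exact Finset.mem_range.2 (hM i hi i hi).1.2.1
  have hc0 : ((Finset.range t).image (M.arr 0)).card = t := by
    rw [Finset.card_image_of_injOn, Finset.card_range]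
    intro i hi j hj hij
    by_contra hne
    exact ((hM i (by simpa using hi) j (by simpa using hj)).2 hne).1 hij
  have hc1 : ((Finset.range t).image (M.arr 1)).card = t := by
    rw [Finset.card_image_of_injOn, Finset.card_range]
    intro i hi j hj hij
    by_contra hne
    exact ((hM i (by simpa using hi) j (by simpa using hj)).2 hne).2 hij
  have key := card_le_or_card_le_of_joined hG
    (P := ((Finset.range t).image (M.arr 0)).biUnion fun i => (Finset.range ℓ).image (w i))
    (Q := ((Finset.range t).image (M.arr 1)).biUnion fun i => (Finset.range ℓ).image (w i))
    (by
      intro u hu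
      simp only [Finset.mem_biUnion, Finset.mem_image (f := w _), Finset.mem_range] at hu
      obtain ⟨i, hi, a, ha, rfl⟩ := hu
      exact hw i (Finset.mem_range.1 (hI0 hi)) a ha)
    (by
      intro u hu
      simp only [Finset.mem_biUnion, Finset.mem_image (f := w _), Finset.mem_range] at hu
      obtain ⟨i, hi, a, ha, rfl⟩ := hu
      exact hw i (Finset.mem_range.1 (hI1 hi)) a ha)
    (by
      intro u hu v hv
      simp only [Finset.mem_biUnion, Finset.mem_image, Finset.mem_range] at hu hv
      obtain ⟨_, ⟨i, hi, rfl⟩, a, ha, rfl⟩ := hu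
      obtain ⟨_, ⟨j, hj, rfl⟩, b, hb, rfl⟩ := hv
      have h1 := (hM i hi j hj).1
      obtain ⟨hiN, hjN, -⟩ := id h1
      exact ((adjNat_rowGraph hiN hjN).1 h1).2 a ha b hb)
  rcases key with hc | hc
  · exact exists_rowIn_of_card_le hn hw hI0 hc0 hc
  · exact exists_rowIn_of_card_le hn hw hI1 hc1 hc

/-- A union bound over the `t` rows and over the set of `2 * h` vertices that contains them; each of
the `ℓ * t` independent entries hits this set with probability at most `4 * h / 2 ^ L`. The
behaviour of `A` plays no role. -/
theorem trialDist_prob_true_le {c t h L : ℕ} (hG : ¬ HasJoinedSets G h) (hn : 2 * h ≤ n)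
    (hL : 2 ^ L ≤ 2 * n) :
    (trialDist A c G L ℓ N t T).prob (· = some true) ≤
      (N : ℝ≥0∞) ^ t * (n : ℝ≥0∞) ^ (2 * h) *
        (((4 * h : ℕ) : ℝ≥0∞) * (2⁻¹ : ℝ≥0∞) ^ L) ^ (ℓ * t) := by
  classical
  rw [trialDist, PMF.prob_bind]
  calc _ ≤ (randRows n L ℓ N).prob (fun w => ∃ I ∈ (Finset.range N).powersetCard t,
        ∃ U ∈ (Finset.range n).powersetCard (2 * h), ∀ i ∈ I, RowIn U ℓ (w i)) := by
        rw [PMF.prob]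
        refine PMF.expect_mono fun w hw => ?_
        rw [PMF.prob_map]
        by_cases hex : ∃ I ∈ (Finset.range N).powersetCard t,
          ∃ U ∈ (Finset.range n).powersetCard (2 * h), ∀ i ∈ I, RowIn U ℓ (w i)
        · rw [Set.indicator_of_mem (by exact hex)]
          exact PMF.prob_le_one _ _
        · rw [PMF.prob_eq_zero]
          · exact zero_le
          intro cf _ hcf
          unfold verdict at hcf
          split_ifs at hcf with h0
          simp only [Option.some.injEq, decide_eq_true_eq] at hcf
          exact hex (hcf.exists_rowIn hG hn (randRows_lt hL hw))
    _ ≤ ∑ I ∈ (Finset.range N).powersetCard t, ∑ U ∈ (Finset.range n).powersetCard (2 * h),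
        (randRows n L ℓ N).prob (fun w => ∀ i ∈ I, RowIn U ℓ (w i)) :=
        (PMF.prob_exists_le _ _ _).trans
          (Finset.sum_le_sum fun I _ => PMF.prob_exists_le _ _ _)
    _ ≤ ∑ I ∈ (Finset.range N).powersetCard t, ∑ U ∈ (Finset.range n).powersetCard (2 * h),
        (((4 * h : ℕ) : ℝ≥0∞) * (2⁻¹ : ℝ≥0∞) ^ L) ^ (ℓ * t) := by
        refine Finset.sum_le_sum fun I hI => Finset.sum_le_sum fun U hU => ?_
        rw [Finset.mem_powersetCard] at hI hU
        rw [randRows, prob_fill_forall _ _ _ hI.1, randRow_prob, hI.2, ← pow_mul]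
        refine pow_le_pow_left' ((randVertex_prob_le _ _ _).trans (le_of_eq ?_)) _
        rw [hU.2]
        push_cast
        ring
    _ ≤ _ := by
        rw [Finset.sum_const, Finset.sum_const, nsmul_eq_mul, nsmul_eq_mul, ← mul_assoc,
          Finset.card_powersetCard, Finset.card_powersetCard, Finset.card_range, Finset.card_range]
        gcongr
        · exact_mod_cast Nat.choose_le_pow _ _
        · exact_mod_cast Nat.choose_le_pow _ _

theorem stepDist_prob_true_le {c e L : ℕ} (hG : ¬ HasJoinedSets G (3 * L)) (hn : 2 * (3 * L) ≤ n)
    (hL1 : 1 ≤ L) (hnL : n ≤ 2 ^ L) (hL : 2 ^ L ≤ 2 * n)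
    (hpow : (12 * L) ^ (e + 1) ≤ 2 ^ (L / 2)) (j : ℕ) :
    (stepDist A c e G L j).prob (· = some true) ≤ (2⁻¹ : ℝ≥0∞) ^ (4 * L ^ 2) := by
  classical
  rw [stepDist]
  split_ifs with hN
  swap
  · rw [PMF.prob_pure]; simp
  set t := L - j % L with ht
  have ht1 : 1 ≤ t := by
    have := Nat.mod_lt j (show L > 0 by omega)
    omega
  refine (trialDist_prob_true_le hG hn hL).trans ?_
  have hmt := (rowExp_spec (L := L) ht1).1
  rw [rowCount, rowLen]
  set m := rowExp L t with hm
  -- In exponents of two, after cancelling `e * L * m * t`, one needs `6L² + (L/2)mt + 4L² ≤ Lmt`.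
  -- This follows from `m * t ≥ 20 * L`, which explains the constant 20 in `rowExp`.
  have key : (2 ^ (e * L * m)) ^ t * n ^ (2 * (3 * L)) * (4 * (3 * L)) ^ ((e + 1) * m * t) *
      2 ^ (4 * L ^ 2) ≤ 2 ^ (L * ((e + 1) * m * t)) := by
    calc _ ≤ (2 ^ (e * L * m)) ^ t * (2 ^ L) ^ (2 * (3 * L)) * (2 ^ (L / 2)) ^ (m * t) *
          2 ^ (4 * L ^ 2) := by
          have h0 : (4 * (3 * L)) ^ ((e + 1) * m * t) ≤ (2 ^ (L / 2)) ^ (m * t) := by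
            rw [mul_assoc (e + 1), pow_mul, show 4 * (3 * L) = 12 * L by ring]
            exact Nat.pow_le_pow_left hpow _
          exact Nat.mul_le_mul_right _ (Nat.mul_le_mul (Nat.mul_le_mul_left _
            (Nat.pow_le_pow_left hnL _)) h0)
      _ = 2 ^ (e * L * m * t + L * (2 * (3 * L)) + L / 2 * (m * t) + 4 * L ^ 2) := by
          simp only [← pow_mul, ← pow_add]
      _ ≤ _ := by
          refine Nat.pow_le_pow_right (by omega) ?_
          have h1 : 2 * (L / 2 * (m * t)) ≤ L * (m * t) := by
            rw [← mul_assoc]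
            exact Nat.mul_le_mul_right _ (by omega)
          have h2 : L * (20 * L) ≤ L * (m * t) := Nat.mul_le_mul_left _ hmt
          have h3 : L * ((e + 1) * m * t) = e * L * m * t + L * (m * t) := by ring
          rw [h3]
          nlinarith
  have hk : (((2 ^ (e * L * m)) ^ t * n ^ (2 * (3 * L)) * (4 * (3 * L)) ^ ((e + 1) * m * t) *
      2 ^ (4 * L ^ 2) : ℕ) : ℝ≥0∞) ≤ ((2 ^ (L * ((e + 1) * m * t)) : ℕ) : ℝ≥0∞) := by
    exact_mod_cast key
  push_cast at hk ⊢
  rw [mul_pow, ← pow_mul (2⁻¹ : ℝ≥0∞), ← ENNReal.inv_pow, ← ENNReal.inv_pow, ← mul_assoc,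
    ← div_eq_mul_inv, ENNReal.div_le_iff (by simp) (by simp), mul_comm (_⁻¹), ← div_eq_mul_inv,
    ENNReal.le_div_iff_mul_le (by simp) (by simp)]
  exact hk

/-! ### The outcome of the search -/

theorem whileKernel_of_not {κ : α → PMF α} {P : α → Prop} {a : α} (h : ¬ P a) (f : ℕ) :
    whileKernel κ P f a = PMF.pure a := by
  cases f with
  | zero => rfl
  | succ f => rw [whileKernel, if_neg h]

theorem PMF.expect_verdict (μ : PMF Verdict) (f : Verdict → ℝ≥0∞) :
    μ.expect f = μ none * f none + μ (some false) * f (some false) +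
      μ (some true) * f (some true) := by
  rw [PMF.expect, tsum_fintype, Fintype.sum_option, Fintype.sum_bool]
  ring

/-- A union bound over the at most `f` trials. -/
theorem whileKernel_prob_accept_le {c e L : ℕ} {ε : ℝ≥0∞}
    (h : ∀ j, (stepDist A c e G L j).prob (· = some true) ≤ ε) (f : ℕ) (a : SearchState)
    (ha : a.2.2 ≠ some true) :
    (whileKernel (searchKernel A c e G L) SearchState.Running f a).prob
      (fun b => b.2.2 = some true) ≤ f * ε := by
  classical
  induction f generalizing a with
  | zero =>
    rw [whileKernel, PMF.prob_pure, if_neg ha]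
    simp
  | succ f ih =>
    by_cases hrun : a.Running
    · rw [whileKernel, if_pos hrun, PMF.prob_bind, searchKernel, PMF.expect_map,
        PMF.expect_verdict]
      have h1 := ih (advance n a none) (by simp [advance])
      have h2 := ih (advance n a (some false)) (by simp only [advance]; split_ifs <;> simp)
      have h3 := h a.1
      rw [PMF.prob_eq_apply] at h3
      set μ := stepDist A c e G L a.1 with hμ
      have h4 : μ none + μ (some false) ≤ 1 := by
        have := μ.expect_verdict fun _ => 1
        rw [PMF.expect_const] at this
        simp only [mul_one] at this
        rw [this]
        exact le_self_add
      calc _ ≤ μ none * (f * ε) + μ (some false) * (f * ε) + ε * 1 := by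
            gcongr
            exact PMF.prob_le_one _ _
        _ = (μ none + μ (some false)) * (f * ε) + ε := by ring
        _ ≤ 1 * (f * ε) + ε := by gcongr
        _ = _ := by push_cast; ring
    · rw [whileKernel_of_not hrun, PMF.prob_pure, if_neg ha]
      simp

/-- Rejection takes as many failures in a row as the counter shows, each of probability at most
`1/2`. Every move to a new position resets the counter to `n` and adds at most `2⁻¹ ^ n`. -/
theorem whileKernel_prob_reject_le {c e L : ℕ}
    (h : ∀ j, (stepDist A c e G L j).prob (· = some false) ≤ 2⁻¹) (f : ℕ) (a : SearchState)
    (ha : a.2.2 ≠ some false) :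
    (whileKernel (searchKernel A c e G L) SearchState.Running f a).prob
      (fun b => b.2.2 = some false) ≤ 2⁻¹ ^ a.2.1 + f * 2⁻¹ ^ n := by
  classical
  induction f generalizing a with
  | zero =>
    rw [whileKernel, PMF.prob_pure, if_neg ha]
    simp
  | succ f ih =>
    by_cases hrun : a.Running
    · rw [whileKernel, if_pos hrun, PMF.prob_bind, searchKernel, PMF.expect_map,
        PMF.expect_verdict]
      have h1 := ih (advance n a none) (by simp [advance])
      have h2 : (whileKernel (searchKernel A c e G L) SearchState.Running f
          (advance n a (some false))).prob (fun b => b.2.2 = some false) ≤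
          2⁻¹ ^ (a.2.1 - 1) + f * 2⁻¹ ^ n := by
        by_cases h0 : a.2.1 - 1 = 0
        · refine (PMF.prob_le_one _ _).trans ?_
          rw [h0, pow_zero]
          exact le_self_add
        · exact ih (advance n a (some false)) (by simp [advance, h0])
      have h3 := h a.1
      rw [PMF.prob_eq_apply] at h3
      have h5 : (whileKernel (searchKernel A c e G L) SearchState.Running f
          (advance n a (some true))).prob (fun b => b.2.2 = some false) = 0 := by
        rw [whileKernel_of_not (by simp [advance, SearchState.Running]), PMF.prob_pure]
        simp [advance]
      set μ := stepDist A c e G L a.1 with hμ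
      have h4 : μ none + μ (some false) ≤ 1 := by
        have := μ.expect_verdict fun _ => 1
        rw [PMF.expect_const] at this
        simp only [mul_one] at this
        rw [this]
        exact le_self_add
      have h6 : μ (some false) * (2⁻¹ : ℝ≥0∞) ^ (a.2.1 - 1) ≤ 2⁻¹ ^ a.2.1 := by
        rcases Nat.eq_zero_or_pos a.2.1 with h0 | h0
        · rw [h0]
          simpa using μ.coe_le_one _
        · obtain ⟨r, hr⟩ := Nat.exists_eq_add_of_le' h0
          rw [hr, Nat.add_sub_cancel, pow_succ']
          gcongr
      have h7 : μ none ≤ 1 := μ.coe_le_one _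
      rw [h5, mul_zero, add_zero]
      calc _ ≤ μ none * (2⁻¹ ^ n + f * 2⁻¹ ^ n) +
            μ (some false) * (2⁻¹ ^ (a.2.1 - 1) + f * 2⁻¹ ^ n) := by
            gcongr
            exact h1
        _ = μ none * 2⁻¹ ^ n + μ (some false) * 2⁻¹ ^ (a.2.1 - 1) +
            (μ none + μ (some false)) * (f * 2⁻¹ ^ n) := by ring
        _ ≤ 1 * 2⁻¹ ^ n + 2⁻¹ ^ a.2.1 + 1 * (f * 2⁻¹ ^ n) := by gcongr
        _ = _ := by push_cast; ring
    · rw [whileKernel_of_not hrun, PMF.prob_pure, if_neg ha]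
      simp

end

/-! ### Bicliques in random graphs and the error probabilities -/

section

variable {α β : Type} {p q : Prog} {s σ : MemState} {T T₁ T₂ : ℕ}
variable {n : ℕ} {G : SimpleGraph (Fin n)} {ℓ N X : ℕ} {w : ℕ → ℕ → ℕ}
variable {A : Prog} {V W r : ℕ}

/-! ### Random graphs -/

theorem erdosRenyiHalf_apply (G : SimpleGraph (Fin n)) :
    erdosRenyiHalf n G = 2⁻¹ ^ n.choose 2 := by
  have hle : G.edgeSet.ncard ≤ n.choose 2 := by
    classical
    have := G.card_edgeFinset_le_card_choose_two
    rw [Fintype.card_fin, ← Set.ncard_coe_finset, SimpleGraph.coe_edgeFinset] at this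
    exact this
  rw [erdosRenyiHalf, MeasureTheory.Measure.toPMF_apply, SimpleGraph.binomialRandom_singleton,
    Nat.card_fin]
  have h1 : unitInterval.toNNReal ⟨1 / 2, by norm_num, by norm_num⟩ = 2⁻¹ := by
    ext; simp [unitInterval.toNNReal]; rfl
  have h2 : unitInterval.toNNReal (unitInterval.symm ⟨1 / 2, by norm_num, by norm_num⟩) = 2⁻¹ := by
    ext
    change (1 : ℝ) - 1 / 2 = 2⁻¹
    norm_num
  rw [h1, h2]
  simp only [ENNReal.coe_inv (two_ne_zero), ENNReal.coe_ofNat]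
  rw [← pow_add, Nat.add_sub_cancel' hle]

/-- Given edges are present with the expected probability. -/
theorem erdosRenyiHalf_prob_subset_le (F : Finset (Sym2 (Fin n))) :
    (erdosRenyiHalf n).prob (fun G => (F : Set (Sym2 (Fin n))) ⊆ G.edgeSet) ≤ 2⁻¹ ^ F.card := by
  classical
  set c : ℝ≥0∞ := 2⁻¹ ^ n.choose 2 with hc
  set E : Finset (SimpleGraph (Fin n)) :=
    Finset.univ.filter fun G => (F : Set (Sym2 (Fin n))) ⊆ G.edgeSet with hE
  have h1 : (erdosRenyiHalf n).prob (fun G => (F : Set (Sym2 (Fin n))) ⊆ G.edgeSet) =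
      E.card * c := by
    have := (erdosRenyiHalf n).prob_mem_finset E
    simp only [erdosRenyiHalf_apply, Finset.sum_const, nsmul_eq_mul, hE, Finset.mem_filter,
      Finset.mem_univ, true_and] at this
    exact this
  have h2 : (Fintype.card (SimpleGraph (Fin n)) : ℝ≥0∞) * c = 1 := by
    have := (erdosRenyiHalf n).tsum_coe
    rw [tsum_fintype] at this
    simpa only [erdosRenyiHalf_apply, Finset.sum_const, nsmul_eq_mul, Finset.card_univ] using this
  -- All graphs are equally likely, so it suffices to count. From a graph containing `F`, delete a
  -- subset of `F`; the result determines both the graph and the subset.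
  have h3 : E.card * 2 ^ F.card ≤ Fintype.card (SimpleGraph (Fin n)) := by
    rw [← Finset.card_powerset, ← Finset.card_product, ← Finset.card_univ]
    refine Finset.card_le_card_of_injOn
      (fun x => x.1.deleteEdges (x.2 : Set (Sym2 (Fin n)))) (fun _ _ => Finset.mem_univ _) ?_
    rintro ⟨G, X⟩ hGX ⟨G', X'⟩ hGX' heq
    simp only [Finset.coe_product, Set.mem_prod, Finset.mem_coe, hE, Finset.mem_filter,
      Finset.mem_univ, true_and, Finset.mem_powerset] at hGX hGX'
    have hes : G.edgeSet \ X = G'.edgeSet \ X' := by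
      have := congrArg SimpleGraph.edgeSet heq
      simpa only [SimpleGraph.edgeSet_deleteEdges] using this
    have hX : X = X' := by
      ext x
      have hx := Set.ext_iff.1 hes x
      simp only [Set.mem_sdiff, Finset.mem_coe] at hx
      constructor
      · intro h
        by_contra h'
        exact (hx.2 ⟨hGX'.1 (hGX.2 h), h'⟩).2 h
      · intro h
        by_contra h'
        exact (hx.1 ⟨hGX.1 (hGX'.2 h), h'⟩).2 h
    have hG : G = G' := by
      rw [← SimpleGraph.edgeSet_inj]
      ext x
      have hx := Set.ext_iff.1 hes x
      simp only [Set.mem_sdiff, Finset.mem_coe, hX] at hx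
      by_cases h : x ∈ X'
      · exact iff_of_true (hGX.1 (hGX'.2 h)) (hGX'.1 (hGX'.2 h))
      · simpa [h] using hx
    rw [hX, hG]
  rw [h1, ← ENNReal.inv_pow, ← one_div, ENNReal.le_div_iff_mul_le (by simp) (by simp), ← h2,
    mul_right_comm]
  gcongr
  exact_mod_cast h3

/-- If `P` and `Q` meet, a common vertex would be adjacent to itself; if not, the pairs are distinct
edges. -/
theorem erdosRenyiHalf_prob_joined_le (P Q : Finset (Fin n)) :
    (erdosRenyiHalf n).prob (fun G => ∀ u ∈ P, ∀ v ∈ Q, G.Adj u v) ≤ 2⁻¹ ^ (P.card * Q.card) := by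
  classical
  by_cases hd : Disjoint P Q
  · have hcard : ((P ×ˢ Q).image fun x => s(x.1, x.2)).card = P.card * Q.card := by
      rw [Finset.card_image_of_injOn, Finset.card_product]
      rintro ⟨u, v⟩ h ⟨u', v'⟩ h' he
      simp only [Finset.coe_product, Set.mem_prod, Finset.mem_coe] at h h'
      simp only [Sym2.eq_iff] at he
      rcases he with ⟨rfl, rfl⟩ | ⟨rfl, rfl⟩
      · rfl
      · exact absurd h'.2 (Finset.disjoint_left.1 hd h.1)
    rw [← hcard]
    refine le_trans (PMF.prob_mono fun G _ hG => ?_) (erdosRenyiHalf_prob_subset_le _)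
    intro x hx
    simp only [Finset.coe_image, Set.mem_image, Finset.coe_product, Set.mem_prod,
      Finset.mem_coe] at hx
    obtain ⟨⟨u, v⟩, h, rfl⟩ := hx
    exact hG u h.1 v h.2
  · rw [PMF.prob_eq_zero]
    · exact zero_le
    intro G _ hG
    rw [Finset.not_disjoint_iff] at hd
    obtain ⟨u, hP, hQ⟩ := hd
    exact (hG u hP u hQ).ne rfl

/-- There are at most `2 ^ (6 * L ^ 2)` pairs of sides, and each is joined with probability at most
`2⁻¹ ^ (9 * L ^ 2)`. -/
theorem erdosRenyiHalf_prob_hasJoinedSets_le {L : ℕ} (hL : n ≤ 2 ^ L) :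
    (erdosRenyiHalf n).prob (fun G => HasJoinedSets G (3 * L)) ≤ 2⁻¹ ^ (3 * L ^ 2) := by
  classical
  calc _ ≤ (erdosRenyiHalf n).prob (fun G =>
        ∃ P ∈ (Finset.univ : Finset (Fin n)).powersetCard (3 * L),
        ∃ Q ∈ (Finset.univ : Finset (Fin n)).powersetCard (3 * L),
        ∀ u ∈ P, ∀ v ∈ Q, G.Adj u v) := by
        refine PMF.prob_mono fun G _ hG => ?_
        obtain ⟨P, Q, hP, hQ, h⟩ := hG
        exact ⟨P, by simp [Finset.mem_powersetCard, hP], Q, by simp [Finset.mem_powersetCard, hQ], h⟩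
    _ ≤ ∑ P ∈ (Finset.univ : Finset (Fin n)).powersetCard (3 * L),
        ∑ Q ∈ (Finset.univ : Finset (Fin n)).powersetCard (3 * L),
        (erdosRenyiHalf n).prob (fun G => ∀ u ∈ P, ∀ v ∈ Q, G.Adj u v) :=
        (PMF.prob_exists_le _ _ _).trans (Finset.sum_le_sum fun _ _ => PMF.prob_exists_le _ _ _)
    _ ≤ ∑ P ∈ (Finset.univ : Finset (Fin n)).powersetCard (3 * L),
        ∑ Q ∈ (Finset.univ : Finset (Fin n)).powersetCard (3 * L), 2⁻¹ ^ (3 * L * (3 * L)) := by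
        refine Finset.sum_le_sum fun P hP => Finset.sum_le_sum fun Q hQ => ?_
        rw [Finset.mem_powersetCard] at hP hQ
        have := erdosRenyiHalf_prob_joined_le P Q
        rwa [hP.2, hQ.2] at this
    _ ≤ (2 ^ L) ^ (3 * L) * ((2 ^ L) ^ (3 * L) * 2⁻¹ ^ (3 * L * (3 * L))) := by
        rw [Finset.sum_const, Finset.sum_const, nsmul_eq_mul, nsmul_eq_mul,
          Finset.card_powersetCard, Finset.card_univ, Fintype.card_fin]
        have : ((n.choose (3 * L) : ℕ) : ℝ≥0∞) ≤ (2 ^ L) ^ (3 * L) := by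
          exact_mod_cast (Nat.choose_le_pow _ _).trans (Nat.pow_le_pow_left hL _)
        gcongr
    _ = 2⁻¹ ^ (3 * L ^ 2) := by
        rw [← mul_assoc, ← pow_mul, ← pow_add,
          show 3 * L * (3 * L) = (L * (3 * L) + L * (3 * L)) + 3 * L ^ 2 by ring,
          pow_add 2⁻¹, ← mul_assoc, ← mul_pow 2 2⁻¹, ENNReal.mul_inv_cancel (by simp) (by simp), one_pow, one_mul]

theorem plantedClique_support {κ : ℕ} (hκ : κ ≤ n)
    (hG : G ∈ (plantedClique n κ).support) :
    ∃ S : Finset (Fin n), S.card = κ ∧ G.IsClique (S : Set (Fin n)) := by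
  rw [plantedClique, PMF.mem_support_bind_iff] at hG
  obtain ⟨G', -, hG⟩ := hG
  rw [PMF.support_map] at hG
  obtain ⟨S, hS, rfl⟩ := hG
  rw [randomVertexSet, PMF.mem_support_uniformOfFinset_iff, Finset.mem_powersetCard] at hS
  refine ⟨S, by rw [hS.2, min_eq_left hκ], fun u hu v hv huv => ?_⟩
  change (addClique G' S).Adj u v
  rw [addClique, SimpleGraph.sup_adj, SimpleGraph.fromRel_adj]
  exact Or.inr ⟨huv, Or.inl ⟨hu, hv⟩⟩

/-! ### The distinguisher -/

theorem distinguisher_acceptProb (hV : ∀ y, A.WritesVar y → y < V)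
    (hW : ∀ y, A.WritesArr y → y < W) (hV2 : 2 ≤ V) (hW0 : 0 < W) {c e J : ℕ} (he : 1 ≤ e)
    (hn : 2 ≤ n) (hJ : ∀ G : SimpleGraph (Fin n),
      none ∉ (stepDist A c e G (Nat.clog 2 n) J).support) (D : PMF (SimpleGraph (Fin n))) :
    acceptProb (distinguisher A c e V W) D =
      D.expect fun G => (searchDist A c e G J).prob fun a => a.2.2 = some true := by
  rw [acceptProb, PMF.expect]
  refine tsum_congr fun G => ?_
  congr 1
  -- The running time does not matter here, so any sufficiently large `X` serves.
  exact (yields_distinguisher (X := 2 * n + c + (e + 1) * 2 ^ (J / Nat.clog 2 n)) hV hW hV2 hW0 he G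
    hn (by omega) (by omega) (by omega) (hJ G)).outcome.2 _ _ fun a s' h => h

theorem searchDist_prob_accept_add {c e J : ℕ} (hn : 1 ≤ n)
    (hJ : none ∉ (stepDist A c e G (Nat.clog 2 n) J).support) :
    1 ≤ (searchDist A c e G J).prob (fun a => a.2.2 = some true) +
      (searchDist A c e G J).prob (fun a => a.2.2 = some false) := by
  rw [← (searchDist A c e G J).prob_add_not (fun a => a.2.2 = some true)]
  refine add_le_add le_rfl (PMF.prob_mono fun a ha h => ?_)
  have h0 := searchKernel_halts hn hJ ((J + 1) * n) (0, n, none) (Nat.zero_le _) hn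
    (by simp only [Nat.sub_zero]; rw [Nat.succ_mul]) a ha
  rw [SearchState.Running] at h0
  match ho : a.2.2 with
  | none => exact absurd ho h0
  | some true => exact absurd ho h
  | some false => rfl

/-- The search always ends with an answer, so it suffices to bound rejection, whose probability is
at most `((J + 1) * n + 1) * 2⁻¹ ^ n`. -/
theorem le_acceptProb_plantedClique {C : ℝ} (hC : 0 < C) {c e J κ : ℕ} (hc : C ≤ c)
    (hA : ApproximatesBiclique C (fun G k => ContainsDoubleClique G k) A)
    (hV : ∀ y, A.WritesVar y → y < V) (hW : ∀ y, A.WritesArr y → y < W) (hV2 : 2 ≤ V)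
    (hW0 : 0 < W) (he : 1 ≤ e) (hn : 2 ≤ n) (hJ : ∀ G : SimpleGraph (Fin n),
      none ∉ (stepDist A c e G (Nat.clog 2 n) J).support) (hκ : κ ≤ n)
    (hcard : n * 2 ^ Nat.clog 2 n ≤ κ ^ (e + 1))
    (hexp : (2 : ℝ) ^ (2 * (c * Nat.clog 2 n)) * Real.exp (-((n : ℝ) / 2)) ≤ 6⁻¹)
    (hJn : J + 1 ≤ n) (hsmall : 3 * (n * n + 1) ≤ 2 ^ n) :
    2 / 3 ≤ acceptProb (distinguisher A c e V W) (plantedClique n κ) := by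
  rw [distinguisher_acceptProb hV hW hV2 hW0 he hn hJ, ← (plantedClique n κ).expect_const (2 / 3)]
  refine PMF.expect_mono fun G hG => ?_
  obtain ⟨S, rfl, hS⟩ := plantedClique_support hκ hG
  have h1 := stepDist_prob_false_le hC hc hA (by omega) (Nat.clog_pos (by omega) hn)
    (Nat.le_pow_clog (by omega) n) hS hcard hexp
  have h2 := whileKernel_prob_reject_le h1 ((J + 1) * n) (0, n, none) (by simp)
  have h3 : (searchDist A c e G J).prob (fun a => a.2.2 = some false) ≤ 3⁻¹ := by
    refine h2.trans ?_
    calc (2⁻¹ : ℝ≥0∞) ^ n + (((J + 1) * n : ℕ) : ℝ≥0∞) * 2⁻¹ ^ n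
        = (((J + 1) * n + 1 : ℕ) : ℝ≥0∞) * 2⁻¹ ^ n := by push_cast; ring
      _ ≤ ((n * n + 1 : ℕ) : ℝ≥0∞) * 2⁻¹ ^ n := by gcongr
      _ ≤ 3⁻¹ := by
        rw [← ENNReal.inv_pow, ← div_eq_mul_inv, ENNReal.div_le_iff (by simp) (by simp),
          mul_comm (3⁻¹), ← div_eq_mul_inv, ENNReal.le_div_iff_mul_le (by simp) (by simp),
          mul_comm]
        exact_mod_cast hsmall
  have h4 := searchDist_prob_accept_add (by omega) (hJ G)
  have h5 : (2 : ℝ≥0∞) / 3 + 3⁻¹ = 1 := by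
    rw [← one_div, ENNReal.div_add_div_same, show (2 : ℝ≥0∞) + 1 = 3 by norm_num,
      ENNReal.div_self (by norm_num) (by norm_num)]
  have h6 : (2 : ℝ≥0∞) / 3 + 3⁻¹ ≤
      (searchDist A c e G J).prob (fun a => a.2.2 = some true) + 3⁻¹ := by
    rw [h5]
    exact h4.trans (add_le_add le_rfl h3)
  exact (ENNReal.add_le_add_iff_right (by simp)).1 h6

/-- With probability at least `7/8` the graph has no large joined sets, and then the at most `2 ^ (2
* L)` trials, each accepting with probability at most `2⁻¹ ^ (4 * L ^ 2)`, contribute at most `1/8`.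
-/
theorem acceptProb_erdosRenyiHalf_le {c e J : ℕ}
    (hV : ∀ y, A.WritesVar y → y < V) (hW : ∀ y, A.WritesArr y → y < W) (hV2 : 2 ≤ V)
    (hW0 : 0 < W) (he : 1 ≤ e) (hn : 3 ≤ n) (hJ : ∀ G : SimpleGraph (Fin n),
      none ∉ (stepDist A c e G (Nat.clog 2 n) J).support)
    (h6 : 2 * (3 * Nat.clog 2 n) ≤ n)
    (hpow : (12 * Nat.clog 2 n) ^ (e + 1) ≤ 2 ^ (Nat.clog 2 n / 2)) (hJn : J + 1 ≤ n) :
    acceptProb (distinguisher A c e V W) (erdosRenyiHalf n) ≤ 1 / 3 := by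
  classical
  rw [distinguisher_acceptProb hV hW hV2 hW0 he (by omega) hJ]
  set L := Nat.clog 2 n with hL
  have hnL : n ≤ 2 ^ L := Nat.le_pow_clog (by omega) n
  have hL2 : 2 ≤ L := by
    by_contra h
    have : 2 ^ L ≤ 2 ^ 1 := Nat.pow_le_pow_right (by omega) (by omega)
    omega
  have hLn : 2 ^ L ≤ 2 * n := by
    have : ¬ n ≤ 2 ^ (L - 1) := by
      rw [← Nat.clog_le_iff_le_pow (by omega)]
      omega
    rw [show L = L - 1 + 1 by omega, pow_succ]
    omega
  have hL4 : 4 ≤ L ^ 2 := by nlinarith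
  have key : ∀ G : SimpleGraph (Fin n),
      (searchDist A c e G J).prob (fun a => a.2.2 = some true) ≤
      {G | HasJoinedSets G (3 * L)}.indicator 1 G + 2⁻¹ ^ 3 := by
    intro G
    by_cases hG : HasJoinedSets G (3 * L)
    · rw [Set.indicator_of_mem (by exact hG)]
      exact (PMF.prob_le_one _ _).trans le_self_add
    · refine le_trans ?_ le_add_self
      refine (whileKernel_prob_accept_le
        (stepDist_prob_true_le hG h6 (by omega) hnL hLn hpow) _ _ (by simp)).trans ?_
      calc (((J + 1) * n : ℕ) : ℝ≥0∞) * 2⁻¹ ^ (4 * L ^ 2)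
          ≤ ((2 ^ L * 2 ^ L : ℕ) : ℝ≥0∞) * 2⁻¹ ^ (L + L + 3) := by
            refine mul_le_mul' ?_ (pow_le_pow_right_of_le_one' (by simp) (by nlinarith))
            exact_mod_cast Nat.mul_le_mul (hJn.trans hnL) hnL
        _ = 2⁻¹ ^ 3 := by
            push_cast
            rw [← pow_add, pow_add _ (L + L), ← mul_assoc, ← mul_pow,
              ENNReal.mul_inv_cancel (by simp) (by simp), one_pow, one_mul]
  calc _ ≤ (erdosRenyiHalf n).expect fun G =>
        {G | HasJoinedSets G (3 * L)}.indicator 1 G + 2⁻¹ ^ 3 := PMF.expect_mono fun G _ => key G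
    _ = (erdosRenyiHalf n).prob (fun G => HasJoinedSets G (3 * L)) + 2⁻¹ ^ 3 := by
        rw [PMF.expect_add, PMF.expect_const]; rfl
    _ ≤ 2⁻¹ ^ 3 + 2⁻¹ ^ 3 := by
        gcongr
        refine (erdosRenyiHalf_prob_hasJoinedSets_le hnL).trans ?_
        exact pow_le_pow_right_of_le_one' (by simp) (by omega)
    _ = 4⁻¹ := by
        rw [← ENNReal.inv_pow, ← two_mul, show (2 : ℝ≥0∞) ^ 3 = 2 * 4 by norm_num,
          ENNReal.mul_inv (by simp) (by simp), ← mul_assoc,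
          ENNReal.mul_inv_cancel (by simp) (by simp), one_mul]
    _ ≤ 1 / 3 := by
        rw [one_div]
        exact ENNReal.inv_le_inv.2 (by norm_num)

/-- The index `L * i + (L - t)` is the position of the time bound `2 ^ i` and the side `t` in the
enumeration. -/
theorem none_notMem_stepDist {c e L t i : ℕ} (ht : 1 ≤ t) (htL : t ≤ L)
    (hN : rowCount e L t ≤ 2 ^ i)
    (hA : ∀ H : SimpleGraph (Fin (rowCount e L t)), A.HaltsWithin (2 ^ i) (graphInput H (c * t))) :
    none ∉ (stepDist A c e G L (L * i + (L - t))).support := by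
  have h1 : (L * i + (L - t)) / L = i := by
    rw [Nat.mul_add_div (by omega), Nat.div_eq_of_lt (by omega), Nat.add_zero]
  have h2 : L - (L * i + (L - t)) % L = t := by
    rw [Nat.mul_add_mod, Nat.mod_eq_of_lt (by omega)]
    omega
  rw [stepDist, h1, h2, if_pos hN, trialDist, PMF.mem_support_bind_iff]
  rintro ⟨w, -, hw⟩
  rw [PMF.support_map] at hw
  obtain ⟨cf, hcf, hv⟩ := hw
  rw [verdict, if_pos (hA _ cf hcf)] at hv
  cases hv

end

/-! ### Choice of the parameters and the running time -/

section

variable {α β : Type} {p q : Prog} {s σ : MemState} {T T₁ T₂ : ℕ}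
variable {n : ℕ} {G : SimpleGraph (Fin n)} {ℓ N X : ℕ} {w : ℕ → ℕ → ℕ}
variable {A : Prog} {V W r : ℕ}

/-! ### Asymptotics -/

theorem Prog.HaltsWithin.mono (h : A.HaltsWithin T₁ s) (hT : T₁ ≤ T₂) : A.HaltsWithin T₂ s :=
  HaltsIn.mono h hT

/-- It is enough to bound the running time by `n ^ (ε log n)` for every `ε`. -/
theorem quasiPolyLittleOTime_of_forall
    (h : ∀ ε : ℝ, 0 < ε → ∀ᶠ n : ℕ in atTop, ∃ T : ℕ, (T : ℝ) ≤ Real.exp (ε * Real.log n ^ 2) ∧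
      ∀ G : SimpleGraph (Fin n), A.HaltsWithin T (graphInput G 0)) :
    QuasiPolyLittleOTime A := by
  classical
  -- The least uniform time bound does not depend on `ε`, so a single exponent serves all `ε` at
  -- once. Adding `1` below avoids the logarithm of zero.
  set τ : ℕ → ℕ := fun n => sInf {T | ∀ G : SimpleGraph (Fin n), A.HaltsWithin T (graphInput G 0)}
    with hτ
  have hlog : Tendsto (fun n : ℕ => Real.log n) atTop atTop :=
    Real.tendsto_log_atTop.comp tendsto_natCast_atTop_atTop
  refine ⟨fun n => Real.log (τ n + 1) / Real.log n, ?_, ?_⟩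
  · rw [isLittleO_iff]
    intro ε hε
    filter_upwards [h (ε / 2) (by positivity), hlog.eventually_ge_atTop 1,
      hlog.eventually_ge_atTop (2 / ε)] with n hn h1 h2
    obtain ⟨T, hT, hG⟩ := hn
    have hle : τ n ≤ T := Nat.sInf_le hG
    have hpos : (1 : ℝ) ≤ Real.exp (ε / 2 * Real.log n ^ 2) := Real.one_le_exp (by positivity)
    have h3 : Real.log (τ n + 1) ≤ ε / 2 * Real.log n ^ 2 + 1 := by
      have h4 : (τ n + 1 : ℝ) ≤ Real.exp (ε / 2 * Real.log n ^ 2 + 1) := by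
        have h5 : (τ n : ℝ) ≤ T := by exact_mod_cast hle
        have h6 : (2 : ℝ) ≤ Real.exp 1 := by
          have := Real.add_one_le_exp (1 : ℝ)
          linarith
        rw [Real.exp_add]
        nlinarith
      calc _ ≤ Real.log (Real.exp (ε / 2 * Real.log n ^ 2 + 1)) :=
            Real.log_le_log (by positivity) h4
        _ = _ := Real.log_exp _
    have h7 : 0 ≤ Real.log (τ n + 1) := Real.log_nonneg (by
      have : (0 : ℝ) ≤ τ n := Nat.cast_nonneg _
      linarith)
    have h0 : 0 < Real.log n := by linarith
    rw [Real.norm_of_nonneg (by positivity), Real.norm_of_nonneg h0.le, div_le_iff₀ h0]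
    have h8 : 1 ≤ ε / 2 * Real.log n := by
      rw [div_le_iff₀ hε] at h2
      linarith
    nlinarith
  · filter_upwards [h 1 one_pos, hlog.eventually_ge_atTop 1, eventually_ge_atTop 1]
      with n hn h1 hn1 G
    obtain ⟨T, -, hG⟩ := hn
    have hmem : τ n ∈ {T | ∀ G : SimpleGraph (Fin n), A.HaltsWithin T (graphInput G 0)} :=
      Nat.sInf_mem ⟨T, hG⟩
    refine (hmem G).mono (Nat.le_floor ?_)
    have hn0 : (0 : ℝ) < n := by exact_mod_cast hn1
    have ht0 : (0 : ℝ) < τ n + 1 := by positivity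
    rw [Real.rpow_def_of_pos hn0, mul_div_cancel₀ _ (by linarith), Real.exp_log ht0]
    linarith

theorem tendsto_clog : Tendsto (Nat.clog 2) atTop atTop := by
  refine tendsto_atTop.2 fun b => ?_
  filter_upwards [eventually_ge_atTop (2 ^ b)] with n hn
  calc b = Nat.clog 2 (2 ^ b) := (Nat.clog_pow 2 b (by omega)).symm
    _ ≤ Nat.clog 2 n := Nat.clog_mono_right 2 hn

theorem clog_le_three_mul_log {n : ℕ} (hn : 3 ≤ n) :
    (Nat.clog 2 n : ℝ) ≤ 3 * Real.log n := by
  set L := Nat.clog 2 n with hL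
  have hL1 : 1 ≤ L := Nat.clog_pos (by omega) (by omega)
  have h : 2 ^ (L - 1) < n := Nat.pow_lt_of_lt_clog (by omega)
  have h1 : (2 : ℝ) ^ (L - 1) ≤ n := by exact_mod_cast h.le
  have h2 := Real.log_le_log (by positivity) h1
  rw [Real.log_pow, Nat.cast_sub hL1, Nat.cast_one] at h2
  have h3 := Real.log_two_gt_d9
  have h4 : (1 : ℝ) ≤ Real.log n := by
    rw [Real.le_log_iff_exp_le (by positivity)]
    have := Real.exp_one_lt_d9
    have : (3 : ℝ) ≤ n := by exact_mod_cast hn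
    linarith
  have h5 : (0 : ℝ) ≤ L - 1 := by
    have : (1 : ℝ) ≤ L := by exact_mod_cast hL1
    linarith
  nlinarith

theorem eventually_pow_le_two_pow (a k : ℕ) : ∀ᶠ x : ℕ in atTop, a * x ^ k ≤ 2 ^ x := by
  have h := tendsto_pow_const_div_const_pow_of_one_lt k (show (1 : ℝ) < 2 by norm_num)
  have h2 : ∀ᶠ x : ℕ in atTop, (x : ℝ) ^ k / 2 ^ x < 1 / (a + 1) :=
    h.eventually_lt_const (by positivity)
  filter_upwards [h2] with x hx
  rw [div_lt_div_iff₀ (by positivity) (by positivity)] at hx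
  have : ((a * x ^ k : ℕ) : ℝ) ≤ ((2 ^ x : ℕ) : ℝ) := by
    push_cast
    have : (0 : ℝ) ≤ (x : ℝ) ^ k := by positivity
    nlinarith
  exact_mod_cast this

theorem eventually_twelve_mul_pow_le (e : ℕ) :
    ∀ᶠ L : ℕ in atTop, (12 * L) ^ e ≤ 2 ^ (L / 2) := by
  have hd : Tendsto (fun L : ℕ => L / 2) atTop atTop :=
    Nat.tendsto_div_const_atTop (by omega)
  filter_upwards [hd.eventually (eventually_pow_le_two_pow (36 ^ e) e), eventually_ge_atTop 2]
    with L h1 h2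
  calc (12 * L) ^ e ≤ (36 * (L / 2)) ^ e := Nat.pow_le_pow_left (by omega) _
    _ = 36 ^ e * (L / 2) ^ e := mul_pow _ _ _
    _ ≤ _ := h1

/-- Since `2 ^ Nat.clog 2 n ≤ 2 * n`, the first factor is at most a power of `2 * n` with fixed
exponent. -/
theorem eventually_two_pow_mul_exp_le (c : ℕ) :
    ∀ᶠ n : ℕ in atTop,
      (2 : ℝ) ^ (2 * (c * Nat.clog 2 n)) * Real.exp (-((n : ℝ) / 2)) ≤ 6⁻¹ := by
  have h1 : Tendsto (fun n : ℕ => (n : ℝ) / 2) atTop atTop :=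
    tendsto_natCast_atTop_atTop.atTop_div_const (by norm_num)
  have h2 := (Real.tendsto_pow_mul_exp_neg_atTop_nhds_zero (2 * c)).comp h1
  have h3 : ∀ᶠ n : ℕ in atTop, ((n : ℝ) / 2) ^ (2 * c) * Real.exp (-((n : ℝ) / 2)) <
      6⁻¹ / 4 ^ (2 * c) := h2.eventually_lt_const (by positivity)
  filter_upwards [h3, eventually_ge_atTop 2] with n hn hn2
  have hL : 2 ^ Nat.clog 2 n ≤ 2 * n := by
    have h : 2 ^ (Nat.clog 2 n - 1) < n := Nat.pow_pred_clog_lt_self (by omega) (by omega)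
    have := Nat.clog_pos (b := 2) (by omega) hn2
    rw [show Nat.clog 2 n = Nat.clog 2 n - 1 + 1 by omega, pow_succ]
    omega
  rw [lt_div_iff₀ (by positivity)] at hn
  calc _ = ((2 ^ Nat.clog 2 n : ℕ) : ℝ) ^ (2 * c) * Real.exp (-((n : ℝ) / 2)) := by
        push_cast
        rw [← pow_mul]
        ring_nf
    _ ≤ ((2 * n : ℕ) : ℝ) ^ (2 * c) * Real.exp (-((n : ℝ) / 2)) := by gcongr
    _ = ((n : ℝ) / 2) ^ (2 * c) * Real.exp (-((n : ℝ) / 2)) * 4 ^ (2 * c) := by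
        push_cast
        rw [mul_right_comm, ← mul_pow]
        ring_nf
    _ ≤ _ := hn.le

/-- For a suitable side length, the simulated program halts within `2 ^ i` steps for an `i` that is
small compared to the square of the logarithm of the number of vertices. -/
theorem exists_side_halts (hA : RunsInTimeFMulNPowLittleO A) {c : ℕ} (hc : 1 ≤ c) (e : ℕ) {θ : ℝ}
    (hθ : 0 < θ) : ∃ t : ℕ, 1 ≤ t ∧ ∀ᶠ L : ℕ in atTop, t ≤ L ∧ ∃ i : ℕ, (i : ℝ) ≤ θ * L ^ 2 ∧
      rowCount e L t ≤ 2 ^ i ∧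
      ∀ H : SimpleGraph (Fin (rowCount e L t)), A.HaltsWithin (2 ^ i) (graphInput H (c * t)) := by
  obtain ⟨f, g, hg, hA⟩ := hA
  set η : ℝ := θ / (80 * (e + 1)) with hη
  have hη0 : 0 < η := by positivity
  have hc0 : (0 : ℝ) < c := by exact_mod_cast hc
  have hct : Tendsto (fun t : ℕ => c * t) atTop atTop :=
    tendsto_id.const_mul_atTop' (by omega)
  have hg' := hct.eventually ((isLittleO_iff.1 hg) (show 0 < η / c by positivity))
  -- A constant `t` at which `|g (c * t)| ≤ η * t` and `2 ≤ η * t`; the latter absorbs the rounding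
  -- of the exponent.
  obtain ⟨t, ht, ht1, ht2⟩ := (hg'.and ((eventually_ge_atTop 1).and
    (tendsto_natCast_atTop_atTop.eventually_ge_atTop (2 / η)))).exists
  refine ⟨t, ht1, ?_⟩
  set Γ : ℕ := ⌈|g (c * t)|⌉₊ with hΓ
  obtain ⟨Φ, hΦ⟩ := pow_unbounded_of_one_lt |f (c * t)| (show (1 : ℝ) < 2 by norm_num)
  have ht0 : (0 : ℝ) < t := by exact_mod_cast ht1
  have hΓt : (Γ + 1 : ℝ) ≤ 2 * η * t := by
    have h1 : (Γ : ℝ) < |g (c * t)| + 1 := Nat.ceil_lt_add_one (abs_nonneg _)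
    have h2 : |g (c * t)| ≤ η * t := by
      rw [Real.norm_eq_abs, Real.norm_of_nonneg (by positivity)] at ht
      refine ht.trans (le_of_eq ?_)
      push_cast
      field_simp
    have h3 : 2 ≤ η * t := by
      rw [div_le_iff₀ hη0] at ht2
      linarith
    linarith
  have hΦL : ∀ᶠ L : ℕ in atTop, (e * (Γ + 1) + Φ) / (θ / 2) ≤ (L : ℝ) :=
    tendsto_natCast_atTop_atTop.eventually_ge_atTop _
  filter_upwards [eventually_ge_atTop t, hΦL] with L hL hL2
  have hL1 : 1 ≤ L := ht1.trans hL
  have hL1' : (1 : ℝ) ≤ L := by exact_mod_cast hL1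
  set m := rowExp L t with hm
  -- The part `e * L * m * Γ` bounds the power of the number of rows in the running time, `Φ` bounds
  -- `f`, and the additional `e * L * m` lets the number of rows pass the guard.
  refine ⟨hL, e * L * m * (Γ + 1) + Φ, ?_, ?_, fun H => ?_⟩
  · have hmt : (m : ℝ) * t ≤ 20 * L + t := by
      have hm0 := (rowExp_spec (L := L) ht1).2 (m - 1)
      rcases Nat.eq_zero_or_pos m with h0 | h0
      · rw [h0]
        push_cast
        rw [zero_mul]
        positivity
      · have h1 := hm0 (by omega)
        have h2 : m * t ≤ 20 * L + t := by
          rw [show m = m - 1 + 1 by omega, Nat.succ_mul]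
          omega
        exact_mod_cast h2
    have h1 : (m : ℝ) * (Γ + 1) ≤ 40 * η * L + (Γ + 1) := by
      have h2 : (m : ℝ) * (Γ + 1) * t ≤ (20 * L + t) * (Γ + 1) := by
        nlinarith
      have h3 : (20 * L : ℝ) * (Γ + 1) ≤ 20 * L * (2 * η * t) := by gcongr
      refine le_of_mul_le_mul_right ?_ ht0
      nlinarith
    have h2 : (e : ℝ) * L * (m * (Γ + 1)) ≤ e * L * (40 * η * L + (Γ + 1)) := by gcongr
    have h3 : (e : ℝ) * (40 * η) ≤ θ / 2 := by
      rw [hη]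
      rw [show (e : ℝ) * (40 * (θ / (80 * (e + 1)))) = (θ / 2) * (e / (e + 1)) by
        field_simp; ring]
      refine mul_le_of_le_one_right (by positivity) ?_
      rw [div_le_one (by positivity)]
      linarith
    have h4 : (e * (Γ + 1) + Φ : ℝ) ≤ θ / 2 * L := by
      rw [div_le_iff₀ (by positivity)] at hL2
      linarith
    have h5 : (Φ : ℝ) ≤ Φ * L := le_mul_of_one_le_right (by positivity) hL1'
    have h6 : (e : ℝ) * (40 * η) * (L * L) ≤ θ / 2 * (L * L) := by gcongr
    have h7 : (e * (Γ + 1) + Φ : ℝ) * L ≤ θ / 2 * L * L := by gcongr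
    push_cast
    nlinarith
  · rw [rowCount, ← hm]
    refine Nat.pow_le_pow_right (by omega) ?_
    have := Nat.le_mul_of_pos_right (e * L * m) (show 0 < Γ + 1 by omega)
    omega
  · have hN1 : 1 ≤ rowCount e L t := Nat.one_le_two_pow
    refine (hA (c * t) _ (Nat.mul_pos hc ht1) hN1 H).mono ?_
    refine Nat.floor_le_of_le ?_
    have hN1' : (1 : ℝ) ≤ (rowCount e L t : ℕ) := by exact_mod_cast hN1
    have h1 : ((rowCount e L t : ℕ) : ℝ) ^ g (c * t) ≤ ((rowCount e L t : ℕ) : ℝ) ^ Γ := by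
      rw [← Real.rpow_natCast]
      refine Real.rpow_le_rpow_of_exponent_le hN1' ?_
      exact (le_abs_self _).trans (Nat.le_ceil _)
    calc f (c * t) * ((rowCount e L t : ℕ) : ℝ) ^ g (c * t)
        ≤ 2 ^ Φ * ((rowCount e L t : ℕ) : ℝ) ^ Γ := by
          refine mul_le_mul ((le_abs_self _).trans hΦ.le) h1 (by positivity) (by positivity)
      _ = ((2 ^ (e * L * m * Γ + Φ) : ℕ) : ℝ) := by
          rw [rowCount, ← hm]
          push_cast
          rw [← pow_mul, ← pow_add, add_comm]
      _ ≤ _ := by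
          gcongr
          · norm_num
          · omega

/-- The search halts at a position at which the time bound is quasipolynomial with an arbitrarily
small constant. -/
theorem exists_search_bound (hA : RunsInTimeFMulNPowLittleO A) {c e : ℕ} (hc : 1 ≤ c)
    (K : ℕ) {ε : ℝ} (hε : 0 < ε) : ∀ᶠ n : ℕ in atTop, ∃ J X : ℕ, J + 1 ≤ n ∧
      (∀ G : SimpleGraph (Fin n), none ∉ (stepDist A c e G (Nat.clog 2 n) J).support) ∧
      2 * n ≤ X ∧ c ≤ X ∧ (e + 1) * 2 ^ (J / Nat.clog 2 n) ≤ X ∧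
      ((K * (J + 1) * X ^ 6 : ℕ) : ℝ) ≤ Real.exp (ε * Real.log n ^ 2) := by
  -- The factor 126 is `2 * 7 * 9`: the bound contains `(2 ^ i) ^ 7`, `L ^ 2` is at most nine times
  -- the squared logarithm, and half of `ε` is kept for lower-order terms. The cap at `1` gives `i ≤
  -- L ^ 2`, whence `J < n`.
  set θ : ℝ := min 1 (ε / 126) with hθ
  have hθ0 : 0 < θ := by positivity
  have hθ1 : θ ≤ 1 := min_le_left _ _
  have hθε : 126 * θ ≤ ε := by
    have := min_le_right 1 (ε / 126)
    rw [← hθ] at this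
    linarith
  obtain ⟨t, ht1, ht⟩ := exists_side_halts hA hc e hθ0
  set M : ℕ := (K + 1) * (c + e + 3) ^ 7 with hM
  have hlog : Tendsto (fun n : ℕ => Real.log n) atTop atTop :=
    Real.tendsto_log_atTop.comp tendsto_natCast_atTop_atTop
  filter_upwards [tendsto_clog.eventually ht,
    tendsto_clog.eventually (eventually_pow_le_two_pow 4 3), eventually_ge_atTop 3,
    hlog.eventually_ge_atTop ((Real.log M + 7) / (ε / 2)), hlog.eventually_ge_atTop 1]
    with n h1 h2 hn h4 h5
  set L := Nat.clog 2 n with hL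
  obtain ⟨htL, i, hi, hN, hH⟩ := h1
  have hL1 : 1 ≤ L := ht1.trans htL
  have hLn : 2 ^ (L - 1) < n := Nat.pow_pred_clog_lt_self (by omega) (by omega)
  have hdiv : (L * i + (L - t)) / L = i := by
    rw [Nat.mul_add_div (by omega), Nat.div_eq_of_lt (by omega), Nat.add_zero]
  have hiL : i ≤ L ^ 2 := by
    have : (i : ℝ) ≤ ((L ^ 2 : ℕ) : ℝ) := by
      push_cast
      nlinarith [sq_nonneg (L : ℝ)]
    exact_mod_cast this
  have hJn : L * i + (L - t) + 1 ≤ n := by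
    have e1 : L * i ≤ L * L ^ 2 := Nat.mul_le_mul_left _ hiL
    have e2 : L * L ^ 2 = L ^ 3 := by ring
    have e3 : L ≤ L ^ 3 := Nat.le_self_pow (by omega) _
    have e4 : 2 ^ L = 2 ^ (L - 1) * 2 := by rw [← pow_succ]; congr 1; omega
    omega
  refine ⟨L * i + (L - t), 2 * n + c + (e + 1) * 2 ^ i, hJn,
    fun G => none_notMem_stepDist ht1 htL hN hH, by omega, by omega, by rw [hdiv]; omega, ?_⟩
  have hX : 2 * n + c + (e + 1) * 2 ^ i ≤ (c + e + 3) * (n * 2 ^ i) := by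
    have hp : 1 ≤ 2 ^ i := Nat.one_le_two_pow
    have e1 : n ≤ n * 2 ^ i := Nat.le_mul_of_pos_right _ hp
    have e2 : 2 ^ i ≤ n * 2 ^ i := Nat.le_mul_of_pos_left _ (by omega)
    have e3 : 1 ≤ n * 2 ^ i := hp.trans e2
    nlinarith
  have hbound : K * (L * i + (L - t) + 1) * (2 * n + c + (e + 1) * 2 ^ i) ^ 6 ≤
      M * (n * 2 ^ i) ^ 7 := by
    have e1 : n ≤ (c + e + 3) * (n * 2 ^ i) := by
      have hp : 1 ≤ 2 ^ i := Nat.one_le_two_pow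
      have e1 : n ≤ n * 2 ^ i := Nat.le_mul_of_pos_right _ hp
      exact e1.trans (Nat.le_mul_of_pos_left _ (by omega))
    calc _ ≤ (K + 1) * ((c + e + 3) * (n * 2 ^ i)) * ((c + e + 3) * (n * 2 ^ i)) ^ 6 := by
          gcongr
          · omega
          · exact hJn.trans e1
      _ = _ := by rw [hM]; ring
  have hn0 : (0 : ℝ) < n := by positivity
  have hM0 : (0 : ℝ) < M := by
    have : 0 < M := by positivity
    exact_mod_cast this
  have hL3 := clog_le_three_mul_log hn
  rw [← hL] at hL3
  calc ((K * (L * i + (L - t) + 1) * (2 * n + c + (e + 1) * 2 ^ i) ^ 6 : ℕ) : ℝ)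
      ≤ ((M * (n * 2 ^ i) ^ 7 : ℕ) : ℝ) := by exact_mod_cast hbound
    _ = Real.exp (Real.log M + 7 * (Real.log n + i * Real.log 2)) := by
        push_cast
        rw [Real.exp_add, Real.exp_log hM0, ← Real.log_pow, ← Real.log_mul hn0.ne' (by positivity),
          show (7 : ℝ) * Real.log (n * 2 ^ i) = ((7 : ℕ) : ℝ) * Real.log (n * 2 ^ i) by norm_num,
          ← Real.log_pow, Real.exp_log (by positivity)]
    _ ≤ Real.exp (ε * Real.log n ^ 2) := by
        refine Real.exp_le_exp.2 ?_
        have e1 : Real.log 2 ≤ 1 := by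
          have := Real.log_two_lt_d9
          linarith
        have e2 : (i : ℝ) * Real.log 2 ≤ i * 1 := by gcongr
        have e3 : (L : ℝ) ^ 2 ≤ (3 * Real.log n) ^ 2 := by gcongr
        have e4 : θ * (L : ℝ) ^ 2 ≤ θ * (3 * Real.log n) ^ 2 := by gcongr
        have e5 : 126 * θ * Real.log n ^ 2 ≤ ε * Real.log n ^ 2 := by gcongr
        have e6 : Real.log M + 7 ≤ ε / 2 * Real.log n := by
          rw [div_le_iff₀ (by positivity)] at h4
          linarith
        have hM1 : 0 ≤ Real.log M := Real.log_natCast_nonneg _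
        have e7 : (Real.log M + 7) * Real.log n ≤ ε / 2 * Real.log n * Real.log n := by gcongr
        have e8 : Real.log M * 1 ≤ Real.log M * Real.log n := by gcongr
        nlinarith

end

/-! ### Refutation of SPCH by an approximation algorithm -/

section

variable {α β : Type} {p q : Prog} {s σ : MemState} {T T₁ T₂ : ℕ}
variable {n : ℕ} {G : SimpleGraph (Fin n)} {ℓ N X : ℕ} {w : ℕ → ℕ → ℕ}
variable {A : Prog} {V W r : ℕ}

theorem ContainsDoubleClique.containsBiclique {k : ℕ} (h : ContainsDoubleClique G k) :
    ContainsBiclique G k := by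
  obtain ⟨S, hS, hcard⟩ := h
  set φ : Fin k ⊕ Fin k ↪ Fin n :=
    (finSumFinEquiv.toEmbedding.trans (finCongr (two_mul k).symm).toEmbedding).trans
      (S.orderEmbOfFin hcard).toEmbedding with hφ
  refine ⟨⟨⟨φ, fun {x y} hxy => ?_⟩, φ.injective⟩⟩
  refine hS (S.orderEmbOfFin_mem hcard _) (S.orderEmbOfFin_mem hcard _) fun he => ?_
  exact hxy.ne (φ.injective he)

/-- The left side is at most `2 * n ^ 2`, hence at most `n ^ 3`, while the right side is at least
`n` to the power `δ * (e + 1)`. -/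
theorem eventually_card_le {δ : ℝ} {e : ℕ} (hδ : 3 ≤ δ * (e + 1)) :
    ∀ᶠ n : ℕ in atTop, n * 2 ^ Nat.clog 2 n ≤ ⌈(n : ℝ) ^ δ⌉₊ ^ (e + 1) := by
  filter_upwards [eventually_ge_atTop 2] with n hn
  have hL : 2 ^ Nat.clog 2 n ≤ 2 * n := by
    have h : 2 ^ (Nat.clog 2 n - 1) < n := Nat.pow_pred_clog_lt_self (by omega) (by omega)
    have := Nat.clog_pos (b := 2) (by omega) hn
    rw [show Nat.clog 2 n = Nat.clog 2 n - 1 + 1 by omega, pow_succ]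
    omega
  have hn1 : (1 : ℝ) ≤ n := by exact_mod_cast (by omega : 1 ≤ n)
  have h1 : (n : ℝ) ^ 3 ≤ (⌈(n : ℝ) ^ δ⌉₊ : ℝ) ^ (e + 1) := by
    calc (n : ℝ) ^ 3 = (n : ℝ) ^ (3 : ℝ) := by rw [← Real.rpow_natCast]; norm_num
      _ ≤ (n : ℝ) ^ (δ * (e + 1)) := Real.rpow_le_rpow_of_exponent_le hn1 hδ
      _ = ((n : ℝ) ^ δ) ^ (e + 1) := by
          rw [Real.rpow_mul (by positivity), ← Real.rpow_natCast]
          push_cast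
          rfl
      _ ≤ _ := by
          gcongr
          exact Nat.le_ceil _
  have h2 : n ^ 3 ≤ ⌈(n : ℝ) ^ δ⌉₊ ^ (e + 1) := by exact_mod_cast h1
  calc n * 2 ^ Nat.clog 2 n ≤ n * (2 * n) := Nat.mul_le_mul_left _ hL
    _ ≤ n * (n * n) := Nat.mul_le_mul_left _ (Nat.mul_le_mul_right _ hn)
    _ = n ^ 3 := by ring
    _ ≤ _ := h2

theorem not_exists_approximates_of_containsDoubleClique (hSPCH : SPCH) {C : ℝ} (hC : 0 < C) :
    ¬ ∃ A : Prog, RunsInTimeFMulNPowLittleO A ∧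
      ApproximatesBiclique C (fun G k => ContainsDoubleClique G k) A := by
  rintro ⟨A, hT, hA⟩
  obtain ⟨δ, hδ0, hδ1, hno⟩ := hSPCH
  obtain ⟨V, hV⟩ := A.exists_writesVar_bound
  obtain ⟨W, hW⟩ := A.exists_writesArr_bound
  -- The enlarged bounds include the input variables `x₀`, `x₁` and the input array `a₀`.
  have hV' : ∀ y, A.WritesVar y → y < V + 2 := fun y hy => (hV y hy).trans_le (by omega)
  have hW' : ∀ y, A.WritesArr y → y < W + 1 := fun y hy => (hW y hy).trans_le (by omega)
  set c : ℕ := ⌈C⌉₊ with hc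
  have hcC : C ≤ c := Nat.le_ceil C
  have hc1 : 1 ≤ c := Nat.ceil_pos.2 hC
  set e : ℕ := ⌈3 / δ⌉₊ with he
  have heδ : 3 / δ ≤ e := Nat.le_ceil _
  have he1 : 1 ≤ e := Nat.ceil_pos.2 (by positivity)
  have hδe : 3 ≤ δ * (e + 1) := by
    rw [div_le_iff₀ hδ0] at heδ
    nlinarith
  refine hno ⟨distinguisher A c e (V + 2) (W + 1), ?_, ?_⟩
  · refine quasiPolyLittleOTime_of_forall fun ε hε => ?_
    filter_upwards [exists_search_bound (e := e) hT hc1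
      (searchConst A e (V + 2) (W + 1) + 40) hε, eventually_ge_atTop 2] with n hn hn2
    obtain ⟨J, X, -, hJ, h1, h2, h3, h4⟩ := hn
    exact ⟨_, h4, fun G => (yields_distinguisher hV' hW' (by omega) (by omega) he1 G hn2 h1 h2 h3
      (hJ G)).outcome.1⟩
  -- The acceptance probabilities require only a position `J < n` at which all runs halt, so the
  -- time constant `0` and `ε = 1` suffice.
  · filter_upwards [exists_search_bound (e := e) hT hc1 0 one_pos, eventually_ge_atTop 3,
      eventually_card_le hδe, eventually_two_pow_mul_exp_le c,
      tendsto_clog.eventually (eventually_twelve_mul_pow_le (e + 1)),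
      eventually_pow_le_two_pow 6 2] with n hn hn3 hcard hexp hpow hsq
    obtain ⟨J, X, hJn, hJ, -⟩ := hn
    have hn1 : (1 : ℝ) ≤ n := by exact_mod_cast (by omega : 1 ≤ n)
    have hL2 : 2 ≤ Nat.clog 2 n := by
      by_contra h
      have h1 : 2 ^ Nat.clog 2 n ≤ 2 ^ 1 := Nat.pow_le_pow_right (by omega) (by omega)
      have := Nat.le_pow_clog (b := 2) (by omega) n
      omega
    refine ⟨le_acceptProb_plantedClique hC hcC hA hV' hW' (by omega) (by omega) he1 (by omega) hJ
      ?_ hcard hexp hJn ?_, acceptProb_erdosRenyiHalf_le hV' hW' (by omega) (by omega) he1 hn3 hJ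
      ?_ hpow hJn⟩
    · rw [Nat.ceil_le]
      calc (n : ℝ) ^ δ ≤ (n : ℝ) ^ (1 : ℝ) :=
            Real.rpow_le_rpow_of_exponent_le hn1 (by linarith)
        _ = n := Real.rpow_one _
    · refine le_trans ?_ hsq
      nlinarith
    · have h1 : 12 * Nat.clog 2 n ≤ (12 * Nat.clog 2 n) ^ (e + 1) := Nat.le_self_pow (by omega) _
      have h2 : 2 ^ (Nat.clog 2 n / 2) ≤ 2 ^ (Nat.clog 2 n - 1) :=
        Nat.pow_le_pow_right (by omega) (by omega)
      have h3 : 2 ^ (Nat.clog 2 n - 1) < n := Nat.pow_pred_clog_lt_self (by omega) (by omega)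
      omega

end

/-- The two halves of a clique on `2 * k` vertices form a biclique, so an algorithm for the biclique
promise also works under the clique promise, and the second claim implies the first. -/
theorem mainTheorem4 (hSPCH : SPCH) (C : ℝ) (hC : 0 < C) :
    (¬ ∃ A : Prog, RunsInTimeFMulNPowLittleO A ∧
      ApproximatesBiclique C (fun G k => ContainsBiclique G k) A) ∧
    (¬ ∃ A : Prog, RunsInTimeFMulNPowLittleO A ∧
      ApproximatesBiclique C (fun G k => ContainsDoubleClique G k) A) := by
  have h := not_exists_approximates_of_containsDoubleClique hSPCH hC
  refine ⟨?_, h⟩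
  rintro ⟨A, hT, hA⟩
  exact h ⟨A, hT, fun n k G hk hG => hA n k G hk hG.containsBiclique⟩
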